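/- Let $\mathbf V$ be a symmetric monoidal category with unit object $1$ that has small coproducts, over which $\otimes$ distributes, and finite limits, and let $I$ be a small category. For a set $S$ put $S\otimes 1=\coprod_{S}1$ (so $S\mapsto S\otimes 1$ is left adjoint to $\mathrm{Mor}_{\mathbf V}(1,-)$), and let $I\otimes 1$ be the $\mathbf V$-category with the objects of $I$ and with $(I\otimes 1)(i,j)=\mathrm{Mor}_I(i,j)\otimes 1$; the diagonals of the sets $\mathrm{Mor}_I(i,j)$ make it a coalgebra in $\mathbf V$-categories. Write $\mathbf V\text{-}\mathbf{Cat}$ for the $2$-category of small $\mathbf V$-categories. *Graded categories.* An $I$-graded $\mathbf V$-category is a small $\mathbf V$-category $E$ with a coassociative and counital coaction $\mu:E\to E\otimes(I\otimes 1)$; on objects $\mu(e)=(e,\deg e)$. A left morphism $(E,\mu)\to(E',\mu')$ is a $\mathbf V$-functor $F$ with a $\mathbf V$-natural transformation $\varphi:\mu'\circ F\Rightarrow(F\otimes 1)\circ\mu$; it is degree-preserving if there are morphisms $\varphi_2(e):\deg F(e)\to\deg e$ of $I$ with $\varphi(e)=1_{F(e)}\otimes\varphi_2(e)$ for all $e$.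 A $2$-morphism $(F,\varphi)\to(G,\psi)$ is a $\mathbf V$-natural transformation $\xi:F\Rightarrow G$ with $\psi\circ(\mu'\circ\xi)=((\xi\otimes 1)\circ\mu)\circ\varphi$. These data form the $2$-category $\mathbf V\text{-}\mathbf{Cat}^{l}_I$ of $I$-graded $\mathbf V$-categories and degree-preserving left morphisms. *Oplax functors.* An oplax functor $X:I\to\mathbf V\text{-}\mathbf{Cat}$ has structure $2$-cells $\eta_i:X(1_i)\Rightarrow 1_{X(i)}$ and $\theta_{v,u}:X(v u)\Rightarrow X(v)X(u)$. A left transformation $F:X\to Y$ of oplax functors consists of $\mathbf V$-functors $F(i):X(i)\to Y(i)$ and $2$-cells $\varphi(u):Y(u)F(i)\Rightarrow F(j)X(u)$ for $u:i\to j$, compatible with the structure $2$-cells. With modifications as morphisms, the left transformations $X\to Y$ form a category $\mathrm{Oplax}^{l}(X,Y)$. The Grothendieck construction $\mathrm{Gr}(X)$ is the $I$-graded $\mathbf V$-category with objects the pairs $(x,i)$, $x\in X(i)$, of degree $i$, with $$\mathrm{Gr}(X)((x,i),(y,j))=\coprod_{u:i\to j}X(j)(X(u)(x),y),$$ where the $u$-th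 summand is of degree $u$, with composition induced by $(g,v)\circ(f,u)=(g\circ X(v)(f)\circ\theta_{v,u},\,vu)$, and with identities $(\eta_i,1_i)$. It extends to functors $\mathrm{Gr}:\mathrm{Oplax}^{l}(X,Y)\to\mathbf V\text{-}\mathbf{Cat}^{l}_I(\mathrm{Gr}(X),\mathrm{Gr}(Y))$. *Fibres and precofibered categories.* Let $\mu:E\to E\otimes(I\otimes 1)$ be $I$-graded and $i\in I$. The $\mathbf V$-category $\mu\downarrow i$ has as objects the pairs $(e,u)$ with $u:\deg e\to i$, and its morphism object from $(e,u)$ to $(e',u')$ is the equalizer of $$u'_*\circ\mu,\ 1\otimes u\;:\;E(e,e')\rightrightarrows E(e,e')\otimes(\mathrm{Mor}_I(\deg e,i)\otimes 1).$$ The fibre $E|_i$ has as objects the objects of $E$ of degree $i$, and its morphism object from $e$ to $e'$ is the equalizer of $\mu$ and $1\otimes 1_i$. There is a $\mathbf V$-functor $i_i:E|_i\to\mu\downarrow i$, $e\mapsto(e,1_i)$. Composition with the morphisms of $I$ makes $\Gamma(\mu)(i)=\mu\downarrow i$ functorial in $i$. A precofibered structure on $\mu$ is a choice, for every $i$, of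 a left adjoint $s_i:\mu\downarrow i\to E|_i$ of $i_i$, with unit $\eta_i:1\Rightarrow i_i s_i$ and counit $\varepsilon_i:s_i i_i\Rightarrow 1$. It defines an oplax functor $\Gamma_{\mathrm{cof}}(\mu):I\to\mathbf V\text{-}\mathbf{Cat}$ by $\Gamma_{\mathrm{cof}}(\mu)(i)=E|_i$ and $\Gamma_{\mathrm{cof}}(\mu)(u)=s_j\circ\Gamma(\mu)(u)\circ i_i$ for $u:i\to j$, with structure $2$-cells $\Gamma_{\mathrm{cof}}(\mu)(vu)\Rightarrow\Gamma_{\mathrm{cof}}(\mu)(v)\Gamma_{\mathrm{cof}}(\mu)(u)$ given by the units and $\Gamma_{\mathrm{cof}}(\mu)(1_i)=s_i i_i\Rightarrow 1$ given by the counits. **Corollary.** Let $\mu:E\to E\otimes(I\otimes1)$ be an $I$-graded $\mathbf V$-category with a precofibered structure such that all $\varepsilon_i:s_i i_i\Rightarrow 1_{E|_i}$ and all $\eta_i:1_{\mu\downarrow i}\Rightarrow i_i s_i$ are isomorphisms. Then for every oplax functor $X:I\to\mathbf V\text{-}\mathbf{Cat}$ there is an equivalence of categories $$\mathbf V\text{-}\mathbf{Cat}^{l}_I(\mathrm{Gr}(X),\mu)\;\simeq\;\mathrm{Oplax}^{l}(X,\Gamma_{\mathrm{cof}}(\mu)).$$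 In this sense $\Gamma_{\mathrm{cof}}$ is weakly right adjoint to $\mathrm{Gr}$: there is a single degree-preserving left morphism $\epsilon:\mathrm{Gr}(\Gamma_{\mathrm{cof}}(\mu))\to\mu$ such that for every $X$ such an equivalence can be chosen with its inverse isomorphic to the functor $F\mapsto\epsilon\circ\mathrm{Gr}(F)$. -/

import Mathlib

open CategoryTheory MonoidalCategory Limits
open scoped Oplax.LaxTrans

universe w v u w₁ w₂ w₃ w₄

set_option linter.unusedSectionVars false

namespace GradedV

/-! ### Enriched categories, functors and natural transformations -/

section Enriched

variable {V : Type u} [Category.{v} V] [MonoidalCategory V]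
variable {C : Type w₁} [EnrichedCategory V C] {D : Type w₂} [EnrichedCategory V D]
  {D' : Type w₃} [EnrichedCategory V D']

/-- Composition `f_*` with a morphism of the underlying category. -/
def post {a b : C} (c : C) (f : 𝟙_ V ⟶ (a ⟶[V] b)) : (c ⟶[V] a) ⟶ (c ⟶[V] b) :=
  (ρ_ _).inv ≫ _ ◁ f ≫ eComp V c a b

/-- Composition `f^*` with a morphism of the underlying category. -/
def pre {a b : C} (f : 𝟙_ V ⟶ (a ⟶[V] b)) (c : C) : (b ⟶[V] c) ⟶ (a ⟶[V] c) :=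
  (λ_ _).inv ≫ f ▷ _ ≫ eComp V a b c

lemma post_eId (a c : C) : post c (eId V a) = 𝟙 (c ⟶[V] a) := e_comp_id V c a

lemma pre_eId (a c : C) : pre (eId V a) c = 𝟙 (a ⟶[V] c) := e_id_comp V a c

lemma comp_post {a b c d : C} (f : 𝟙_ V ⟶ (c ⟶[V] d)) :
    eComp V a b c ≫ post a f = (a ⟶[V] b) ◁ post b f ≫ eComp V a b d := by
  simp only [post, MonoidalCategory.whiskerLeft_comp, Category.assoc]
  rw [rightUnitor_inv_naturality_assoc, ← whisker_exchange_assoc, ← e_assoc' V a b c d]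
  simp

lemma comp_pre {a b c d : C} (f : 𝟙_ V ⟶ (a ⟶[V] b)) :
    eComp V b c d ≫ pre f d = pre f c ▷ (c ⟶[V] d) ≫ eComp V a c d := by
  simp only [pre, comp_whiskerRight, Category.assoc]
  rw [leftUnitor_inv_naturality_assoc, whisker_exchange_assoc, ← e_assoc' V a b c d]
  simp [-e_assoc, -e_assoc_assoc]

lemma post_comp {a b c d : C} (f : 𝟙_ V ⟶ (b ⟶[V] c)) :
    post a f ▷ (c ⟶[V] d) ≫ eComp V a c d = (a ⟶[V] b) ◁ pre f d ≫ eComp V a b d := by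
  simp only [pre, post, comp_whiskerRight, MonoidalCategory.whiskerLeft_comp, Category.assoc,
    ← e_assoc V a b c d]
  simp

/-- Composition in the underlying category. -/
def ucomp {a b c : C} (f : 𝟙_ V ⟶ (a ⟶[V] b)) (g : 𝟙_ V ⟶ (b ⟶[V] c)) : 𝟙_ V ⟶ (a ⟶[V] c) :=
  (λ_ _).inv ≫ (f ⊗ₘ g) ≫ eComp V a b c

lemma ucomp_eq_post {a b c : C} (f : 𝟙_ V ⟶ (a ⟶[V] b)) (g : 𝟙_ V ⟶ (b ⟶[V] c)) :
    ucomp f g = f ≫ post a g := by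
  rw [ucomp, post, MonoidalCategory.tensorHom_def, rightUnitor_inv_naturality_assoc,
    unitors_inv_equal, Category.assoc]

lemma ucomp_eq_pre {a b c : C} (f : 𝟙_ V ⟶ (a ⟶[V] b)) (g : 𝟙_ V ⟶ (b ⟶[V] c)) :
    ucomp f g = g ≫ pre f c := by
  rw [ucomp, pre, MonoidalCategory.tensorHom_def', leftUnitor_inv_naturality_assoc,
    Category.assoc]

lemma post_ucomp {a b c : C} (d : C) (f : 𝟙_ V ⟶ (a ⟶[V] b)) (g : 𝟙_ V ⟶ (b ⟶[V] c)) :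
    post d (ucomp f g) = post d f ≫ post d g := by
  conv_rhs => rw [post]
  simp only [Category.assoc, comp_post]
  simp [post, ucomp_eq_post]

lemma pre_ucomp {a b c : C} (d : C) (f : 𝟙_ V ⟶ (a ⟶[V] b)) (g : 𝟙_ V ⟶ (b ⟶[V] c)) :
    pre (ucomp f g) d = pre g d ≫ pre f d := by
  conv_rhs => rw [pre]
  simp only [Category.assoc, comp_pre]
  simp [pre, ucomp_eq_pre]

lemma pre_post {a b c d : C} (f : 𝟙_ V ⟶ (a ⟶[V] b)) (g : 𝟙_ V ⟶ (c ⟶[V] d)) :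
    pre f c ≫ post a g = post b g ≫ pre f d := by
  simp only [pre, Category.assoc, comp_post, leftUnitor_inv_naturality_assoc,
    whisker_exchange_assoc]

lemma map_post (F : EnrichedFunctor V C D) {a b : C} (c : C) (f : 𝟙_ V ⟶ (a ⟶[V] b)) :
    post c f ≫ F.map c b = F.map c a ≫ post (F.obj c) (f ≫ F.map a b) := by
  simp only [post, Category.assoc, F.map_comp, MonoidalCategory.tensorHom_def,
    MonoidalCategory.whiskerLeft_comp]
  rw [rightUnitor_inv_naturality_assoc, whisker_exchange_assoc]

lemma map_pre (F : EnrichedFunctor V C D) {a b : C} (c : C) (f : 𝟙_ V ⟶ (a ⟶[V] b)) :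
    pre f c ≫ F.map a c = F.map b c ≫ pre (f ≫ F.map a b) (F.obj c) := by
  simp only [pre, Category.assoc, F.map_comp, MonoidalCategory.tensorHom_def',
    comp_whiskerRight]
  rw [leftUnitor_inv_naturality_assoc, ← whisker_exchange_assoc]

lemma ucomp_assoc {a b c d : C} (f : 𝟙_ V ⟶ (a ⟶[V] b)) (g : 𝟙_ V ⟶ (b ⟶[V] c))
    (h : 𝟙_ V ⟶ (c ⟶[V] d)) : ucomp (ucomp f g) h = ucomp f (ucomp g h) := by
  simp only [ucomp_eq_post f, ucomp_eq_post _ h, Category.assoc, ← post_ucomp]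

lemma ucomp_eId {a b : C} (f : 𝟙_ V ⟶ (a ⟶[V] b)) : ucomp f (eId V b) = f := by
  rw [ucomp_eq_post, post_eId, Category.comp_id]

lemma eId_ucomp {a b : C} (f : 𝟙_ V ⟶ (a ⟶[V] b)) : ucomp (eId V a) f = f := by
  rw [ucomp_eq_pre, pre_eId, Category.comp_id]

lemma ucomp_map (F : EnrichedFunctor V C D) {a b c : C} (f : 𝟙_ V ⟶ (a ⟶[V] b))
    (g : 𝟙_ V ⟶ (b ⟶[V] c)) :
    ucomp f g ≫ F.map a c = ucomp (f ≫ F.map a b) (g ≫ F.map b c) := by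
  simp only [ucomp_eq_post, Category.assoc, map_post]

/-- The identity `V`-functor. -/
abbrev fid (C : Type w₁) [EnrichedCategory V C] : EnrichedFunctor V C C where
  obj x := x
  map x y := 𝟙 _

/-- Composition of `V`-functors. -/
abbrev fcomp (F : EnrichedFunctor V C D) (G : EnrichedFunctor V D D') :
    EnrichedFunctor V C D' where
  obj x := G.obj (F.obj x)
  map x y := F.map x y ≫ G.map (F.obj x) (F.obj y)

/-- `V`-natural transformations. -/
@[ext]
structure VNat (F G : EnrichedFunctor V C D) where
  app (x : C) : 𝟙_ V ⟶ (F.obj x ⟶[V] G.obj x)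
  naturality (x y : C) :
    F.map x y ≫ post (F.obj x) (app y) = G.map x y ≫ pre (app x) (G.obj y)

namespace VNat

variable {F G H K : EnrichedFunctor V C D}

/-- The identity `V`-natural transformation. -/
@[simps]
def id (F : EnrichedFunctor V C D) : VNat F F where
  app x := eId V (F.obj x)
  naturality x y := by rw [post_eId, pre_eId]

/-- Vertical composition. -/
@[simps]
def vcomp (α : VNat F G) (β : VNat G H) : VNat F H where
  app x := ucomp (α.app x) (β.app x)
  naturality x y := by
    rw [post_ucomp, pre_ucomp, ← Category.assoc, α.naturality, Category.assoc, pre_post,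
      ← Category.assoc, β.naturality, Category.assoc]

/-- Whiskering with a `V`-functor applied first. -/
@[simps]
def whiskerLeft (F : EnrichedFunctor V C D) {G H : EnrichedFunctor V D D'} (α : VNat G H) :
    VNat (fcomp F G) (fcomp F H) where
  app x := α.app (F.obj x)
  naturality x y := by
    rw [Category.assoc, α.naturality, Category.assoc]

/-- Whiskering with a `V`-functor applied last. -/
@[simps]
def whiskerRight (α : VNat F G) (H : EnrichedFunctor V D D') :
    VNat (fcomp F H) (fcomp G H) where
  app x := α.app x ≫ H.map _ _
  naturality x y := by
    rw [Category.assoc, ← map_post, Category.assoc, ← map_pre, ← Category.assoc, α.naturality,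
      Category.assoc]

/-- The `V`-natural transformation with identity components. -/
@[simps]
def ofEq {F₀ : C → D} {m m' : ∀ x y, (x ⟶[V] y) ⟶ (F₀ x ⟶[V] F₀ y)} {h₁ h₂ h₁' h₂'}
    (h : ∀ x y, m x y = m' x y) :
    VNat (V := V) (EnrichedFunctor.mk F₀ m h₁ h₂) (EnrichedFunctor.mk F₀ m' h₁' h₂') where
  app x := eId V (F₀ x)
  naturality x y := by simp [post_eId, pre_eId, h]

end VNat

end Enriched

/-- Small `V`-categories. -/
structure VCat (V : Type u) [Category.{v} V] [MonoidalCategory V] where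
  /-- the type of objects -/
  carrier : Type w
  [str : EnrichedCategory V carrier]

namespace VCat

variable {V : Type u} [Category.{v} V] [MonoidalCategory V]

instance : CoeSort (VCat.{w} V) (Type w) := ⟨VCat.carrier⟩

instance (C : VCat.{w} V) : EnrichedCategory V C := C.str

instance : CategoryStruct (VCat.{w} V) where
  Hom C D := EnrichedFunctor V C D
  id C := fid C
  comp F G := fcomp F G

instance (C D : VCat.{w} V) : Category (C ⟶ D) where
  Hom F G := VNat (V := V) F G
  id F := VNat.id F
  comp α β := VNat.vcomp α β
  id_comp _ := VNat.ext (funext fun _ => eId_ucomp _)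
  comp_id _ := VNat.ext (funext fun _ => ucomp_eId _)
  assoc _ _ _ := VNat.ext (funext fun _ => ucomp_assoc _ _ _)

/-- The isomorphism with identity components between two `V`-functors with the same values. -/
def isoOfEq {C D : VCat.{w} V} {F₀ : C → D} {m m' : ∀ x y, (x ⟶[V] y) ⟶ (F₀ x ⟶[V] F₀ y)}
    {h₁ h₂ h₁' h₂'} (h : ∀ x y, m x y = m' x y) :
    (show C ⟶ D from EnrichedFunctor.mk F₀ m h₁ h₂) ≅
      (show C ⟶ D from EnrichedFunctor.mk F₀ m' h₁' h₂') where
  hom := VNat.ofEq h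
  inv := VNat.ofEq fun x y => (h x y).symm
  hom_inv_id := VNat.ext (funext fun _ => eId_ucomp _)
  inv_hom_id := VNat.ext (funext fun _ => eId_ucomp _)

lemma hom_ext {C D : VCat.{w} V} {F G : C ⟶ D} {α β : F ⟶ G} (h : ∀ x, α.app x = β.app x) :
    α = β := VNat.ext (funext h)

/-- The 2-category of small `V`-categories, `V`-functors and `V`-natural transformations. -/
instance : Bicategory (VCat.{w} V) where
  whiskerLeft F _ _ α := VNat.whiskerLeft F α
  whiskerRight α H := VNat.whiskerRight α H
  associator F G H := isoOfEq fun x y => Category.assoc _ _ _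
  leftUnitor F := isoOfEq fun x y => Category.id_comp _
  rightUnitor F := isoOfEq fun x y => Category.comp_id _
  whiskerLeft_id _ _ := rfl
  whiskerLeft_comp _ _ _ _ _ _ := rfl
  id_whiskerLeft α := by
    refine hom_ext fun x => ?_
    change α.app x = ucomp (eId V _) (ucomp (α.app x) (eId V _))
    rw [eId_ucomp, ucomp_eId]
  comp_whiskerLeft F G _ _ α := by
    refine hom_ext fun x => ?_
    change α.app (G.obj (F.obj x)) = ucomp (eId V _) (ucomp (α.app _) (eId V _))
    rw [eId_ucomp, ucomp_eId]
  id_whiskerRight F G := hom_ext fun x => G.map_id _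
  comp_whiskerRight α β H := hom_ext fun x => ucomp_map H _ _
  whiskerRight_id α := by
    refine hom_ext fun x => ?_
    change α.app x ≫ 𝟙 _ = ucomp (eId V _) (ucomp (α.app x) (eId V _))
    rw [eId_ucomp, ucomp_eId, Category.comp_id]
  whiskerRight_comp α G H := by
    refine hom_ext fun x => ?_
    change α.app x ≫ G.map _ _ ≫ H.map _ _ =
      ucomp (eId V _) (ucomp ((α.app x ≫ G.map _ _) ≫ H.map _ _) (eId V _))
    rw [eId_ucomp, ucomp_eId, Category.assoc]
  whisker_assoc F G H α K := by
    refine hom_ext fun x => ?_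
    change α.app (F.obj x) ≫ K.map _ _ =
      ucomp (eId V _) (ucomp (α.app (F.obj x) ≫ K.map _ _) (eId V _))
    rw [eId_ucomp, ucomp_eId]
  whisker_exchange {_ _ _ F G H K} α β := by
    refine hom_ext fun x => ?_
    change ucomp (β.app (F.obj x)) (α.app x ≫ K.map _ _) =
      ucomp (α.app x ≫ H.map _ _) (β.app (G.obj x))
    rw [ucomp_eq_pre, ucomp_eq_post, Category.assoc, Category.assoc, β.naturality]
  pentagon F G H K := by
    refine hom_ext fun x => ?_
    change ucomp (eId V _ ≫ K.map _ _) (ucomp (eId V _) (eId V _)) = ucomp (eId V _) (eId V _)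
    rw [K.map_id, eId_ucomp]
  triangle F G := by
    refine hom_ext fun x => ?_
    change ucomp (eId V _) (eId V _) = eId V _ ≫ G.map _ _
    rw [G.map_id, eId_ucomp]

section

variable {C D D' D'' : VCat.{w} V}

@[simp] lemma id_obj (x : C) : (𝟙 C : C ⟶ C).obj x = x := rfl
@[simp] lemma comp_obj (F : C ⟶ D) (G : D ⟶ D') (x : C) : (F ≫ G).obj x = G.obj (F.obj x) := rfl
@[simp] lemma id_app (F : C ⟶ D) (x : C) : (𝟙 F : F ⟶ F).app x = eId V (F.obj x) := rfl
@[simp] lemma comp_app {F G H : C ⟶ D} (α : F ⟶ G) (β : G ⟶ H) (x : C) :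
    (α ≫ β).app x = ucomp (α.app x) (β.app x) := rfl
@[simp] lemma whiskerLeft_app (F : C ⟶ D) {G H : D ⟶ D'} (α : G ⟶ H) (x : C) :
    (Bicategory.whiskerLeft F α).app x = α.app (F.obj x) := rfl
@[simp] lemma whiskerRight_app {F G : C ⟶ D} (α : F ⟶ G) (H : D ⟶ D') (x : C) :
    (Bicategory.whiskerRight α H).app x = α.app x ≫ H.map (F.obj x) (G.obj x) := rfl
@[simp] lemma leftUnitor_hom_app (F : C ⟶ D) (x : C) :
    (Bicategory.leftUnitor F).hom.app x = eId V (F.obj x) := rfl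
@[simp] lemma leftUnitor_inv_app (F : C ⟶ D) (x : C) :
    (Bicategory.leftUnitor F).inv.app x = eId V (F.obj x) := rfl
@[simp] lemma rightUnitor_hom_app (F : C ⟶ D) (x : C) :
    (Bicategory.rightUnitor F).hom.app x = eId V (F.obj x) := rfl
@[simp] lemma rightUnitor_inv_app (F : C ⟶ D) (x : C) :
    (Bicategory.rightUnitor F).inv.app x = eId V (F.obj x) := rfl
@[simp] lemma associator_hom_app (F : C ⟶ D) (G : D ⟶ D') (H : D' ⟶ D'') (x : C) :
    (Bicategory.associator F G H).hom.app x = eId V (H.obj (G.obj (F.obj x))) := rfl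
@[simp] lemma associator_inv_app (F : C ⟶ D) (G : D ⟶ D') (H : D' ⟶ D'') (x : C) :
    (Bicategory.associator F G H).inv.app x = eId V (H.obj (G.obj (F.obj x))) := rfl

end

end VCat

/-! ### Free objects, the free `V`-category on a category, and tensor products -/

noncomputable section Tensor

variable {V : Type u} [Category.{v} V] [MonoidalCategory V]

/-- The morphism `1 ≅ 1 ⊗ 1 ⟶ A ⊗ B` given by two morphisms out of the unit. -/
def tpair {A B : V} (f : 𝟙_ V ⟶ A) (g : 𝟙_ V ⟶ B) : 𝟙_ V ⟶ A ⊗ B := (λ_ _).inv ≫ (f ⊗ₘ g)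

lemma tpair_tensorHom {A B A' B' : V} (f : 𝟙_ V ⟶ A) (g : 𝟙_ V ⟶ B) (a : A ⟶ A') (b : B ⟶ B') :
    tpair f g ≫ (a ⊗ₘ b) = tpair (f ≫ a) (g ≫ b) := by
  simp [tpair]

variable [SymmetricCategory V]

/-- The tensor product of two `V`-categories. -/
instance tensorEnriched (C : Type w₁) [EnrichedCategory V C] (D : Type w₂)
    [EnrichedCategory V D] : EnrichedCategory V (C × D) where
  Hom a b := (a.1 ⟶[V] b.1) ⊗ (a.2 ⟶[V] b.2)
  id a := tpair (eId V a.1) (eId V a.2)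
  comp a b c := tensorμ _ _ _ _ ≫ (eComp V a.1 b.1 c.1 ⊗ₘ eComp V a.2 b.2 c.2)
  id_comp a b := by
    rw [Iso.inv_comp_eq, tensor_left_unitality]
    simp only [tpair, comp_whiskerRight, Category.assoc, tensorμ_natural_left_assoc,
      tensorHom_comp_tensorHom, Category.comp_id]
    rw [← Category.comp_id (λ_ _).hom, ← Category.comp_id (λ_ (a.2 ⟶[V] b.2)).hom,
      (Iso.inv_comp_eq _).1 (e_id_comp V a.1 b.1), (Iso.inv_comp_eq _).1 (e_id_comp V a.2 b.2)]
  comp_id a b := by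
    rw [Iso.inv_comp_eq, tensor_right_unitality]
    simp only [tpair, MonoidalCategory.whiskerLeft_comp, Category.assoc,
      tensorμ_natural_right_assoc,
      tensorHom_comp_tensorHom, Category.comp_id]
    rw [← Category.comp_id (ρ_ _).hom, ← Category.comp_id (ρ_ (a.2 ⟶[V] b.2)).hom,
      (Iso.inv_comp_eq _).1 (e_comp_id V a.1 b.1), (Iso.inv_comp_eq _).1 (e_comp_id V a.2 b.2)]
  assoc a b c d := by
    rw [Iso.inv_comp_eq]
    have := tensor_associativity (a.1 ⟶[V] b.1) (a.2 ⟶[V] b.2) (b.1 ⟶[V] c.1)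
      (b.2 ⟶[V] c.2) (c.1 ⟶[V] d.1) (c.2 ⟶[V] d.2)
    simp only [comp_whiskerRight, MonoidalCategory.whiskerLeft_comp, Category.assoc,
      tensorμ_natural_left_assoc, tensorμ_natural_right_assoc, tensorHom_comp_tensorHom,
      ← e_assoc' V]
    rw [← reassoc_of% this]
    simp only [tensorHom_comp_tensorHom]

/-- The tensor product of two small `V`-categories. -/
abbrev tensorCat (C D : VCat.{w} V) : VCat.{w} V where
  carrier := C × D

end Tensor

noncomputable section Free

variable (V : Type u) [Category.{v} V] [MonoidalCategory V] [HasCoproducts.{w} V]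

/-- The free object `S ⊗ 1` on a set `S`, i.e. the coproduct of `S` copies of the unit. -/
abbrev freeObj (S : Type w) : V := ∐ fun _ : S => 𝟙_ V

/-- `S ↦ S ⊗ 1` is left adjoint to the underlying set functor `A ↦ Mor(1, A)`. -/
def freeObjEquiv (S : Type w) (A : V) : (freeObj V S ⟶ A) ≃ (S → (𝟙_ V ⟶ A)) where
  toFun f s := Sigma.ι (fun _ : S => 𝟙_ V) s ≫ f
  invFun f := Sigma.desc f
  left_inv f := by ext; simp
  right_inv f := by ext; simp

variable {V}

/-- The element of `S ⊗ 1` given by `s ∈ S`. -/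
def single {S : Type w} (s : S) : 𝟙_ V ⟶ freeObj V S := Sigma.ι (fun _ : S => 𝟙_ V) s

lemma free_ext {S : Type w} {A : V} {f g : freeObj V S ⟶ A} (h : ∀ s, single s ≫ f = single s ≫ g) :
    f = g := Sigma.hom_ext _ _ h

/-- Functoriality of `S ↦ S ⊗ 1`. -/
def freeMap {S T : Type w} (f : S → T) : freeObj V S ⟶ freeObj V T :=
  Sigma.desc fun s => single (f s)

@[simp]
lemma single_freeMap {S T : Type w} (f : S → T) (s : S) :
    single s ≫ freeMap f = single (V := V) (f s) := by
  simp [single, freeMap]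

/-- The coproduct of the comonoid `S ⊗ 1`. -/
def comul (S : Type w) : freeObj V S ⟶ freeObj V S ⊗ freeObj V S :=
  Sigma.desc fun s => (λ_ _).inv ≫ (single s ⊗ₘ single s)

/-- The counit of the comonoid `S ⊗ 1`. -/
def counit (S : Type w) : freeObj V S ⟶ 𝟙_ V := Sigma.desc fun _ => 𝟙 _

@[simp]
lemma single_comul {S : Type w} (s : S) :
    single s ≫ comul S = tpair (V := V) (single s) (single s) := by
  simp [single, comul, tpair]

@[simp]
lemma single_counit {S : Type w} (s : S) : single s ≫ counit S = 𝟙 (𝟙_ V) := by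
  simp [single, counit]

variable [SymmetricCategory V]
  [∀ (A : V) (J : Type w), PreservesColimitsOfShape (Discrete J) (tensorLeft A)]

/-- The tensor product distributes over coproducts on the left. -/
def distribLeft {J : Type w} (A : V) (B : J → V) : A ⊗ (∐ B) ≅ ∐ fun j => A ⊗ B j :=
  PreservesCoproduct.iso (tensorLeft A) B

/-- The tensor product distributes over coproducts on the right. -/
def distribRight {J : Type w} (A : J → V) (B : V) : (∐ A) ⊗ B ≅ ∐ fun j => A j ⊗ B :=
  β_ _ _ ≪≫ distribLeft B A ≪≫ Sigma.mapIso fun _ => β_ _ _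

lemma ι_distribLeft {J : Type w} (A : V) (B : J → V) (j : J) :
    A ◁ Sigma.ι B j ≫ (distribLeft A B).hom = Sigma.ι (fun j => A ⊗ B j) j := by
  rw [← Iso.eq_comp_inv, distribLeft, PreservesCoproduct.inv_hom]
  exact (ι_comp_sigmaComparison (tensorLeft A) B j).symm

lemma ι_distribRight {J : Type w} (A : J → V) (B : V) (j : J) :
    Sigma.ι A j ▷ B ≫ (distribRight A B).hom = Sigma.ι (fun j => A j ⊗ B) j := by
  have h := ι_distribLeft B A j
  simp [distribRight, BraidedCategory.braiding_naturality_left_assoc, reassoc_of% h]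

lemma whiskerLeft_sigma_ext {J : Type w} {A : V} {B : J → V} {Z : V} {f g : A ⊗ (∐ B) ⟶ Z}
    (h : ∀ j, A ◁ Sigma.ι B j ≫ f = A ◁ Sigma.ι B j ≫ g) : f = g := by
  rw [← cancel_epi (distribLeft A B).inv]
  refine Sigma.hom_ext _ _ fun j => ?_
  rw [← ι_distribLeft]
  simpa using h j

lemma whiskerRight_sigma_ext {J : Type w} {A : J → V} {B : V} {Z : V} {f g : (∐ A) ⊗ B ⟶ Z}
    (h : ∀ j, Sigma.ι A j ▷ B ≫ f = Sigma.ι A j ▷ B ≫ g) : f = g := by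
  rw [← cancel_epi (distribRight A B).inv]
  refine Sigma.hom_ext _ _ fun j => ?_
  rw [← ι_distribRight]
  simpa using h j

lemma tensor_sigma_ext {J K : Type w} {A : J → V} {B : K → V} {Z : V} {f g : (∐ A) ⊗ (∐ B) ⟶ Z}
    (h : ∀ j k, (Sigma.ι A j ⊗ₘ Sigma.ι B k) ≫ f = (Sigma.ι A j ⊗ₘ Sigma.ι B k) ≫ g) : f = g := by
  refine whiskerRight_sigma_ext fun j => whiskerLeft_sigma_ext fun k => ?_
  simpa [MonoidalCategory.tensorHom_def', Category.assoc] using h j k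

lemma whiskerLeft_left_sigma_ext {J : Type w} {A A' : V} {B : J → V} {Z : V}
    {f g : A' ⊗ (A ⊗ (∐ B)) ⟶ Z}
    (h : ∀ j, A' ◁ A ◁ Sigma.ι B j ≫ f = A' ◁ A ◁ Sigma.ι B j ≫ g) : f = g := by
  rw [← cancel_epi (A' ◁ (distribLeft A B).inv)]
  refine whiskerLeft_sigma_ext fun j => ?_
  have e : Sigma.ι (fun j => A ⊗ B j) j ≫ (distribLeft A B).inv = A ◁ Sigma.ι B j := by
    rw [Iso.comp_inv_eq, ι_distribLeft]
  rw [← whiskerLeft_comp_assoc, ← whiskerLeft_comp_assoc, e, h]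

lemma whiskerLeft_right_sigma_ext {J : Type w} {B A' : V} {A : J → V} {Z : V}
    {f g : A' ⊗ ((∐ A) ⊗ B) ⟶ Z}
    (h : ∀ j, A' ◁ Sigma.ι A j ▷ B ≫ f = A' ◁ Sigma.ι A j ▷ B ≫ g) : f = g := by
  rw [← cancel_epi (A' ◁ (distribRight A B).inv)]
  refine whiskerLeft_sigma_ext fun j => ?_
  have e : Sigma.ι (fun j => A j ⊗ B) j ≫ (distribRight A B).inv = Sigma.ι A j ▷ B := by
    rw [Iso.comp_inv_eq, ι_distribRight]
  rw [← whiskerLeft_comp_assoc, ← whiskerLeft_comp_assoc, e, h]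

lemma tensor_sigma_ext₃ {J K L : Type w} {A : J → V} {B : K → V} {C : L → V} {Z : V}
    {f g : ((∐ A) ⊗ (∐ B)) ⊗ (∐ C) ⟶ Z}
    (h : ∀ j k l, ((Sigma.ι A j ⊗ₘ Sigma.ι B k) ⊗ₘ Sigma.ι C l) ≫ f =
      ((Sigma.ι A j ⊗ₘ Sigma.ι B k) ⊗ₘ Sigma.ι C l) ≫ g) : f = g := by
  rw [← cancel_epi (α_ _ _ _).inv]
  refine whiskerRight_sigma_ext fun j => whiskerLeft_right_sigma_ext fun k =>
    whiskerLeft_left_sigma_ext fun l => ?_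
  rw [← cancel_epi (α_ _ _ _).hom]
  have := h j k l
  simpa [MonoidalCategory.tensorHom_def'] using this

/-- The morphism out of a tensor product of coproducts with prescribed restrictions. -/
def tensorDesc {J K : Type w} {A : J → V} {B : K → V} {Z : V} (f : ∀ j k, A j ⊗ B k ⟶ Z) :
    (∐ A) ⊗ (∐ B) ⟶ Z :=
  (distribRight A (∐ B)).hom ≫ Sigma.desc fun j =>
    (distribLeft (A j) B).hom ≫ Sigma.desc fun k => f j k

lemma ι_tensorDesc {J K : Type w} {A : J → V} {B : K → V} {Z : V} (f : ∀ j k, A j ⊗ B k ⟶ Z)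
    (j : J) (k : K) : (Sigma.ι A j ⊗ₘ Sigma.ι B k) ≫ tensorDesc f = f j k := by
  have h := ι_distribLeft (A j) B k
  have h' := ι_distribRight A (∐ B) j
  simp [tensorDesc, MonoidalCategory.tensorHom_def', Category.assoc, reassoc_of% h',
    reassoc_of% h]

end Free

noncomputable section Tensor2

variable {V : Type u} [Category.{v} V] [MonoidalCategory V] [SymmetricCategory V]

lemma post_tensor {C D : VCat.{w} V} {a b : C} {a' b' : D} (c : C) (c' : D)
    (f : 𝟙_ V ⟶ (a ⟶[V] b)) (g : 𝟙_ V ⟶ (a' ⟶[V] b')) :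
    post (C := tensorCat C D) (a := (a, a')) (b := (b, b')) (c, c') (tpair f g) =
      (post c f ⊗ₘ post c' g) := by
  have h := tensor_right_unitality (c ⟶[V] a) (c' ⟶[V] a')
  rw [← Category.assoc, ← IsIso.comp_inv_eq, inv_tensor] at h
  change (ρ_ _).inv ≫ _ ◁ tpair f g ≫ tensorμ _ _ _ _ ≫ (eComp V _ _ _ ⊗ₘ eComp V _ _ _) = _
  simp only [tpair, MonoidalCategory.whiskerLeft_comp, Category.assoc,
    tensorμ_natural_right_assoc, ← reassoc_of% h, post]
  simp

lemma pre_tensor {C D : VCat.{w} V} {a b : C} {a' b' : D} (c : C) (c' : D)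
    (f : 𝟙_ V ⟶ (a ⟶[V] b)) (g : 𝟙_ V ⟶ (a' ⟶[V] b')) :
    pre (C := tensorCat C D) (a := (a, a')) (b := (b, b')) (tpair f g) (c, c') =
      (pre f c ⊗ₘ pre g c') := by
  have h := tensor_left_unitality (b ⟶[V] c) (b' ⟶[V] c')
  rw [← Category.assoc, ← IsIso.comp_inv_eq, inv_tensor] at h
  change (λ_ _).inv ≫ tpair f g ▷ _ ≫ tensorμ _ _ _ _ ≫ (eComp V _ _ _ ⊗ₘ eComp V _ _ _) = _
  simp only [tpair, comp_whiskerRight, Category.assoc,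
    tensorμ_natural_left_assoc, ← reassoc_of% h, pre]
  simp

lemma ucomp_tensor {C D : VCat.{w} V} {a b c : C} {a' b' c' : D}
    (f : 𝟙_ V ⟶ (a ⟶[V] b)) (g : 𝟙_ V ⟶ (a' ⟶[V] b'))
    (h : 𝟙_ V ⟶ (b ⟶[V] c)) (k : 𝟙_ V ⟶ (b' ⟶[V] c')) :
    ucomp (C := tensorCat C D) (a := (a, a')) (b := (b, b')) (c := (c, c'))
      (tpair f g) (tpair h k) = tpair (ucomp f h) (ucomp g k) := by
  rw [ucomp_eq_post, post_tensor, ucomp_eq_post, ucomp_eq_post]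
  exact tpair_tensorHom _ _ _ _

/-- The `V`-functor `F ⊗ A`. -/
abbrev tensorMap {C D : VCat.{w} V} (F : C ⟶ D) (A : VCat.{w} V) :
    tensorCat C A ⟶ tensorCat D A where
  obj x := (F.obj x.1, x.2)
  map x y := F.map x.1 y.1 ▷ (x.2 ⟶[V] y.2)
  map_id x := by
    have := F.map_id x.1
    change tpair _ _ ≫ _ = tpair _ _
    rw [← tensorHom_id, tpair_tensorHom, this, Category.comp_id]
  map_comp x y z := by
    have := F.map_comp x.1 y.1 z.1
    change (tensorμ _ _ _ _ ≫ (eComp V _ _ _ ⊗ₘ eComp V _ _ _)) ≫ _ =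
      _ ≫ tensorμ _ _ _ _ ≫ (eComp V _ _ _ ⊗ₘ eComp V _ _ _)
    rw [← tensorHom_id, ← tensorHom_id, ← tensorHom_id, tensorμ_natural_assoc]
    simp only [Category.assoc, tensorHom_comp_tensorHom, this]
    simp

/-- The `V`-natural transformation `ξ ⊗ A`. -/
abbrev tensorMap₂ {C D : VCat.{w} V} {F G : C ⟶ D} (ξ : F ⟶ G) (A : VCat.{w} V) :
    tensorMap F A ⟶ tensorMap G A where
  app x := tpair (ξ.app x.1) (eId V x.2)
  naturality x y := by
    have := ξ.naturality x.1 y.1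
    refine Eq.trans (congrArg (_ ≫ ·) (post_tensor _ _ _ _)) (Eq.trans ?_
      (congrArg (_ ≫ ·) (pre_tensor _ _ _ _)).symm)
    change (F.map x.1 y.1 ▷ _) ≫ _ = (G.map x.1 y.1 ▷ _) ≫ _
    rw [← tensorHom_id, ← tensorHom_id, tensorHom_comp_tensorHom, tensorHom_comp_tensorHom, this,
      post_eId, pre_eId]

lemma tensorμ_aux {A B X Y S T S' T' Z R : V} (p : A ⟶ X ⊗ S) (q : B ⟶ Y ⊗ T) (m : X ⊗ Y ⟶ Z)
    (n : S' ⊗ T' ⟶ R) (s : S ⟶ S') (t : T ⟶ T') :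
    ((p ≫ X ◁ s) ⊗ₘ (q ≫ Y ◁ t)) ≫ tensorμ X S' Y T' ≫ (m ⊗ₘ n) =
      (p ⊗ₘ q) ≫ tensorμ X S Y T ≫ (m ⊗ₘ ((s ⊗ₘ t) ≫ n)) := by
  rw [← tensorHom_comp_tensorHom, Category.assoc, ← id_tensorHom, ← id_tensorHom,
    tensorμ_natural_assoc, tensorHom_comp_tensorHom]
  simp

lemma tensorμ_unit (A B : V) :
    ((ρ_ A).inv ⊗ₘ (ρ_ B).inv) ≫ tensorμ A (𝟙_ V) B (𝟙_ V) =
      (ρ_ (A ⊗ B)).inv ≫ (A ⊗ B) ◁ (λ_ (𝟙_ V)).inv := by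
  have h := rightUnitor_monoidal A B
  have h' : ((ρ_ A).inv ⊗ₘ (ρ_ B).inv) ≫ ((ρ_ A).hom ⊗ₘ (ρ_ B).hom) = 𝟙 _ := by simp
  rw [h] at h'
  rw [Iso.eq_inv_comp, ← cancel_mono ((A ⊗ B) ◁ (λ_ (𝟙_ V)).hom), ← cancel_epi (ρ_ _).inv]
  rw [← cancel_mono (ρ_ _).hom]
  simpa using h'


end Tensor2

noncomputable section FreeCat

variable (V : Type u) [Category.{v} V] [MonoidalCategory V] [SymmetricCategory V]
  [HasCoproducts.{w} V]
  [∀ (A : V) (J : Type w), PreservesColimitsOfShape (Discrete J) (tensorLeft A)]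

lemma single_tensorDesc {V : Type u} [Category.{v} V] [MonoidalCategory V] [SymmetricCategory V]
    [HasCoproducts.{w} V]
    [∀ (A : V) (J : Type w), PreservesColimitsOfShape (Discrete J) (tensorLeft A)]
    {S T : Type w} {Z : V} (f : S → T → (𝟙_ V ⊗ 𝟙_ V ⟶ Z)) (s : S) (t : T) :
    (single s ⊗ₘ single t) ≫ tensorDesc (A := fun _ : S => 𝟙_ V) (B := fun _ : T => 𝟙_ V) f =
      f s t :=
  ι_tensorDesc f s t

/-- The objects of the free `V`-category on `I`. -/
@[ext]
structure FreeOb (I : Type w) : Type w where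
  /-- the underlying object of `I` -/
  val : I

variable {V} in
/-- Composition in the free `V`-category on `I`. -/
def freeComp {I : Type w} [SmallCategory I] (i j k : I) :
    freeObj V (i ⟶ j) ⊗ freeObj V (j ⟶ k) ⟶ freeObj V (i ⟶ k) :=
  tensorDesc fun f g => (λ_ _).hom ≫ single (f ≫ g)

variable {V} in
lemma single_freeComp {I : Type w} [SmallCategory I] {i j k : I} (f : i ⟶ j) (g : j ⟶ k) :
    (single f ⊗ₘ single g) ≫ freeComp i j k = (λ_ (𝟙_ V)).hom ≫ single (f ≫ g) :=
  single_tensorDesc _ _ _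

instance freeEnriched (I : Type w) [SmallCategory I] : EnrichedCategory V (FreeOb I) where
  Hom i j := freeObj V (i.val ⟶ j.val)
  id i := single (𝟙 i.val)
  comp i j k := freeComp i.val j.val k.val
  id_comp i j := by
    refine free_ext fun s => ?_
    rw [leftUnitor_inv_naturality_assoc]
    rw [← MonoidalCategory.tensorHom_def'_assoc, single_freeComp]
    simp
  comp_id i j := by
    refine free_ext fun s => ?_
    rw [rightUnitor_inv_naturality_assoc]
    rw [← MonoidalCategory.tensorHom_def_assoc, single_freeComp]
    simp [unitors_equal]
  assoc i j k l := by
    rw [Iso.inv_comp_eq]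
    refine tensor_sigma_ext₃ fun f g h => ?_
    change ((single f ⊗ₘ single g) ⊗ₘ single h) ≫ _ = ((single f ⊗ₘ single g) ⊗ₘ single h) ≫ _
    rw [associator_naturality_assoc, ← tensorHom_id, ← id_tensorHom,
      tensorHom_comp_tensorHom_assoc, tensorHom_comp_tensorHom_assoc, single_freeComp,
      single_freeComp]
    rw [Category.comp_id, Category.comp_id, ← Category.id_comp (single h),
      ← tensorHom_comp_tensorHom_assoc, single_freeComp, ← Category.id_comp (single f),
      ← tensorHom_comp_tensorHom_assoc, single_freeComp, Category.assoc]
    simp [unitors_equal]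

/-- The free `V`-category `I ⊗ 1` on a small category `I`. -/
abbrev freeCat (I : Type w) [SmallCategory I] : VCat.{w} V where
  carrier := FreeOb I

end FreeCat

/-! ### Graded `V`-categories -/

noncomputable section Graded

variable (V : Type u) [Category.{v} V] [MonoidalCategory V] [SymmetricCategory V]
  [HasCoproducts.{w} V]
  [∀ (A : V) (J : Type w), PreservesColimitsOfShape (Discrete J) (tensorLeft A)]
  (I : Type w) [SmallCategory I]

/-- An `I`-graded `V`-category: a `V`-category together with a right comodule structure over
`I ⊗ 1`. The counit axiom forces the coaction to be the identity in the first variable on objects,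
so on objects it is given by a map `deg`. -/
structure GradedCat where
  /-- the underlying `V`-category -/
  cat : VCat.{w} V
  /-- the degree of an object -/
  deg : cat → I
  /-- the coaction on morphism objects -/
  coact (x y : cat) : (x ⟶[V] y) ⟶ (x ⟶[V] y) ⊗ freeObj V (deg x ⟶ deg y)
  coact_id (x : cat) : eId V x ≫ coact x x = tpair (eId V x) (single (𝟙 (deg x)))
  coact_comp (x y z : cat) : eComp V x y z ≫ coact x z =
    (coact x y ⊗ₘ coact y z) ≫ tensorμ _ _ _ _ ≫
      (eComp V x y z ⊗ₘ freeComp (deg x) (deg y) (deg z))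
  coact_counit (x y : cat) : coact x y ≫ _ ◁ counit _ ≫ (ρ_ _).hom = 𝟙 (x ⟶[V] y)
  coact_coassoc (x y : cat) :
    coact x y ≫ coact x y ▷ _ ≫ (α_ _ _ _).hom = coact x y ≫ _ ◁ comul _

variable {V I}

/-- The coaction as a `V`-functor. -/
abbrev GradedCat.coaction (E : GradedCat V I) : E.cat ⟶ tensorCat E.cat (freeCat V I) where
  obj x := (x, ⟨E.deg x⟩)
  map x y := E.coact x y
  map_id x := E.coact_id x
  map_comp x y z := E.coact_comp x y z

/-- Left morphisms of graded `V`-categories: a `V`-functor together with a degree-preserving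
`V`-natural transformation from the coaction after `fn` to `fn ⊗ I ⊗ 1` after the coaction. -/
structure LeftMor (E E' : GradedCat V I) where
  /-- the underlying `V`-functor -/
  fn : E.cat ⟶ E'.cat
  /-- the comparison of the coactions -/
  twist : fn ≫ E'.coaction ⟶ E.coaction ≫ tensorMap fn (freeCat V I)
  exists_deg : ∃ d : ∀ x, E'.deg (fn.obj x) ⟶ E.deg x,
    ∀ x, twist.app x = tpair (eId V (fn.obj x)) (single (d x))

/-- 2-morphisms between left morphisms of graded `V`-categories. -/
@[ext]
structure LeftMor₂ {E E' : GradedCat V I} (F G : LeftMor E E') where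
  /-- the underlying `V`-natural transformation -/
  nat : F.fn ⟶ G.fn
  comm : Bicategory.whiskerRight nat E'.coaction ≫ G.twist =
    F.twist ≫ Bicategory.whiskerLeft E.coaction (tensorMap₂ nat (freeCat V I))

lemma LeftMor₂.comm_app {E E' : GradedCat V I} {F G : LeftMor E E'} (ξ : LeftMor₂ F G)
    (x : E.cat) :
    ucomp (C := tensorCat E'.cat (freeCat V I)) (c := (G.fn.obj x, ⟨E.deg x⟩))
      (ξ.nat.app x ≫ E'.coact _ _) (G.twist.app x) =
    ucomp (C := tensorCat E'.cat (freeCat V I)) (b := (F.fn.obj x, ⟨E.deg x⟩))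
      (F.twist.app x) (tpair (ξ.nat.app x) (single (𝟙 (E.deg x)))) :=
  congrArg (fun α => VNat.app α x) ξ.comm

/-- A `V`-natural transformation satisfying the componentwise condition is a 2-morphism. -/
abbrev LeftMor₂.mk' {E E' : GradedCat V I} {F G : LeftMor E E'} (nat : F.fn ⟶ G.fn)
    (comm : ∀ x : E.cat,
    ucomp (C := tensorCat E'.cat (freeCat V I)) (c := (G.fn.obj x, ⟨E.deg x⟩))
      (nat.app x ≫ E'.coact _ _) (G.twist.app x) =
    ucomp (C := tensorCat E'.cat (freeCat V I)) (b := (F.fn.obj x, ⟨E.deg x⟩))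
      (F.twist.app x) (tpair (nat.app x) (single (𝟙 (E.deg x))))) : LeftMor₂ F G where
  nat := nat
  comm := VCat.hom_ext comm

lemma ucomp_tensor_free {C : VCat.{w} V} {a b c : C} {i j k : I}
    (f : 𝟙_ V ⟶ (a ⟶[V] b)) (g : i ⟶ j) (h : 𝟙_ V ⟶ (b ⟶[V] c)) (k' : j ⟶ k) :
    ucomp (C := tensorCat C (freeCat V I)) (a := (a, ⟨i⟩)) (b := (b, ⟨j⟩)) (c := (c, ⟨k⟩))
      (tpair f (single g)) (tpair h (single k')) = tpair (ucomp f h) (single (g ≫ k')) := by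
  refine (ucomp_tensor (C := C) (D := freeCat V I) _ _ _ _).trans ?_
  congr 1
  change (λ_ _).inv ≫ (single g ⊗ₘ single k') ≫ freeComp i j k = _
  rw [single_freeComp, Iso.inv_hom_id_assoc]

namespace GradedCat

variable {E E' E'' E''' : GradedCat V I}

/-- The identity left morphism. -/
abbrev idMor (E : GradedCat V I) : LeftMor E E where
  fn := 𝟙 E.cat
  twist :=
    { app x := eId V (E.coaction.obj x)
      naturality x y := by
        refine (congrArg (_ ≫ ·) (post_eId _ _)).trans (Eq.trans ?_
          (congrArg (_ ≫ ·) (pre_eId _ _)).symm)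
        change (𝟙 _ ≫ E.coact x y) ≫ 𝟙 _ = (E.coact x y ≫ 𝟙 _ ▷ _) ≫ 𝟙 _
        simp }
  exists_deg := ⟨fun x => 𝟙 _, fun x => rfl⟩

/-- The composite of two left morphisms. -/
abbrev compMor (F : LeftMor E E') (G : LeftMor E' E'') : LeftMor E E'' where
  fn := F.fn ≫ G.fn
  twist :=
    { app x := ucomp (C := tensorCat E''.cat (freeCat V I)) (G.twist.app (F.fn.obj x))
        (F.twist.app x ≫ (tensorMap G.fn (freeCat V I)).map _ _)
      naturality x y := by
        have h1 := (VNat.whiskerLeft F.fn G.twist).naturality x y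
        have h2 := (VNat.whiskerRight F.twist (tensorMap G.fn (freeCat V I))).naturality x y
        have e1 : (F.fn ≫ G.fn ≫ E''.coaction).map x y =
          ((F.fn ≫ G.fn) ≫ E''.coaction).map x y := (Category.assoc _ _ _).symm
        have e2 : (F.fn ≫ E'.coaction ≫ tensorMap G.fn (freeCat V I)).map x y =
          ((F.fn ≫ E'.coaction) ≫ tensorMap G.fn (freeCat V I)).map x y :=
            (Category.assoc _ _ _).symm
        have e3 : ((E.coaction ≫ tensorMap F.fn (freeCat V I)) ≫
            tensorMap G.fn (freeCat V I)).map x y =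
          (E.coaction ≫ tensorMap (F.fn ≫ G.fn) (freeCat V I)).map x y := by
          change (E.coact x y ≫ F.fn.map x y ▷ _) ≫ G.fn.map _ _ ▷ _ =
            E.coact x y ≫ (F.fn.map x y ≫ G.fn.map _ _) ▷ _
          simp
        have h3 := (congrArg (· ≫ _) e1.symm).trans (h1.trans (congrArg (· ≫ _) e2))
        have h4 := h2.trans (congrArg (· ≫ _) e3)
        rw [post_ucomp, pre_ucomp]
        refine (Category.assoc _ _ _).symm.trans ?_
        refine (congrArg (· ≫ _) h3).trans ?_
        refine (Category.assoc _ _ _).trans ?_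
        refine (congrArg (_ ≫ ·) (pre_post _ _)).trans ?_
        refine (Category.assoc _ _ _).symm.trans ?_
        refine (congrArg (· ≫ _) h4).trans ?_
        exact (Category.assoc _ _ _) }
  exists_deg := by
    obtain ⟨d, hd⟩ := F.exists_deg
    obtain ⟨d', hd'⟩ := G.exists_deg
    refine ⟨fun x => d' (F.fn.obj x) ≫ d x, fun x => ?_⟩
    have e := tpair_tensorHom (eId V (F.fn.obj x)) (single (V := V) (d x))
      (G.fn.map (F.fn.obj x) (F.fn.obj x)) (𝟙 _)
    rw [tensorHom_id, G.fn.map_id, Category.comp_id] at e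
    refine Eq.trans ?_ ((ucomp_tensor_free (C := E''.cat) (eId V (G.fn.obj (F.fn.obj x)))
      (d' (F.fn.obj x)) (eId V (G.fn.obj (F.fn.obj x))) (d x)).trans ?_)
    · refine (congrArg (ucomp (C := tensorCat E''.cat (freeCat V I)) · _) (hd' (F.fn.obj x))).trans
        (congrArg (ucomp (C := tensorCat E''.cat (freeCat V I)) _ ·) ?_)
      exact (congrArg (· ≫ _) (hd x)).trans e
    · rw [eId_ucomp]
      rfl

instance : CategoryStruct (GradedCat V I) where
  Hom := LeftMor
  id := idMor
  comp := compMor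

end GradedCat

end Graded

section Squares

variable {V : Type u} [Category.{v} V] [MonoidalCategory V] {C : Type w₁} [EnrichedCategory V C]

lemma sq_vert {a₀ a₁ a₂ b₀ b₁ b₂ : C} {p₁ : 𝟙_ V ⟶ (a₀ ⟶[V] a₁)} {p₂ : 𝟙_ V ⟶ (a₁ ⟶[V] a₂)}
    {q₁ : 𝟙_ V ⟶ (b₀ ⟶[V] b₁)} {q₂ : 𝟙_ V ⟶ (b₁ ⟶[V] b₂)} {t₀ : 𝟙_ V ⟶ (a₀ ⟶[V] b₀)}
    {t₁ : 𝟙_ V ⟶ (a₁ ⟶[V] b₁)} {t₂ : 𝟙_ V ⟶ (a₂ ⟶[V] b₂)}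
    (h₁ : ucomp p₁ t₁ = ucomp t₀ q₁) (h₂ : ucomp p₂ t₂ = ucomp t₁ q₂) :
    ucomp (ucomp p₁ p₂) t₂ = ucomp t₀ (ucomp q₁ q₂) := by
  rw [ucomp_assoc, h₂, ← ucomp_assoc, h₁, ucomp_assoc]

lemma sq_horiz {a₀ a₁ a₂ b₀ b₁ b₂ : C} {p₁ : 𝟙_ V ⟶ (a₀ ⟶[V] a₁)} {p₂ : 𝟙_ V ⟶ (a₁ ⟶[V] a₂)}
    {q₁ : 𝟙_ V ⟶ (b₀ ⟶[V] b₁)} {q₂ : 𝟙_ V ⟶ (b₁ ⟶[V] b₂)} {t₀ : 𝟙_ V ⟶ (a₀ ⟶[V] b₀)}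
    {t₁ : 𝟙_ V ⟶ (a₁ ⟶[V] b₁)} {t₂ : 𝟙_ V ⟶ (a₂ ⟶[V] b₂)}
    (h₁ : ucomp t₀ q₁ = ucomp p₁ t₁) (h₂ : ucomp t₁ q₂ = ucomp p₂ t₂) :
    ucomp t₀ (ucomp q₁ q₂) = ucomp (ucomp p₁ p₂) t₂ := by
  rw [ucomp_assoc, ← h₂, ← ucomp_assoc, h₁, ucomp_assoc]

lemma VNat.naturality_elem {D : Type w₂} [EnrichedCategory V D] {F G : EnrichedFunctor V C D}
    (α : VNat F G) {x y : C} (f : 𝟙_ V ⟶ (x ⟶[V] y)) :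
    ucomp (f ≫ F.map x y) (α.app y) = ucomp (α.app x) (f ≫ G.map x y) := by
  rw [ucomp_eq_post, ucomp_eq_pre, Category.assoc, Category.assoc, α.naturality]

end Squares

noncomputable section Graded2

variable {V : Type u} [Category.{v} V] [MonoidalCategory V] [SymmetricCategory V]
  [HasCoproducts.{w} V]
  [∀ (A : V) (J : Type w), PreservesColimitsOfShape (Discrete J) (tensorLeft A)]
  {I : Type w} [SmallCategory I]

namespace GradedCat

variable {E E' E'' E''' : GradedCat V I}

instance : Category (E ⟶ E') where
  Hom F G := LeftMor₂ F G
  id F := LeftMor₂.mk' (𝟙 F.fn) fun x => by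
    refine (congrArg (ucomp (C := tensorCat E'.cat (freeCat V I)) · (F.twist.app x))
      (E'.coact_id (F.fn.obj x))).trans ?_
    exact (eId_ucomp (C := tensorCat E'.cat (freeCat V I)) _).trans
      (ucomp_eId (C := tensorCat E'.cat (freeCat V I)) _).symm
  comp {F G H} α β := LeftMor₂.mk' (α.nat ≫ β.nat) fun x => by
    refine (congrArg (ucomp (C := tensorCat E'.cat (freeCat V I)) · (H.twist.app x))
      (ucomp_map E'.coaction (α.nat.app x) (β.nat.app x))).trans ?_
    refine (sq_vert (C := tensorCat E'.cat (freeCat V I)) (α.comm_app x) (β.comm_app x)).trans ?_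
    refine congrArg (ucomp (C := tensorCat E'.cat (freeCat V I)) (F.twist.app x) ·)
      ((ucomp_tensor_free _ _ _ _).trans ?_)
    rw [Category.comp_id]
    rfl
  id_comp _ := LeftMor₂.ext (Category.id_comp _)
  comp_id _ := LeftMor₂.ext (Category.comp_id _)
  assoc _ _ _ := LeftMor₂.ext (Category.assoc _ _ _)

lemma hom_ext₂ {F G : E ⟶ E'} {α β : F ⟶ G} (h : LeftMor₂.nat α = LeftMor₂.nat β) : α = β :=
  LeftMor₂.ext h

/-- Whiskering of a 2-morphism with a left morphism applied first. -/
abbrev whiskerL (F : E ⟶ E') {G H : E' ⟶ E''} (ξ : G ⟶ H) : F ≫ G ⟶ F ≫ H :=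
  LeftMor₂.mk' (F := F ≫ G) (G := F ≫ H)
    (Bicategory.whiskerLeft (LeftMor.fn F) (LeftMor₂.nat ξ)) fun x => by
      have h := LeftMor₂.comm_app ξ (F.fn.obj x)
      have h' := VNat.naturality_elem (tensorMap₂ ξ.nat (freeCat V I)) (F.twist.app x)
      exact sq_horiz (C := tensorCat E''.cat (freeCat V I)) h h'.symm

/-- Whiskering of a 2-morphism with a left morphism applied last. -/
abbrev whiskerR {F G : E ⟶ E'} (ξ : F ⟶ G) (H : E' ⟶ E'') : F ≫ H ⟶ G ≫ H :=
  LeftMor₂.mk' (F := F ≫ H) (G := G ≫ H)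
    (Bicategory.whiskerRight (LeftMor₂.nat ξ) (LeftMor.fn H)) fun x => by
      have h := VNat.naturality_elem H.twist (ξ.nat.app x)
      have h₁ := LeftMor₂.comm_app ξ x
      have h' := (ucomp_map (tensorMap H.fn (freeCat V I)) _ _).symm.trans ((congrArg
        (· ≫ (tensorMap H.fn (freeCat V I)).map _ _) h₁).trans
          (ucomp_map (tensorMap H.fn (freeCat V I)) _ _))
      have h₂ : tpair (ξ.nat.app x) (single (V := V) (𝟙 (E.deg x))) ≫ H.fn.map _ _ ▷ _ =
          tpair (ξ.nat.app x ≫ H.fn.map _ _) (single (𝟙 (E.deg x))) := by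
        rw [← tensorHom_id, tpair_tensorHom, Category.comp_id]
      refine (congrArg (ucomp (C := tensorCat E''.cat (freeCat V I)) · ((G ≫ H).twist.app x))
        (Category.assoc _ _ _)).trans ?_
      refine Eq.trans ?_ (congrArg (ucomp (C := tensorCat E''.cat (freeCat V I))
        ((F ≫ H).twist.app x) ·) h₂)
      refine sq_horiz (C := tensorCat E''.cat (freeCat V I)) h ?_
      refine Eq.trans ?_ h'
      exact congrArg (ucomp (C := tensorCat E''.cat (freeCat V I)) · _)
        (Category.assoc _ _ _).symm

lemma eId_square {C : VCat.{w} V} {a : C} {i j : I}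
    {c : 𝟙_ V ⟶ (a ⟶[V] a) ⊗ freeObj V (i ⟶ i)} (hc : c = tpair (eId V a) (single (𝟙 i)))
    {t t' : 𝟙_ V ⟶ (a ⟶[V] a) ⊗ freeObj V (i ⟶ j)} (h : t = t') :
    ucomp (C := tensorCat C (freeCat V I)) (a := (a, ⟨i⟩)) (b := (a, ⟨i⟩)) (c := (a, ⟨j⟩)) c t =
      ucomp (C := tensorCat C (freeCat V I)) (a := (a, ⟨i⟩)) (b := (a, ⟨j⟩)) (c := (a, ⟨j⟩)) t'
        (tpair (eId V a) (single (𝟙 j))) := by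
  subst hc h
  exact (eId_ucomp (C := tensorCat C (freeCat V I)) _).trans
    (ucomp_eId (V := V) (C := tensorCat C (freeCat V I)) (a := (a, ⟨i⟩)) (b := (a, ⟨j⟩)) t).symm

lemma twist_assoc {E₀ E₁ E₂ E₃ : GradedCat V I} (F : E₀ ⟶ E₁) (G : E₁ ⟶ E₂) (H : E₂ ⟶ E₃)
    (x : E₀.cat) : ((F ≫ G) ≫ H).twist.app x = (F ≫ G ≫ H).twist.app x := by
  have h := ucomp_map (tensorMap H.fn (freeCat V I)) (G.twist.app (F.fn.obj x))
    (F.twist.app x ≫ (tensorMap G.fn (freeCat V I)).map _ _)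
  refine (congrArg (ucomp (C := tensorCat E₃.cat (freeCat V I))
    (H.twist.app (G.fn.obj (F.fn.obj x))) ·) h).trans ?_
  refine (ucomp_assoc (C := tensorCat E₃.cat (freeCat V I)) _ _ _).symm.trans ?_
  refine congrArg (ucomp (C := tensorCat E₃.cat (freeCat V I)) _ ·) ?_
  refine (Category.assoc _ _ _).trans (congrArg (F.twist.app x ≫ ·) ?_)
  exact (comp_whiskerRight _ _ _).symm

lemma twist_id_comp {E₀ E₁ : GradedCat V I} (F : E₀ ⟶ E₁)
    (x : E₀.cat) : (𝟙 E₀ ≫ F).twist.app x = F.twist.app x := by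
  refine (congrArg (ucomp (C := tensorCat E₁.cat (freeCat V I)) (F.twist.app x) ·)
    ((tensorMap F.fn (freeCat V I)).map_id _)).trans ?_
  exact ucomp_eId (C := tensorCat E₁.cat (freeCat V I)) _

lemma twist_comp_id {E₀ E₁ : GradedCat V I} (F : E₀ ⟶ E₁)
    (x : E₀.cat) : (F ≫ 𝟙 E₁).twist.app x = F.twist.app x := by
  refine (eId_ucomp (C := tensorCat E₁.cat (freeCat V I)) _).trans ?_
  exact (congrArg (F.twist.app x ≫ ·) (id_whiskerRight _ _)).trans (Category.comp_id _)

instance : Bicategory (GradedCat V I) where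
  whiskerLeft F _ _ ξ := whiskerL F ξ
  whiskerRight ξ H := whiskerR ξ H
  associator F G H :=
    { hom := LeftMor₂.mk' (F := (F ≫ G) ≫ H) (G := F ≫ G ≫ H)
        (Bicategory.associator (LeftMor.fn F) (LeftMor.fn G) (LeftMor.fn H)).hom fun x => by
          exact eId_square (GradedCat.coact_id _ _) (twist_assoc F G H x).symm
      inv := LeftMor₂.mk' (F := F ≫ G ≫ H) (G := (F ≫ G) ≫ H)
        (Bicategory.associator (LeftMor.fn F) (LeftMor.fn G) (LeftMor.fn H)).inv fun x => by
          exact eId_square (GradedCat.coact_id _ _) (twist_assoc F G H x)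
      hom_inv_id := hom_ext₂ (Iso.hom_inv_id _)
      inv_hom_id := hom_ext₂ (Iso.inv_hom_id _) }
  leftUnitor F :=
    { hom := LeftMor₂.mk' (F := 𝟙 _ ≫ F) (G := F)
        (Bicategory.leftUnitor (LeftMor.fn F)).hom fun x => by
          exact eId_square (GradedCat.coact_id _ _) (twist_id_comp F x).symm
      inv := LeftMor₂.mk' (F := F) (G := 𝟙 _ ≫ F)
        (Bicategory.leftUnitor (LeftMor.fn F)).inv fun x => by
          exact eId_square (GradedCat.coact_id _ _) (twist_id_comp F x)
      hom_inv_id := hom_ext₂ (Iso.hom_inv_id _)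
      inv_hom_id := hom_ext₂ (Iso.inv_hom_id _) }
  rightUnitor F :=
    { hom := LeftMor₂.mk' (F := F ≫ 𝟙 _) (G := F)
        (Bicategory.rightUnitor (LeftMor.fn F)).hom fun x => by
          exact eId_square (GradedCat.coact_id _ _) (twist_comp_id F x).symm
      inv := LeftMor₂.mk' (F := F) (G := F ≫ 𝟙 _)
        (Bicategory.rightUnitor (LeftMor.fn F)).inv fun x => by
          exact eId_square (GradedCat.coact_id _ _) (twist_comp_id F x)
      hom_inv_id := hom_ext₂ (Iso.hom_inv_id _)
      inv_hom_id := hom_ext₂ (Iso.inv_hom_id _) }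
  whiskerLeft_id _ _ := hom_ext₂ (Bicategory.whiskerLeft_id _ _)
  whiskerLeft_comp _ _ _ _ _ _ := hom_ext₂ (Bicategory.whiskerLeft_comp _ _ _)
  id_whiskerLeft α := hom_ext₂ (Bicategory.id_whiskerLeft _)
  comp_whiskerLeft F G _ _ α := hom_ext₂ (Bicategory.comp_whiskerLeft _ _ _)
  id_whiskerRight F G := hom_ext₂ (Bicategory.id_whiskerRight _ _)
  comp_whiskerRight α β H := hom_ext₂ (Bicategory.comp_whiskerRight _ _ _)
  whiskerRight_id α := hom_ext₂ (Bicategory.whiskerRight_id _)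
  whiskerRight_comp α G H := hom_ext₂ (Bicategory.whiskerRight_comp _ _ _)
  whisker_assoc F G H α K := hom_ext₂ (Bicategory.whisker_assoc _ _ _)
  whisker_exchange α β := hom_ext₂ (Bicategory.whisker_exchange _ _)
  pentagon F G H K := hom_ext₂ (Bicategory.pentagon _ _ _ _)
  triangle F G := hom_ext₂ (Bicategory.triangle _ _)

end GradedCat

end Graded2

/-! ### Fibres and comma categories of a grading -/

noncomputable section Fibres

variable {V : Type u} [Category.{v} V] [MonoidalCategory V] [SymmetricCategory V]
  [HasCoproducts.{w} V]
  [∀ (A : V) (J : Type w), PreservesColimitsOfShape (Discrete J) (tensorLeft A)]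
  [HasFiniteLimits V] {I : Type w} [SmallCategory I]

namespace GradedCat

/-- The morphism `u_* : (I ⊗ 1)(k, i) ⟶ (I ⊗ 1)(k, j)`. -/
abbrev push (k : I) {i j : I} (u : i ⟶ j) : freeObj V (k ⟶ i) ⟶ freeObj V (k ⟶ j) :=
  post (V := V) (C := FreeOb I) (a := ⟨i⟩) (b := ⟨j⟩) ⟨k⟩ (single u)

lemma single_comp_eComp {i j k : I} (f : i ⟶ j) (g : j ⟶ k) :
    ucomp (V := V) (C := FreeOb I) (a := ⟨i⟩) (b := ⟨j⟩) (c := ⟨k⟩) (single f) (single g) =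
      single (f ≫ g) := by
  change (λ_ _).inv ≫ (single f ⊗ₘ single g) ≫ freeComp i j k = _
  rw [single_freeComp, Iso.inv_hom_id_assoc]

lemma single_push {i j k : I} (f : i ⟶ j) (g : j ⟶ k) :
    single f ≫ push i g = single (V := V) (f ≫ g) :=
  (ucomp_eq_post (V := V) (C := FreeOb I) (a := ⟨i⟩) (b := ⟨j⟩) (c := ⟨k⟩) (single f)
    (single g)).symm.trans (single_comp_eComp f g)

lemma push_push (k : I) {i j l : I} (f : i ⟶ j) (g : j ⟶ l) :
    push (V := V) k f ≫ push k g = push k (f ≫ g) := by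
  refine free_ext fun s => ?_
  rw [← Category.assoc, single_push, single_push, single_push, Category.assoc]

variable (E : GradedCat V I)

/-- Objects of `E ↓ i`: an object of `E` together with a morphism from its degree to `i`. -/
structure CommaOb (i : I) : Type w where
  /-- the underlying object of `E` -/
  ob : E.cat
  /-- the morphism from the degree -/
  hom : E.deg ob ⟶ i

variable {E}

/-- The morphism object of `E ↓ i` from `(e, u)` to `(e', u')`: the equalizer of `u'_* ∘ μ` and
`1 ⊗ u` from `E(e, e')` to `E(e, e') ⊗ (I(deg e, i) ⊗ 1)`. -/
abbrev commaHom {i : I} (x y : CommaOb E i) : V :=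
  equalizer (E.coact x.ob y.ob ≫ _ ◁ push _ y.hom)
    ((ρ_ (x.ob ⟶[V] y.ob)).inv ≫ _ ◁ single x.hom)

/-- The inclusion of a morphism object of `E ↓ i` into that of `E`. -/
abbrev commaι {i : I} (x y : CommaOb E i) : commaHom x y ⟶ (x.ob ⟶[V] y.ob) := equalizer.ι _ _

lemma commaι_condition {i : I} (x y : CommaOb E i) :
    commaι x y ≫ E.coact x.ob y.ob ≫ _ ◁ push _ y.hom =
      commaι x y ≫ (ρ_ (x.ob ⟶[V] y.ob)).inv ≫ _ ◁ single x.hom :=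
  equalizer.condition _ _

/-- The morphism of `E ↓ i` given by the identity of an object of `E`. -/
def commaId {i : I} (e : E.cat) {u u' : E.deg e ⟶ i} (h : u = u') :
    𝟙_ V ⟶ commaHom (CommaOb.mk e u) (CommaOb.mk e u') :=
  equalizer.lift (eId V e) (by
    subst h
    rw [← Category.assoc, E.coact_id, ← id_tensorHom, tpair_tensorHom, single_push]
    rw [rightUnitor_inv_naturality_assoc, tpair, MonoidalCategory.tensorHom_def, unitors_inv_equal]
    simp)

lemma commaId_ι {i : I} (e : E.cat) {u u' : E.deg e ⟶ i} (h : u = u') :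
    commaId e h ≫ commaι _ _ = eId V e := equalizer.lift_ι _ _

lemma comp_condition_aux {a b c : E.cat} {i : I} (u : E.deg a ⟶ i) (v : E.deg b ⟶ i)
    (w : E.deg c ⟶ i) {A B : V} {f : A ⟶ (a ⟶[V] b)} {g : B ⟶ (b ⟶[V] c)}
    (hf : f ≫ E.coact a b ≫ _ ◁ push _ v = f ≫ (ρ_ _).inv ≫ _ ◁ single u)
    (hg : g ≫ E.coact b c ≫ _ ◁ push _ w = g ≫ (ρ_ _).inv ≫ _ ◁ single v) :
    ((f ⊗ₘ g) ≫ eComp V a b c) ≫ E.coact a c ≫ _ ◁ push _ w =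
      ((f ⊗ₘ g) ≫ eComp V a b c) ≫ (ρ_ _).inv ≫ _ ◁ single u := by
  have h₁ : freeComp (E.deg a) (E.deg b) (E.deg c) ≫
      push (V := V) (E.deg a) w =
      _ ◁ push (E.deg b) w ≫ freeComp (E.deg a) (E.deg b) i :=
    comp_post (V := V) (C := FreeOb I) (a := ⟨E.deg a⟩) (b := ⟨E.deg b⟩)
      (c := ⟨E.deg c⟩) (d := ⟨i⟩) (single w)
  have h₂ : (𝟙 (freeObj V (E.deg a ⟶ E.deg b)) ⊗ₘ single v) ≫
      freeComp (E.deg a) (E.deg b) i =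
      (push (E.deg a) v ⊗ₘ 𝟙 _) ≫ (ρ_ (freeObj V (E.deg a ⟶ i))).hom := by
    rw [tensorHom_id, rightUnitor_naturality, id_tensorHom]
    exact ((Iso.eq_inv_comp (ρ_ (freeObj V (E.deg a ⟶ E.deg b)))).1 rfl).symm
  calc
    _ = (f ⊗ₘ g) ≫ (E.coact a b ⊗ₘ E.coact b c) ≫ tensorμ _ _ _ _ ≫
        (eComp V a b c ⊗ₘ ((𝟙 _ ⊗ₘ push _ w) ≫
          freeComp (E.deg a) (E.deg b) i)) := by
      rw [Category.assoc, reassoc_of% (E.coact_comp a b c), id_tensorHom, ← h₁, ← id_tensorHom,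
        tensorHom_comp_tensorHom, Category.comp_id]
    _ = ((f ≫ E.coact a b) ⊗ₘ (g ≫ (ρ_ _).inv ≫ _ ◁ single v)) ≫ tensorμ _ _ _ _ ≫
        (eComp V a b c ⊗ₘ
          freeComp (E.deg a) (E.deg b) i) := by
      rw [← tensorμ_aux, whiskerLeft_id, Category.comp_id, tensorHom_comp_tensorHom_assoc, hg]
    _ = ((f ≫ E.coact a b) ⊗ₘ (g ≫ (ρ_ _).inv)) ≫ tensorμ _ _ _ _ ≫
        (eComp V a b c ⊗ₘ ((push _ v ⊗ₘ 𝟙 _) ≫ (ρ_ _).hom)) := by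
      rw [← h₂, ← tensorμ_aux, whiskerLeft_id, Category.comp_id, Category.assoc]
    _ = ((f ≫ (ρ_ _).inv) ⊗ₘ (g ≫ (ρ_ _).inv)) ≫ tensorμ _ _ _ _ ≫
        (eComp V a b c ⊗ₘ ((single u ⊗ₘ 𝟙 _) ≫ (ρ_ _).hom)) := by
      rw [← tensorμ_aux, ← tensorμ_aux, Category.assoc, Category.assoc, hf, Category.assoc]
    _ = _ := by
      rw [← tensorHom_comp_tensorHom, Category.assoc, reassoc_of% (tensorμ_unit (a ⟶[V] b) (b ⟶[V] c)), tensorHom_id,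
        rightUnitor_naturality, ← unitors_equal, ← id_tensorHom, tensorHom_comp_tensorHom,
        Category.id_comp, Iso.inv_hom_id_assoc, MonoidalCategory.tensorHom_def (eComp V a b c),
        Category.assoc, rightUnitor_inv_naturality_assoc (eComp V a b c)]

/-- The `V`-category `E ↓ i`. -/
instance {i : I} : EnrichedCategory V (CommaOb E i) where
  Hom x y := commaHom x y
  id x := commaId x.ob rfl
  comp x y z := equalizer.lift ((commaι x y ⊗ₘ commaι y z) ≫ eComp V x.ob y.ob z.ob)
    (comp_condition_aux _ _ _ (commaι_condition x y) (commaι_condition y z))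
  id_comp x y := by
    refine equalizer.hom_ext ?_
    rw [Category.assoc, Category.assoc, equalizer.lift_ι, MonoidalCategory.tensorHom_def,
      Category.assoc, ← comp_whiskerRight_assoc, commaId_ι, ← whisker_exchange_assoc,
      ← leftUnitor_inv_naturality_assoc, e_id_comp, Category.id_comp, Category.comp_id]
  comp_id x y := by
    refine equalizer.hom_ext ?_
    rw [Category.assoc, Category.assoc, equalizer.lift_ι, MonoidalCategory.tensorHom_def',
      Category.assoc, ← whiskerLeft_comp_assoc, commaId_ι, whisker_exchange_assoc,
      ← rightUnitor_inv_naturality_assoc, e_comp_id, Category.id_comp, Category.comp_id]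
  assoc x y z t := by
    refine equalizer.hom_ext ?_
    rw [Category.assoc, Category.assoc, Category.assoc, equalizer.lift_ι, equalizer.lift_ι,
      ← tensorHom_id, tensorHom_comp_tensorHom_assoc, equalizer.lift_ι, Category.id_comp,
      ← id_tensorHom, tensorHom_comp_tensorHom_assoc, equalizer.lift_ι, Category.id_comp,
      ← Category.comp_id (commaι z t), ← tensorHom_comp_tensorHom_assoc,
      ← associator_inv_naturality_assoc, Category.comp_id, tensorHom_id, e_assoc,
      ← Category.comp_id (commaι x y), ← tensorHom_comp_tensorHom_assoc, id_tensorHom,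
      Category.comp_id]

variable (E) in
/-- The `V`-category `E ↓ i`. -/
abbrev comma (i : I) : VCat.{w} V where
  carrier := CommaOb E i

end GradedCat

end Fibres

noncomputable section Gamma

variable {V : Type u} [Category.{v} V] [MonoidalCategory V] [SymmetricCategory V]
  [HasCoproducts.{w} V]
  [∀ (A : V) (J : Type w), PreservesColimitsOfShape (Discrete J) (tensorLeft A)]
  [HasFiniteLimits V] {I : Type w} [SmallCategory I]

namespace GradedCat

variable {E : GradedCat V I}

variable (E) in
/-- The forgetful `V`-functor from `E ↓ i` to `E`. -/
abbrev forget (i : I) : comma E i ⟶ E.cat where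
  obj x := x.ob
  map x y := commaι x y
  map_id _ := equalizer.lift_ι _ _
  map_comp _ _ _ := equalizer.lift_ι _ _

lemma comma_ext {i : I} {x y : CommaOb E i} {A : V} {f g : A ⟶ (x ⟶[V] y)}
    (h : f ≫ (forget E i).map x y = g ≫ (forget E i).map x y) : f = g :=
  equalizer.hom_ext h

lemma commaId_forget {i : I} (e : E.cat) {u u' : E.deg e ⟶ i} (h : u = u') :
    commaId e h ≫ (forget E i).map (CommaOb.mk e u) (CommaOb.mk e u') = eId V e :=
  equalizer.lift_ι _ _

lemma post_commaId_forget {i : I} (z : CommaOb E i) (e : E.cat) {u u' : E.deg e ⟶ i}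
    (h : u = u') :
    post (a := CommaOb.mk e u) (b := CommaOb.mk e u') z (commaId e h) ≫
      (forget E i).map z (CommaOb.mk e u') = (forget E i).map z (CommaOb.mk e u) := by
  rw [map_post, commaId_forget, post_eId, Category.comp_id]

lemma pre_commaId_forget {i : I} (z : CommaOb E i) (e : E.cat) {u u' : E.deg e ⟶ i}
    (h : u = u') :
    pre (a := CommaOb.mk e u) (b := CommaOb.mk e u') (commaId e h) z ≫
      (forget E i).map (CommaOb.mk e u) z = (forget E i).map (CommaOb.mk e u') z := by
  rw [map_pre, commaId_forget, pre_eId, Category.comp_id]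

lemma commaMap_condition {i j : I} (u : i ⟶ j) (x y : CommaOb E i) :
    commaι x y ≫ E.coact x.ob y.ob ≫ _ ◁ push _ (y.hom ≫ u) =
      commaι x y ≫ (ρ_ (x.ob ⟶[V] y.ob)).inv ≫ _ ◁ single (x.hom ≫ u) := by
  have h := congrArg (· ≫ (x.ob ⟶[V] y.ob) ◁ push (E.deg x.ob) u) (commaι_condition x y)
  simpa only [Category.assoc, ← MonoidalCategory.whiskerLeft_comp, push_push, single_push]
    using h

variable (E) in
/-- The `V`-functor `E ↓ i ⟶ E ↓ j` given by composition with `u : i ⟶ j`. -/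
abbrev commaMap {i j : I} (u : i ⟶ j) : comma E i ⟶ comma E j where
  obj x := CommaOb.mk x.ob (x.hom ≫ u)
  map x y := equalizer.lift (commaι x y) (commaMap_condition u x y)
  map_id x := by
    refine comma_ext ?_
    rw [Category.assoc, EnrichedFunctor.map_id]
    refine (congrArg (_ ≫ ·) (equalizer.lift_ι _ _)).trans ?_
    exact (forget E i).map_id x
  map_comp x y z := by
    refine comma_ext ?_
    rw [Category.assoc, Category.assoc, EnrichedFunctor.map_comp, tensorHom_comp_tensorHom_assoc]
    refine (congrArg (_ ≫ ·) (equalizer.lift_ι _ (commaMap_condition u x z))).trans ?_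
    refine ((forget E i).map_comp x y z).trans ?_
    exact congrArg₂ (fun f g => (f ⊗ₘ g) ≫ _) (equalizer.lift_ι _ (commaMap_condition u x y)).symm
      (equalizer.lift_ι _ (commaMap_condition u y z)).symm

lemma commaMap_forget {i j : I} (u : i ⟶ j) (x y : CommaOb E i) :
    (commaMap E u).map x y ≫ (forget E j).map _ _ = (forget E i).map x y := equalizer.lift_ι _ _

lemma commaId_commaMap {i j : I} (u : i ⟶ j) (e : E.cat) {v v' : E.deg e ⟶ i} (h : v = v') :
    commaId e h ≫ (commaMap E u).map (CommaOb.mk e v) (CommaOb.mk e v') =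
      commaId e (congrArg (· ≫ u) h) := by
  refine comma_ext ?_
  rw [Category.assoc, commaMap_forget, commaId_forget]
  exact (commaId_forget e _).symm

lemma commaId_comp {i : I} (e : E.cat) {u u' u'' : E.deg e ⟶ i} (h : u = u') (h' : u' = u'') :
    ucomp (a := CommaOb.mk e u) (b := CommaOb.mk e u') (c := CommaOb.mk e u'')
      (commaId e h) (commaId e h') = commaId e (h.trans h') := by
  subst h h'
  exact ucomp_eId (a := CommaOb.mk e u) (b := CommaOb.mk e u) _

lemma comma_eId {i : I} (x : CommaOb E i) : eId V x = commaId x.ob (Eq.refl x.hom) := rfl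

/-- `V`-naturality of a family of morphisms given by identities of `E`. -/
lemma commaId_naturality {j : I} {e e' : E.cat} {u v : E.deg e ⟶ j} {u' v' : E.deg e' ⟶ j}
    (h : u = v) (h' : u' = v') {A : V} {f : A ⟶ (CommaOb.mk e u ⟶[V] CommaOb.mk e' u')}
    {g : A ⟶ (CommaOb.mk e v ⟶[V] CommaOb.mk e' v')}
    (hm : f ≫ (forget E j).map (CommaOb.mk e u) (CommaOb.mk e' u') =
      g ≫ (forget E j).map (CommaOb.mk e v) (CommaOb.mk e' v')) :
    f ≫ post (b := CommaOb.mk e' v') (CommaOb.mk e u) (commaId e' h') =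
      g ≫ pre (a := CommaOb.mk e u) (commaId e h) (CommaOb.mk e' v') := by
  refine comma_ext ?_
  rw [Category.assoc, Category.assoc, post_commaId_forget, pre_commaId_forget, hm]

/-- Morphisms of `E ↓ i` given by identities of `E`. -/
inductive IsCommaId {i : I} : {x y : CommaOb E i} → (𝟙_ V ⟶ (x ⟶[V] y)) → Prop
  | mk (e : E.cat) {u u' : E.deg e ⟶ i} (h : u = u') : IsCommaId (commaId e h)

namespace IsCommaId

lemma unique {i : I} {x y : CommaOb E i} {f g : 𝟙_ V ⟶ (x ⟶[V] y)} (hf : IsCommaId f)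
    (hg : IsCommaId g) : f = g := by
  cases hf
  cases hg
  rfl

lemma eId {i : I} (x : CommaOb E i) : IsCommaId (eId V x) := .mk x.ob rfl

lemma ucomp {i : I} {x y z : CommaOb E i} {f : 𝟙_ V ⟶ (x ⟶[V] y)} {g : 𝟙_ V ⟶ (y ⟶[V] z)}
    (hf : IsCommaId f) (hg : IsCommaId g) : IsCommaId (ucomp f g) := by
  cases hf
  cases hg
  rw [commaId_comp]
  exact .mk _ _

lemma map {i j : I} {x y : CommaOb E i} {f : 𝟙_ V ⟶ (x ⟶[V] y)} (hf : IsCommaId f)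
    (u : i ⟶ j) : IsCommaId (f ≫ (commaMap E u).map x y) := by
  cases hf
  rw [commaId_commaMap]
  exact .mk _ _

end IsCommaId

lemma comp_as_eq {i j : LocallyDiscrete I} {f g : i ⟶ j} (η : f ⟶ g) {k : I} (u : k ⟶ i.as) :
    u ≫ f.as = u ≫ g.as := by
  rw [LocallyDiscrete.eq_of_hom η]

variable (E) in
/-- The functor `i ↦ E ↓ i`. -/
def Gamma : OplaxFunctor (LocallyDiscrete I) (VCat.{w} V) where
  obj i := comma E i.as
  map u := commaMap E u.as
  map₂ η :=
    { app x := commaId x.ob (comp_as_eq η x.hom)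
      naturality x y := commaId_naturality _ _ (by rw [commaMap_forget, commaMap_forget]) }
  map₂_id _ := rfl
  map₂_comp η θ := VCat.hom_ext fun x => IsCommaId.unique (.mk _ (comp_as_eq (η ≫ θ) _))
    (.ucomp (.mk _ (comp_as_eq η _)) (.mk _ (comp_as_eq θ _)))
  mapId i :=
    { app x := commaId x.ob (Category.comp_id _)
      naturality x y := commaId_naturality _ _ (by
        rw [commaMap_forget]; exact (Category.id_comp _).symm) }
  mapComp u v :=
    { app x := commaId x.ob (Category.assoc _ _ _).symm
      naturality x y := commaId_naturality _ _ (by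
        rw [commaMap_forget]
        refine Eq.trans ?_ (Category.assoc _ _ _).symm
        rw [commaMap_forget, commaMap_forget]) }
  mapComp_naturality_left η g := VCat.hom_ext fun x => IsCommaId.unique
    (.ucomp (.mk _ (comp_as_eq (Bicategory.whiskerRight η g) _))
      (.mk _ (Category.assoc _ _ _).symm))
    (.ucomp (.mk _ (Category.assoc _ _ _).symm) (.map (.mk _ (comp_as_eq η _)) g.as))
  mapComp_naturality_right f _ _ η := VCat.hom_ext fun x => IsCommaId.unique
    (.ucomp (.mk _ (comp_as_eq (Bicategory.whiskerLeft f η) _))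
      (.mk _ (Category.assoc _ _ _).symm))
    (.ucomp (.mk _ (Category.assoc _ _ _).symm) (.mk _ (comp_as_eq η _)))
  map₂_associator f g h := VCat.hom_ext fun x => IsCommaId.unique
    (.ucomp (.mk _ (comp_as_eq (Bicategory.associator f g h).hom _))
      (.ucomp (.mk _ (Category.assoc _ _ _).symm) (.mk _ (Category.assoc _ _ _).symm)))
    (.ucomp (.mk _ (Category.assoc _ _ _).symm)
      (.ucomp (.map (.mk _ (Category.assoc _ _ _).symm) h.as) (.eId _)))
  map₂_leftUnitor f := VCat.hom_ext fun x => IsCommaId.unique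
    (.mk _ (comp_as_eq (Bicategory.leftUnitor f).hom _))
    (.ucomp (.mk _ (Category.assoc _ _ _).symm)
      (.ucomp (.map (.mk _ (Category.comp_id _)) f.as) (.eId _)))
  map₂_rightUnitor f := VCat.hom_ext fun x => IsCommaId.unique
    (.mk _ (comp_as_eq (Bicategory.rightUnitor f).hom _))
    (.ucomp (.mk _ (Category.assoc _ _ _).symm) (.ucomp (.mk _ (Category.comp_id _)) (.eId _)))

end GradedCat

end Gamma

/-! ### Transport of an oplax functor along adjunctions -/

section Transport

variable {V : Type u} [Category.{v} V] [MonoidalCategory V]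

namespace VCat

/-- The effect of a `V`-functor on morphisms of the underlying category. -/
abbrev el {C D : VCat.{w} V} (F : C ⟶ D) {x y : C} (f : 𝟙_ V ⟶ (x ⟶[V] y)) :
    𝟙_ V ⟶ (F.obj x ⟶[V] F.obj y) := f ≫ F.map x y

lemma el_ucomp {C D : VCat.{w} V} (F : C ⟶ D) {x y z : C} (f : 𝟙_ V ⟶ (x ⟶[V] y))
    (g : 𝟙_ V ⟶ (y ⟶[V] z)) : el F (ucomp f g) = ucomp (el F f) (el F g) := ucomp_map F f g

lemma el_eId {C D : VCat.{w} V} (F : C ⟶ D) (x : C) : el F (eId V x) = eId V (F.obj x) :=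
  F.map_id x

lemma nat_el {C D : VCat.{w} V} {F G : C ⟶ D} (α : F ⟶ G) {x y : C} (f : 𝟙_ V ⟶ (x ⟶[V] y)) :
    ucomp (el F f) (α.app y) = ucomp (α.app x) (el G f) := VNat.naturality_elem α f

lemma adj_left {C D : VCat.{w} V} {l : C ⟶ D} {r : D ⟶ C} (adj : Bicategory.Adjunction l r)
    (x : C) : ucomp (el l (adj.unit.app x)) (adj.counit.app (l.obj x)) = eId V (l.obj x) := by
  have h := congrArg (fun α => VNat.app α x) adj.left_triangle
  simp only [Bicategory.leftZigzag, bicategoricalComp] at h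
  simpa [ucomp_eId, eId_ucomp] using h

lemma adj_right {C D : VCat.{w} V} {l : C ⟶ D} {r : D ⟶ C} (adj : Bicategory.Adjunction l r)
    (x : D) : ucomp (adj.unit.app (r.obj x)) (el r (adj.counit.app x)) = eId V (r.obj x) := by
  have h := congrArg (fun α => VNat.app α x) adj.right_triangle
  simp only [Bicategory.rightZigzag, bicategoricalComp] at h
  simpa [ucomp_eId, eId_ucomp] using h

end VCat

end Transport

section Transport2

section Aux

variable {V : Type u} [Category.{v} V] [MonoidalCategory V] {C : Type w₁} [EnrichedCategory V C]

lemma ucomp_aux₁ {a b c d e f x y z : C} {p : 𝟙_ V ⟶ (a ⟶[V] b)} {m₁ : 𝟙_ V ⟶ (b ⟶[V] c)}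
    {m₀ : 𝟙_ V ⟶ (c ⟶[V] d)} {m₃ : 𝟙_ V ⟶ (a ⟶[V] e)} {m₄ : 𝟙_ V ⟶ (e ⟶[V] d)}
    {q : 𝟙_ V ⟶ (c ⟶[V] f)} {m₂ : 𝟙_ V ⟶ (f ⟶[V] x)} {r : 𝟙_ V ⟶ (d ⟶[V] x)}
    {s : 𝟙_ V ⟶ (x ⟶[V] y)} {t : 𝟙_ V ⟶ (e ⟶[V] z)} {t' : 𝟙_ V ⟶ (z ⟶[V] y)}
    (h₁ : ucomp p (ucomp m₁ m₀) = ucomp m₃ m₄) (h₂ : ucomp q m₂ = ucomp m₀ r)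
    (h₃ : ucomp (ucomp m₄ r) s = ucomp t t') :
    ucomp p (ucomp (ucomp m₁ q) (ucomp m₂ s)) = ucomp (ucomp m₃ t) t' := by
  rw [ucomp_assoc m₃, ← h₃, ucomp_assoc m₁, ← ucomp_assoc q, h₂, ucomp_assoc m₀,
    ← ucomp_assoc m₁, ← ucomp_assoc p, h₁]
  simp only [ucomp_assoc]

lemma ucomp_aux₂ {a b c d e : C} {m : 𝟙_ V ⟶ (a ⟶[V] b)} {p : 𝟙_ V ⟶ (b ⟶[V] c)}
    {q : 𝟙_ V ⟶ (c ⟶[V] d)} {k : 𝟙_ V ⟶ (d ⟶[V] e)} {m' : 𝟙_ V ⟶ (b ⟶[V] e)}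
    {n : 𝟙_ V ⟶ (e ⟶[V] d)} (h₁ : ucomp p q = ucomp m' n) (h₂ : ucomp n k = eId V e) :
    ucomp m m' = ucomp (ucomp m p) (ucomp q k) := by
  rw [ucomp_assoc, ← ucomp_assoc p, h₁, ucomp_assoc, h₂, ucomp_eId]

end Aux

variable {V : Type u} [Category.{v} V] [MonoidalCategory V]
  {B : Type w₁} [Bicategory.{w₂, w₃} B]

namespace VCat

variable (G : OplaxFunctor B (VCat.{w} V)) (C : B → VCat.{w} V) (r : ∀ a, C a ⟶ G.obj a)
  (l : ∀ a, G.obj a ⟶ C a) (adj : ∀ a, Bicategory.Adjunction (l a) (r a))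

/-- The oplax structure of `transport`: insert the unit of the adjunction in the middle. -/
def transportComp {a b c : B} (f : a ⟶ b) (g : b ⟶ c) :
    r a ≫ G.map (f ≫ g) ≫ l c ⟶ (r a ≫ G.map f ≫ l b) ≫ (r b ≫ G.map g ≫ l c) :=
  Bicategory.whiskerLeft (r a) (Bicategory.whiskerRight (G.mapComp f g) (l c) ≫
    (Bicategory.associator _ _ _).hom ≫
    Bicategory.whiskerLeft (G.map f) ((Bicategory.leftUnitor _).inv ≫
      Bicategory.whiskerRight (adj b).unit (G.map g ≫ l c) ≫
        (Bicategory.associator _ _ _).hom) ≫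
    (Bicategory.associator _ _ _).inv) ≫ (Bicategory.associator _ _ _).inv

lemma transportComp_app {a b c : B} (f : a ⟶ b) (g : b ⟶ c) (x : C a) :
    (transportComp G C r l adj f g).app x = el (l c) (ucomp ((G.mapComp f g).app ((r a).obj x))
      (el (G.map g) ((adj b).unit.app ((G.map f).obj ((r a).obj x))))) := by
  rw [el_ucomp, transportComp]
  simp [eId_ucomp, ucomp_eId]

/-- The oplax structure of `transport` on identities: use the counit of the adjunction. -/
def transportId (a : B) : r a ≫ G.map (𝟙 a) ≫ l a ⟶ 𝟙 (C a) :=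
  Bicategory.whiskerLeft (r a) (Bicategory.whiskerRight (G.mapId a) (l a) ≫
    (Bicategory.leftUnitor _).hom) ≫ (adj a).counit

lemma transportId_app (a : B) (x : C a) :
    (transportId G C r l adj a).app x = ucomp (el (l a) ((G.mapId a).app ((r a).obj x)))
      ((adj a).counit.app x) := by
  rw [transportId]
  simp [eId_ucomp]

lemma comp_el {C₁ C₂ C₃ C₄ : VCat.{w} V} (F : C₁ ⟶ C₂) (G : C₂ ⟶ C₃) (H : C₃ ⟶ C₄) {x y : C₁}
    (f : 𝟙_ V ⟶ (x ⟶[V] y)) : el (F ≫ G ≫ H) f = el H (el G (el F f)) := by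
  simp only [el, Category.assoc]
  rfl

lemma comp_el₂ {C₁ C₂ C₃ : VCat.{w} V} (F : C₁ ⟶ C₂) (G : C₂ ⟶ C₃) {x y : C₁}
    (f : 𝟙_ V ⟶ (x ⟶[V] y)) : el (F ≫ G) f = el G (el F f) :=
  (Category.assoc _ _ _).symm

lemma unit_nat {C D : VCat.{w} V} {l : C ⟶ D} {r : D ⟶ C} (adj : Bicategory.Adjunction l r)
    {x y : C} (f : 𝟙_ V ⟶ (x ⟶[V] y)) :
    ucomp f (adj.unit.app y) = ucomp (adj.unit.app x) (el r (el l f)) :=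
  (congrArg (ucomp · _) (Category.comp_id f).symm).trans ((nat_el adj.unit f).trans
    (congrArg (ucomp _ ·) (comp_el₂ _ _ _)))

lemma counit_nat {C D : VCat.{w} V} {l : C ⟶ D} {r : D ⟶ C} (adj : Bicategory.Adjunction l r)
    {x y : D} (f : 𝟙_ V ⟶ (x ⟶[V] y)) :
    ucomp (el l (el r f)) (adj.counit.app y) = ucomp (adj.counit.app x) f :=
  (congrArg (ucomp · _) (comp_el₂ _ _ _).symm).trans ((nat_el adj.counit f).trans
    (congrArg (ucomp _ ·) (Category.comp_id f)))

lemma el_sq {C D : VCat.{w} V} (F : C ⟶ D) {x y y' z : C} {f : 𝟙_ V ⟶ (x ⟶[V] y)}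
    {g : 𝟙_ V ⟶ (y ⟶[V] z)} {f' : 𝟙_ V ⟶ (x ⟶[V] y')} {g' : 𝟙_ V ⟶ (y' ⟶[V] z)}
    (h : ucomp f g = ucomp f' g') : ucomp (el F f) (el F g) = ucomp (el F f') (el F g') := by
  rw [← el_ucomp, ← el_ucomp, h]

lemma transport_naturality_left {a b c : B} {f f' : a ⟶ b} (η : f ⟶ f') (g : b ⟶ c) (x : C a) :
    ucomp (el (l c) ((G.map₂ (Bicategory.whiskerRight η g)).app ((r a).obj x)))
      ((transportComp G C r l adj f' g).app x) =
    ucomp ((transportComp G C r l adj f g).app x)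
      (el (r b ≫ G.map g ≫ l c) (el (l b) ((G.map₂ η).app ((r a).obj x)))) := by
  have h : ucomp _ _ = ucomp _ (el (G.map g) _) :=
    congrArg (fun α => VNat.app α ((r a).obj x)) (G.mapComp_naturality_left η g)
  have h2 := unit_nat (adj b) ((G.map₂ η).app ((r a).obj x))
  rw [transportComp_app, transportComp_app, comp_el, ← el_ucomp, ← el_ucomp]
  exact congrArg (el (l c)) (sq_horiz h (el_sq (G.map g) h2))

lemma transport_naturality_right {a b c : B} (f : a ⟶ b) {g g' : b ⟶ c} (η : g ⟶ g') (x : C a) :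
    ucomp (el (l c) ((G.map₂ (Bicategory.whiskerLeft f η)).app ((r a).obj x)))
      ((transportComp G C r l adj f g').app x) =
    ucomp ((transportComp G C r l adj f g).app x)
      (el (l c) ((G.map₂ η).app ((r b).obj ((l b).obj ((G.map f).obj ((r a).obj x)))))) := by
  have h : ucomp _ _ = ucomp _ _ :=
    congrArg (fun α => VNat.app α ((r a).obj x)) (G.mapComp_naturality_right f η)
  have h2 := nat_el (G.map₂ η) ((adj b).unit.app ((G.map f).obj ((r a).obj x)))
  rw [transportComp_app, transportComp_app, ← el_ucomp, ← el_ucomp, ucomp_assoc]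
  refine congrArg (el (l c)) ?_
  refine Eq.trans ?_ (congrArg (ucomp _ ·) h2).symm
  rw [← ucomp_assoc, h, ucomp_assoc]
  rfl

lemma transport_assoc {a b c d : B} (f : a ⟶ b) (g : b ⟶ c) (h : c ⟶ d) (x : C a) :
    ucomp (el (l d) ((G.map₂ (Bicategory.associator f g h).hom).app ((r a).obj x)))
      (ucomp ((transportComp G C r l adj f (g ≫ h)).app x)
        ((transportComp G C r l adj g h).app ((l b).obj ((G.map f).obj ((r a).obj x))))) =
    ucomp ((transportComp G C r l adj (f ≫ g) h).app x)
      (el (r c ≫ G.map h ≫ l d) ((transportComp G C r l adj f g).app x)) := by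
  have h1 : ucomp _ (ucomp _ _) = ucomp _ (ucomp (el (G.map h) _) (eId V _)) :=
    congrArg (fun α => VNat.app α ((r a).obj x)) (G.map₂_associator f g h)
  rw [ucomp_eId] at h1
  have h2 := nat_el (G.mapComp g h) ((adj b).unit.app ((G.map f).obj ((r a).obj x)))
  rw [comp_el₂] at h2
  have h3 := unit_nat (adj c) (ucomp ((G.mapComp f g).app ((r a).obj x))
    (el (G.map g) ((adj b).unit.app ((G.map f).obj ((r a).obj x)))))
  rw [transportComp_app, transportComp_app, transportComp_app, transportComp_app, comp_el,
    ← el_ucomp, ← el_ucomp, ← el_ucomp]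
  refine congrArg (el (l d)) (ucomp_aux₁ h1 h2 ?_)
  refine Eq.trans ?_ (el_sq (G.map h) h3)
  exact congrArg (ucomp · _) (el_ucomp _ _ _).symm

lemma transport_leftUnitor {a b : B} (f : a ⟶ b) (x : C a) :
    el (l b) ((G.map₂ (Bicategory.leftUnitor f).hom).app ((r a).obj x)) =
    ucomp ((transportComp G C r l adj (𝟙 a) f).app x)
      (el (r a ≫ G.map f ≫ l b) ((transportId G C r l adj a).app x)) := by
  have h1 : _ = ucomp _ (ucomp (el (G.map f) _) (eId V _)) :=
    congrArg (fun α => VNat.app α ((r a).obj x)) (G.map₂_leftUnitor f)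
  rw [ucomp_eId] at h1
  have h2 := unit_nat (adj a) ((G.mapId a).app ((r a).obj x))
  have h3 := adj_right (adj a) x
  rw [transportComp_app, transportId_app, comp_el, ← el_ucomp, h1]
  refine congrArg (el (l b)) ?_
  refine Eq.trans ?_ (congrArg (fun f' => ucomp _ (el (G.map f) f'))
    (el_ucomp (r a) (el (l a) ((G.mapId a).app ((r a).obj x))) ((adj a).counit.app x)).symm)
  refine Eq.trans ?_ (congrArg (ucomp _ ·) (el_ucomp _ _ _).symm)
  refine ucomp_aux₂ (el_sq _ h2.symm) ?_
  exact (el_ucomp _ _ _).symm.trans ((congrArg (el (G.map f)) h3).trans (el_eId _ _))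

lemma transport_rightUnitor {a b : B} (f : a ⟶ b) (x : C a) :
    el (l b) ((G.map₂ (Bicategory.rightUnitor f).hom).app ((r a).obj x)) =
    ucomp ((transportComp G C r l adj f (𝟙 b)).app x)
      ((transportId G C r l adj b).app ((l b).obj ((G.map f).obj ((r a).obj x)))) := by
  have h1 : _ = ucomp _ (ucomp _ (eId V _)) :=
    congrArg (fun α => VNat.app α ((r a).obj x)) (G.map₂_rightUnitor f)
  rw [ucomp_eId] at h1
  have h2 := nat_el (G.mapId b) ((adj b).unit.app ((G.map f).obj ((r a).obj x)))
  have h3 := adj_left (adj b) ((G.map f).obj ((r a).obj x))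
  rw [transportComp_app, transportId_app, h1, el_ucomp, el_ucomp]
  exact ucomp_aux₂ (el_sq _ (h2.trans (congrArg (ucomp _ ·) (Category.comp_id _)))) h3

/-- Transport of an oplax functor along a family of adjunctions. -/
def transport : OplaxFunctor B (VCat.{w} V) where
  obj := C
  map f := r _ ≫ G.map f ≫ l _
  map₂ η := Bicategory.whiskerLeft (r _) (Bicategory.whiskerRight (G.map₂ η) (l _))
  mapId a := transportId G C r l adj a
  mapComp f g := transportComp G C r l adj f g
  mapComp_naturality_left η g := hom_ext fun x => transport_naturality_left G C r l adj η g x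
  mapComp_naturality_right f _ _ η := hom_ext fun x =>
    transport_naturality_right G C r l adj f η x
  map₂_associator f g h := hom_ext fun x => (transport_assoc G C r l adj f g h x).trans
    (congrArg (ucomp _ ·) (ucomp_eId _).symm)
  map₂_leftUnitor f := hom_ext fun x => (transport_leftUnitor G C r l adj f x).trans
    (congrArg (ucomp _ ·) (ucomp_eId _).symm)
  map₂_rightUnitor f := hom_ext fun x => (transport_rightUnitor G C r l adj f x).trans
    (congrArg (ucomp _ ·) (ucomp_eId _).symm)

end VCat

end Transport2

/-! ### Precofibered graded categories -/

noncomputable section Precofibered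

variable {V : Type u} [Category.{v} V] [MonoidalCategory V] [SymmetricCategory V]
  [HasCoproducts.{w} V]
  [∀ (A : V) (J : Type w), PreservesColimitsOfShape (Discrete J) (tensorLeft A)]
  [HasFiniteLimits V] {I : Type w} [SmallCategory I]

namespace GradedCat

variable (E : GradedCat V I)

/-- Objects of the fibre over `i`: the objects of degree `i`. -/
structure FibreOb (i : I) : Type w where
  /-- the underlying object of `E` -/
  ob : E.cat
  deg_eq : E.deg ob = i

variable {E} in
/-- An object of the fibre over `i` together with the identity morphism from its degree to `i`. -/
abbrev FibreOb.toComma {i : I} (x : FibreOb E i) : CommaOb E i := ⟨x.ob, eqToHom x.deg_eq⟩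

/-- The fibre `E|_i`. Its morphism object from `e` to `e'` is the equalizer of the coaction and
`1 ⊗ 1_i` from `E(e, e')` to `E(e, e') ⊗ (I(i, i) ⊗ 1)`, where `deg e = i` and `deg e' = i`; since
the identity morphism of `i` is used for `deg e ⟶ i` and `deg e' ⟶ i`, this is the morphism object
of `E ↓ i` from `(e, 1_i)` to `(e', 1_i)`. -/
instance {i : I} : EnrichedCategory V (FibreOb E i) where
  Hom x y := (x.toComma ⟶[V] y.toComma)
  id x := eId V x.toComma
  comp x y z := eComp V x.toComma y.toComma z.toComma
  id_comp x y := e_id_comp V x.toComma y.toComma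
  comp_id x y := e_comp_id V x.toComma y.toComma
  assoc x y z t := e_assoc V x.toComma y.toComma z.toComma t.toComma

/-- The fibre `E|_i`. -/
abbrev fibre (i : I) : VCat.{w} V where
  carrier := FibreOb E i

/-- The `V`-functor `e ↦ (e, 1_i)`. -/
def incl (i : I) : E.fibre i ⟶ E.comma i where
  obj x := x.toComma
  map x y := 𝟙 _
  map_id _ := Category.comp_id _
  map_comp _ _ _ := (Category.comp_id _).trans ((Category.id_comp _).symm.trans
    (congrArg (· ≫ _) (by simp)))

/-- A precofibered structure: a left adjoint `s i` of the inclusion of the fibre over `i`, for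
every `i`. -/
structure Precofibered where
  /-- the left adjoints -/
  s (i : I) : E.comma i ⟶ E.fibre i
  /-- the adjunctions -/
  adj (i : I) : Bicategory.Adjunction (s i) (E.incl i)

variable {E} in
/-- The oplax functor associated with a precofibered structure: it sends `i` to the fibre over `i`,
and `u : i ⟶ j` to the composite of the inclusion into `E ↓ i`, composition with `u`, and `s j`.
Its structure 2-cells are given by the counits and the units of the adjunctions. -/
def Precofibered.GammaCof (P : Precofibered E) : OplaxFunctor (LocallyDiscrete I) (VCat.{w} V) :=
  VCat.transport (Gamma E) (fun i => E.fibre i.as) (fun i => E.incl i.as) (fun i => P.s i.as)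
    fun i => P.adj i.as

end GradedCat

end Precofibered

/-! ### The Grothendieck construction -/

section GrAux

variable {V : Type u} [Category.{v} V] [MonoidalCategory V]
  {C : Type w₁} [EnrichedCategory V C] {D : Type w₂} [EnrichedCategory V D]
  {D' : Type w₃} [EnrichedCategory V D']

lemma e_assoc_map {A B : V} {x y z t : C} (m : A ⟶ (x ⟶[V] y)) (n : B ⟶ (y ⟶[V] z)) :
    (α_ A B (z ⟶[V] t)).hom ≫ A ◁ (n ▷ _ ≫ eComp V y z t) ≫ m ▷ _ ≫ eComp V x y t =
      ((m ⊗ₘ n) ≫ eComp V x y z) ▷ _ ≫ eComp V x z t := by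
  rw [whisker_exchange_assoc, MonoidalCategory.whiskerLeft_comp, Category.assoc, comp_whiskerRight,
    Category.assoc, ← e_assoc' V]
  simp [MonoidalCategory.tensorHom_def, -e_assoc]

lemma grComp_assoc_aux {G : EnrichedFunctor V C D} {H : EnrichedFunctor V D D'}
    {K : EnrichedFunctor V C D'} (n : ∀ x, 𝟙_ V ⟶ (K.obj x ⟶[V] H.obj (G.obj x)))
    {p y : C} {q z : D} {k k' t : D'}
    (hn : K.map p y ≫ post (K.obj p) (n y) =
      (G.map p y ≫ H.map (G.obj p) (G.obj y)) ≫ pre (n p) (H.obj (G.obj y)))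
    (a : 𝟙_ V ⟶ (q ⟶[V] G.obj p)) (b : 𝟙_ V ⟶ (k ⟶[V] H.obj q)) (c : 𝟙_ V ⟶ (k ⟶[V] k'))
    (d : 𝟙_ V ⟶ (k' ⟶[V] K.obj p)) (h : ucomp c (ucomp d (n p)) = ucomp b (a ≫ H.map _ _)) :
    (G.map p y ▷ (G.obj y ⟶[V] z) ≫ eComp V (G.obj p) (G.obj y) z ≫ pre a z) ▷ _ ≫
      H.map q z ▷ (H.obj z ⟶[V] t) ≫ eComp V (H.obj q) (H.obj z) t ≫ pre b t =
    (α_ _ _ _).hom ≫ _ ◁ (H.map (G.obj y) z ▷ (H.obj z ⟶[V] t) ≫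
      eComp V (H.obj (G.obj y)) (H.obj z) t ≫
      pre (n y) t) ≫ K.map p y ▷ _ ≫ eComp V (K.obj p) (K.obj y) t ≫ pre d t ≫ pre c t := by
  have e : (G.map p y ▷ (G.obj y ⟶[V] z) ≫ eComp V (G.obj p) (G.obj y) z ≫ pre a z) ≫
      H.map q z =
      (((G.map p y ≫ H.map _ _) ⊗ₘ H.map (G.obj y) z) ≫
        eComp V (H.obj (G.obj p)) (H.obj (G.obj y)) (H.obj z)) ≫
          pre (a ≫ H.map _ _) (H.obj z) := by
    rw [Category.assoc, Category.assoc, map_pre, ← Category.assoc (eComp V _ _ _), H.map_comp]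
    simp [MonoidalCategory.tensorHom_def]
  have e' : K.map p y ▷ (H.obj (G.obj y) ⟶[V] t) ≫ _ ◁ pre (n y) t ≫
      eComp V (K.obj p) (K.obj y) t =
      (G.map p y ≫ H.map _ _) ▷ _ ≫ eComp V _ _ _ ≫ pre (n p) t := by
    rw [← post_comp, ← comp_whiskerRight_assoc, hn, comp_pre, comp_whiskerRight_assoc]
  have e'' := e_assoc_map (t := t) (G.map p y ≫ H.map (G.obj p) (G.obj y))
    (H.map (G.obj y) z)
  calc
    _ = (((G.map p y ≫ H.map _ _) ⊗ₘ H.map (G.obj y) z) ≫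
        eComp V (H.obj (G.obj p)) (H.obj (G.obj y)) (H.obj z)) ▷ (H.obj z ⟶[V] t) ≫
          eComp V _ _ _ ≫ pre (ucomp b (a ≫ H.map _ _)) t := by
      rw [pre_ucomp, reassoc_of% (comp_pre (c := H.obj z) (d := t) (a ≫ H.map q (G.obj p))),
        ← comp_whiskerRight_assoc, ← comp_whiskerRight_assoc, e]
    _ = _ := by
      rw [← h, pre_ucomp, pre_ucomp, ← Category.assoc (_ ▷ _), ← e'']
      simp only [MonoidalCategory.whiskerLeft_comp, Category.assoc]
      rw [whisker_exchange_assoc (K.map p y) (pre (n y) t), reassoc_of% e']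

lemma grComp_unit_right_aux {K : EnrichedFunctor V C C} (n : ∀ x, 𝟙_ V ⟶ (K.obj x ⟶[V] x))
    {p y z : C} (hn : K.map p y ≫ post (K.obj p) (n y) = pre (n p) y) {k : C}
    (d : 𝟙_ V ⟶ (k ⟶[V] K.obj p)) (g : 𝟙_ V ⟶ (y ⟶[V] z)) :
    (ρ_ _).inv ≫ _ ◁ (g ≫ pre (n y) z) ≫ K.map p y ▷ _ ≫ eComp V _ _ _ ≫ pre d z =
      post p g ≫ pre (n p) z ≫ pre d z := by
  have e' : K.map p y ▷ (y ⟶[V] z) ≫ _ ◁ pre (n y) z ≫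
      eComp V (K.obj p) (K.obj y) z = eComp V _ _ _ ≫ pre (n p) z := by
    rw [← post_comp, ← comp_whiskerRight_assoc, hn, comp_pre]
  rw [MonoidalCategory.whiskerLeft_comp, Category.assoc, whisker_exchange_assoc (K.map p y),
    reassoc_of% e', post]
  simp only [Category.assoc]

end GrAux

section GrComp

variable {V : Type u} [Category.{v} V] [MonoidalCategory V]
  {B : Type w₁} [Bicategory.{w₂, w₃} B] (X : OplaxFunctor B (VCat.{w} V))

/-- The composition `g ∘ X(g)(f) ∘ X(f, g)` on components of the Grothendieck construction. -/
def grComp {a b c : B} (f : a ⟶ b) (g : b ⟶ c) (x : X.obj a) (y : X.obj b) (z : X.obj c) :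
    ((X.map f).obj x ⟶[V] y) ⊗ ((X.map g).obj y ⟶[V] z) ⟶ ((X.map (f ≫ g)).obj x ⟶[V] z) :=
  (X.map g).map _ _ ▷ _ ≫ eComp V ((X.map g).obj ((X.map f).obj x)) ((X.map g).obj y) z ≫
    pre ((X.mapComp f g).app x) z

lemma grComp_assoc {a b c d : B} (f : a ⟶ b) (g : b ⟶ c) (h : c ⟶ d) (x : X.obj a)
    (y : X.obj b) (z : X.obj c) (t : X.obj d) :
    grComp X f g x y z ▷ _ ≫ grComp X (f ≫ g) h x z t =
      (α_ _ _ _).hom ≫ _ ◁ grComp X g h y z t ≫ grComp X f (g ≫ h) x y t ≫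
        pre ((X.map₂ (Bicategory.associator f g h).hom).app x) t := by
  have h1 : ucomp _ (ucomp _ _) = ucomp _ (ucomp (VCat.el (X.map h) _) (eId V _)) :=
    congrArg (fun α => VNat.app α x) (X.map₂_associator f g h)
  rw [ucomp_eId] at h1
  simp only [grComp, Category.assoc]
  exact grComp_assoc_aux (G := X.map g) (H := X.map h) (K := X.map (g ≫ h))
    (X.mapComp g h).app ((X.mapComp g h).naturality _ _) _ _ _ _ h1

lemma grComp_id_left {a b : B} (f : a ⟶ b) (x : X.obj a) (y : X.obj b) :
    (λ_ _).inv ≫ (X.mapId a).app x ▷ _ ≫ grComp X (𝟙 a) f x x y =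
      pre ((X.map₂ (Bicategory.leftUnitor f).hom).app x) y := by
  have h1 : _ = ucomp _ (ucomp (VCat.el (X.map f) _) (eId V _)) :=
    congrArg (fun α => VNat.app α x) (X.map₂_leftUnitor f)
  rw [ucomp_eId] at h1
  rw [h1, pre_ucomp, grComp]
  simp only [pre, Category.assoc, ← comp_whiskerRight_assoc]
  rfl

lemma grComp_id_right {a b : B} (f : a ⟶ b) (x : X.obj a) (y z : X.obj b)
    (g : 𝟙_ V ⟶ (y ⟶[V] z)) :
    (ρ_ _).inv ≫ _ ◁ (g ≫ pre ((X.mapId b).app y) z) ≫ grComp X f (𝟙 b) x y z =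
      post ((X.map f).obj x) g ≫ pre ((X.map₂ (Bicategory.rightUnitor f).hom).app x) z := by
  have h1 : _ = ucomp _ (ucomp _ (eId V _)) :=
    congrArg (fun α => VNat.app α x) (X.map₂_rightUnitor f)
  rw [ucomp_eId] at h1
  rw [h1, pre_ucomp, grComp]
  exact grComp_unit_right_aux (K := X.map (𝟙 b)) (X.mapId b).app
    (((X.mapId b).naturality _ _).trans (Category.id_comp _)) _ _

lemma grComp_el_left {a b : B} (f : a ⟶ b) (x x' : X.obj a) (y : X.obj b)
    (g : 𝟙_ V ⟶ (x ⟶[V] x')) :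
    (λ_ _).inv ≫ (g ≫ pre ((X.mapId a).app x) x') ▷ _ ≫ grComp X (𝟙 a) f x x' y =
      pre (VCat.el (X.map f) g) y ≫ pre ((X.map₂ (Bicategory.leftUnitor f).hom).app x) y := by
  have h1 : _ = ucomp _ (ucomp (VCat.el (X.map f) _) (eId V _)) :=
    congrArg (fun α => VNat.app α x) (X.map₂_leftUnitor f)
  rw [ucomp_eId] at h1
  rw [h1, ← pre_ucomp, ucomp_assoc, ← VCat.el_ucomp, pre_ucomp, grComp, ucomp_eq_pre _ g]
  simp only [pre, VCat.el, Category.assoc, ← comp_whiskerRight_assoc]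
  rfl

end GrComp

section

variable {C : Type u} [Category.{v} C]

lemma comp₂_eq {a b c : C} {f : a ⟶ b} {g : b ⟶ c} {h : a ⟶ c} (e : f ≫ g = h) {d : C}
    (k : c ⟶ d) : f ≫ g ≫ k = h ≫ k := by
  rw [← e, Category.assoc]

lemma chain_eq {a b c d e e' : C} {f : a ⟶ b} {g : b ⟶ c} {h : c ⟶ d} {k : d ⟶ e} {l : e ⟶ e'}
    {m : d ⟶ e'} (w : k ≫ l = m) : (f ≫ g ≫ h ≫ k) ≫ l = f ≫ g ≫ h ≫ m := by
  simp only [Category.assoc, w]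

lemma comp₃_eq {a b c d : C} {f : a ⟶ b} {g : b ⟶ c} {h : c ⟶ d} {l : a ⟶ d}
    (e : f ≫ g ≫ h = l) {d' : C} (k : d ⟶ d') : f ≫ g ≫ h ≫ k = l ≫ k := by
  rw [← e, Category.assoc, Category.assoc]

end

noncomputable section Gr

variable {V : Type u} [Category.{v} V] [MonoidalCategory V] [SymmetricCategory V]
  [HasCoproducts.{w} V]
  [∀ (A : V) (J : Type w), PreservesColimitsOfShape (Discrete J) (tensorLeft A)]
  {I : Type w} [SmallCategory I] (X Y Z : OplaxFunctor (LocallyDiscrete I) (VCat.{w} V))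

/-- Objects of the Grothendieck construction. -/
structure GrOb : Type w where
  /-- the degree -/
  deg : I
  /-- the object of the corresponding category -/
  ob : X.obj ⟨deg⟩

variable {X Y Z}

/-- The component of degree `u` of a morphism object of the Grothendieck construction. -/
abbrev grComponent (x y : GrOb X) (u : x.deg ⟶ y.deg) : V := (X.map u.toLoc).obj x.ob ⟶[V] y.ob

/-- The inclusion of the component of degree `u`. -/
abbrev grι (x y : GrOb X) (u : x.deg ⟶ y.deg) : grComponent x y u ⟶ ∐ grComponent x y :=
  Sigma.ι (grComponent x y) u

/-- The identity: it lies in the component of the identity. -/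
abbrev grId (x : GrOb X) : 𝟙_ V ⟶ ∐ grComponent x x :=
  (X.mapId ⟨x.deg⟩).app x.ob ≫ grι x x (𝟙 _)

/-- The composition: the components of degrees `u` and `v` are mapped to the component of degree
`u ≫ v`. -/
abbrev grMul (x y z : GrOb X) :
    (∐ grComponent x y) ⊗ (∐ grComponent y z) ⟶ ∐ grComponent x z :=
  tensorDesc fun u v => grComp X u.toLoc v.toLoc x.ob y.ob z.ob ≫ grι x z (u ≫ v)

lemma pre_grι {x y : GrOb X} {f g : (⟨x.deg⟩ : LocallyDiscrete I) ⟶ ⟨y.deg⟩} (η : f ⟶ g) :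
    pre ((X.map₂ η).app x.ob) y.ob ≫ grι x y f.as = grι x y g.as := by
  obtain rfl := LocallyDiscrete.eq_of_hom η
  obtain rfl : η = 𝟙 f := Subsingleton.elim _ _
  rw [X.map₂_id]
  exact (congrArg (· ≫ _) (pre_eId _ _)).trans (Category.id_comp _)

lemma tensorHom_grMul {x y z : GrOb X} (u : x.deg ⟶ y.deg) (v : y.deg ⟶ z.deg) :
    (grι x y u ⊗ₘ grι y z v) ≫ grMul x y z =
      grComp X u.toLoc v.toLoc x.ob y.ob z.ob ≫ grι x z (u ≫ v) :=
  ι_tensorDesc _ _ _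

lemma pair_grMul {x y z : GrOb X} {A A' : V} {u : x.deg ⟶ y.deg} {v : y.deg ⟶ z.deg}
    (f : A ⟶ grComponent x y u) (g : A' ⟶ grComponent y z v) :
    ((f ≫ grι x y u) ⊗ₘ (g ≫ grι y z v)) ≫ grMul x y z =
      (f ⊗ₘ g) ≫ grComp X u.toLoc v.toLoc x.ob y.ob z.ob ≫ grι x z (u ≫ v) := by
  rw [← tensorHom_comp_tensorHom, Category.assoc, tensorHom_grMul]

lemma pair_grMul_left {x y z : GrOb X} {A : V} {u : x.deg ⟶ y.deg} {v : y.deg ⟶ z.deg}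
    (f : A ⟶ grComponent x y u) :
    ((f ≫ grι x y u) ⊗ₘ grι y z v) ≫ grMul x y z =
      f ▷ _ ≫ grComp X u.toLoc v.toLoc x.ob y.ob z.ob ≫ grι x z (u ≫ v) := by
  rw [← tensorHom_id, ← pair_grMul, Category.id_comp]

lemma pair_grMul_right {x y z : GrOb X} {A : V} {u : x.deg ⟶ y.deg} {v : y.deg ⟶ z.deg}
    (f : A ⟶ grComponent y z v) :
    (grι x y u ⊗ₘ (f ≫ grι y z v)) ≫ grMul x y z =
      _ ◁ f ≫ grComp X u.toLoc v.toLoc x.ob y.ob z.ob ≫ grι x z (u ≫ v) := by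
  rw [← id_tensorHom, ← pair_grMul, Category.id_comp]

lemma grMul_left {x x' y : GrOb X} {u : x.deg ⟶ x'.deg} {v : x'.deg ⟶ y.deg}
    (f : 𝟙_ V ⟶ grComponent x x' u) :
    grι x' y v ≫ (λ_ _).inv ≫ (f ≫ grι x x' u) ▷ _ ≫ grMul x x' y =
      (λ_ _).inv ≫ f ▷ _ ≫ grComp X u.toLoc v.toLoc x.ob x'.ob y.ob ≫ grι x y (u ≫ v) := by
  have h := pair_grMul f (𝟙 (grComponent x' y v))
  rw [Category.id_comp, tensorHom_id] at h
  rw [← h, leftUnitor_inv_naturality_assoc, MonoidalCategory.tensorHom_def', Category.assoc]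

lemma grMul_right {x y y' : GrOb X} {u : x.deg ⟶ y.deg} {v : y.deg ⟶ y'.deg}
    (f : 𝟙_ V ⟶ grComponent y y' v) :
    grι x y u ≫ (ρ_ _).inv ≫ _ ◁ (f ≫ grι y y' v) ≫ grMul x y y' =
      (ρ_ _).inv ≫ _ ◁ f ≫ grComp X u.toLoc v.toLoc x.ob y.ob y'.ob ≫ grι x y' (u ≫ v) := by
  have h := pair_grMul (𝟙 (grComponent x y u)) f
  rw [Category.id_comp, id_tensorHom] at h
  rw [← h, rightUnitor_inv_naturality_assoc, MonoidalCategory.tensorHom_def, Category.assoc]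

lemma gr_id_comp (x y : GrOb X) : (λ_ _).inv ≫ grId x ▷ _ ≫ grMul x x y = 𝟙 _ := by
  refine Sigma.hom_ext _ _ fun u => ?_
  refine (grMul_left (u := 𝟙 x.deg) (v := u) ((X.mapId ⟨x.deg⟩).app x.ob)).trans ?_
  have h := grComp_id_left X u.toLoc x.ob y.ob
  refine (comp₃_eq h _).trans ?_
  exact (pre_grι (Bicategory.leftUnitor u.toLoc).hom).trans (Category.comp_id _).symm

lemma gr_comp_id (x y : GrOb X) : (ρ_ _).inv ≫ _ ◁ grId y ≫ grMul x y y = 𝟙 _ := by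
  refine Sigma.hom_ext _ _ fun u => ?_
  refine (grMul_right (u := u) (v := 𝟙 y.deg) ((X.mapId ⟨y.deg⟩).app y.ob)).trans ?_
  have h := grComp_id_right X u.toLoc x.ob y.ob y.ob (eId V _)
  rw [post_eId, Category.id_comp, ← ucomp_eq_pre, ucomp_eId] at h
  refine (comp₃_eq h _).trans ?_
  exact (pre_grι (Bicategory.rightUnitor u.toLoc).hom).trans (Category.comp_id _).symm

lemma gr_assoc (x y z t : GrOb X) :
    (α_ _ _ _).inv ≫ grMul x y z ▷ _ ≫ grMul x z t = _ ◁ grMul y z t ≫ grMul x y t := by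
  rw [Iso.inv_comp_eq]
  refine tensor_sigma_ext₃ fun u v r => ?_
  have h := grComp_assoc X u.toLoc v.toLoc r.toLoc x.ob y.ob z.ob t.ob
  have h' := pre_grι (x := x) (y := t) (Bicategory.associator u.toLoc v.toLoc r.toLoc).hom
  have e₁ : ((grι x y u ⊗ₘ grι y z v) ⊗ₘ grι z t r) ≫ grMul x y z ▷ _ =
      (grComp X u.toLoc v.toLoc x.ob y.ob z.ob ≫ grι x z (u ≫ v)) ⊗ₘ grι z t r := by
    refine (tensorHom_comp_whiskerRight _ _ _).trans ?_
    exact congrArg (· ⊗ₘ _) (tensorHom_grMul u v)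
  have e₂ : (grι x y u ⊗ₘ (grι y z v ⊗ₘ grι z t r)) ≫ _ ◁ grMul y z t =
      grι x y u ⊗ₘ (grComp X v.toLoc r.toLoc y.ob z.ob t.ob ≫ grι y t (v ≫ r)) := by
    refine (tensorHom_comp_whiskerLeft _ _ _).trans ?_
    exact congrArg (_ ⊗ₘ ·) (tensorHom_grMul v r)
  refine (comp₂_eq e₁ _).trans ((pair_grMul_left _).trans ?_)
  refine Eq.trans ?_ (associator_naturality_assoc _ _ _ _).symm
  refine Eq.trans ?_ (congrArg (_ ≫ ·) ((comp₂_eq e₂ _).trans (pair_grMul_right _))).symm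
  refine (comp₂_eq h _).trans ?_
  exact chain_eq h'

instance : EnrichedCategory V (GrOb X) where
  Hom x y := ∐ grComponent x y
  id x := grId x
  comp x y z := grMul x y z
  id_comp x y := gr_id_comp x y
  comp_id x y := gr_comp_id x y
  assoc x y z t := gr_assoc x y z t

/-- The coaction: the component of degree `u` is of degree `u`. -/
abbrev grCoact (x y : GrOb X) :
    (∐ grComponent x y) ⟶ (∐ grComponent x y) ⊗ freeObj V (x.deg ⟶ y.deg) :=
  Sigma.desc fun u => (ρ_ _).inv ≫ (grι x y u ⊗ₘ single u)

lemma ι_grCoact (x y : GrOb X) (u : x.deg ⟶ y.deg) :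
    grι x y u ≫ grCoact x y = (ρ_ _).inv ≫ (grι x y u ⊗ₘ single u) :=
  Sigma.ι_desc _ _

lemma el_grCoact_aux {A B S : V} (f : 𝟙_ V ⟶ A) (a : A ⟶ B) (s : 𝟙_ V ⟶ S) :
    f ≫ (ρ_ A).inv ≫ (a ⊗ₘ s) = tpair (f ≫ a) s := by
  rw [rightUnitor_inv_naturality_assoc, tpair, unitors_inv_equal,
    ← tensorHom_id, tensorHom_comp_tensorHom, Category.id_comp]

lemma el_grCoact {x y : GrOb X} (u : x.deg ⟶ y.deg) (f : 𝟙_ V ⟶ grComponent x y u) :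
    (f ≫ grι x y u) ≫ grCoact x y = tpair (f ≫ grι x y u) (single u) := by
  rw [Category.assoc, ι_grCoact, el_grCoact_aux]

lemma grCoact_id (x : GrOb X) :
    grId x ≫ grCoact x x = tpair (grId x) (single (𝟙 x.deg)) :=
  el_grCoact (𝟙 x.deg) _

lemma grCoact_comp_aux {A B C S T R : V} {A' B' C' : V} (a : A ⟶ A') (b : B ⟶ B') (c : C ⟶ C')
    (s : 𝟙_ V ⟶ S) (t : 𝟙_ V ⟶ T) (r : 𝟙_ V ⟶ R) (n : S ⊗ T ⟶ R) (m : A ⊗ B ⟶ C)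
    (m' : A' ⊗ B' ⟶ C') (h : (a ⊗ₘ b) ≫ m' = m ≫ c) (h' : (s ⊗ₘ t) ≫ n = (λ_ _).hom ≫ r) :
    m ≫ (ρ_ _).inv ≫ (c ⊗ₘ r) = (((ρ_ _).inv ≫ (a ⊗ₘ s)) ⊗ₘ ((ρ_ _).inv ≫ (b ⊗ₘ t))) ≫
      tensorμ _ _ _ _ ≫ (m' ⊗ₘ n) := by
  have e := tensorμ_unit A B
  rw [← tensorHom_comp_tensorHom, Category.assoc, tensorμ_natural_assoc, tensorHom_comp_tensorHom,
    h, h', reassoc_of% e, ← id_tensorHom, tensorHom_comp_tensorHom, Iso.inv_hom_id_assoc,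
    Category.id_comp, rightUnitor_inv_naturality_assoc, ← tensorHom_id, tensorHom_comp_tensorHom,
    Category.id_comp]

lemma grCoact_comp (x y z : GrOb X) : grMul x y z ≫ grCoact x z =
    (grCoact x y ⊗ₘ grCoact y z) ≫ tensorμ _ _ _ _ ≫
      (grMul x y z ⊗ₘ freeComp x.deg y.deg z.deg) := by
  refine tensor_sigma_ext fun u v => ?_
  have h := grCoact_comp_aux (grι x y u) (grι y z v) (grι x z (u ≫ v)) (single u) (single v)
    (single (u ≫ v)) (freeComp x.deg y.deg z.deg) (grComp X u.toLoc v.toLoc x.ob y.ob z.ob)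
    (grMul x y z) (tensorHom_grMul u v) (single_freeComp u v)
  have e : (grι x y u ⊗ₘ grι y z v) ≫ (grCoact x y ⊗ₘ grCoact y z) = _ :=
    (tensorHom_comp_tensorHom _ _ _ _).trans (congrArg₂ (· ⊗ₘ ·) (ι_grCoact x y u)
      (ι_grCoact y z v))
  refine (Category.assoc _ _ _).symm.trans ((congrArg (· ≫ _) (tensorHom_grMul u v)).trans ?_)
  refine Eq.trans ?_ ((congrArg (· ≫ _) e).symm.trans (Category.assoc _ _ _))
  refine (Category.assoc _ _ _).trans ((congrArg (_ ≫ ·) (ι_grCoact x z (u ≫ v))).trans h)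

lemma grCoact_counit (x y : GrOb X) :
    grCoact x y ≫ _ ◁ counit _ ≫ (ρ_ _).hom = 𝟙 _ := by
  refine Sigma.hom_ext _ _ fun u => ?_
  refine (comp₂_eq (ι_grCoact x y u) _).trans ?_
  rw [Category.assoc, tensorHom_comp_whiskerLeft_assoc, single_counit]
  simp

lemma grCoact_coassoc_aux {A B S : V} (a : A ⟶ B) (s : 𝟙_ V ⟶ S) :
    (ρ_ _).inv ≫ (((ρ_ _).inv ≫ (a ⊗ₘ s)) ⊗ₘ s) ≫ (α_ _ _ _).hom =
      (ρ_ _).inv ≫ (a ⊗ₘ tpair s s) := by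
  have h : ((ρ_ A).inv ≫ (a ⊗ₘ s)) ⊗ₘ s = ((ρ_ A).inv ▷ _) ≫ ((a ⊗ₘ s) ⊗ₘ s) := by
    rw [← tensorHom_id, tensorHom_comp_tensorHom, Category.id_comp]
  have h' : a ⊗ₘ tpair s s = (_ ◁ (λ_ _).inv) ≫ (a ⊗ₘ (s ⊗ₘ s)) := by
    rw [← id_tensorHom, tensorHom_comp_tensorHom, Category.id_comp, tpair]
  rw [h, h', Category.assoc, associator_naturality, triangle_assoc_comp_right_inv_assoc]

lemma grCoact_coassoc (x y : GrOb X) :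
    grCoact x y ≫ grCoact x y ▷ _ ≫ (α_ _ _ _).hom = grCoact x y ≫ _ ◁ comul _ := by
  refine Sigma.hom_ext _ _ fun u => ?_
  refine (comp₂_eq (ι_grCoact x y u) _).trans (Eq.trans ?_
    (comp₂_eq (ι_grCoact x y u) _).symm)
  rw [Category.assoc, Category.assoc, tensorHom_comp_whiskerLeft, single_comul,
    tensorHom_comp_whiskerRight_assoc, ι_grCoact]
  exact grCoact_coassoc_aux _ _

variable (X) in
/-- The Grothendieck construction of an oplax functor. -/
def Gr : GradedCat V I where
  cat := ⟨GrOb X⟩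
  deg x := x.deg
  coact x y := grCoact x y
  coact_id x := grCoact_id x
  coact_comp x y z := grCoact_comp x y z
  coact_counit x y := grCoact_counit x y
  coact_coassoc x y := grCoact_coassoc x y

end Gr

section GrMapAux

variable {V : Type u} [Category.{v} V] [MonoidalCategory V]
  {C : Type w₁} [EnrichedCategory V C] {D : Type w₂} [EnrichedCategory V D]
  {C' : Type w₃} [EnrichedCategory V C'] {D' : Type w₄} [EnrichedCategory V D']

lemma grMap_comp_aux {F : EnrichedFunctor V C D} {G : EnrichedFunctor V C C'}
    {G' : EnrichedFunctor V D D'} {F' : EnrichedFunctor V C' D'}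
    (n : ∀ x, 𝟙_ V ⟶ (G'.obj (F.obj x) ⟶[V] F'.obj (G.obj x))) {p y : C} {q z : C'} {k : D}
    {m : D'}
    (hn : (F.map p y ≫ G'.map _ _) ≫ post _ (n y) = (G.map p y ≫ F'.map _ _) ≫ pre (n p) _)
    (a : 𝟙_ V ⟶ (q ⟶[V] G.obj p)) (b : 𝟙_ V ⟶ (m ⟶[V] F'.obj q)) (c : 𝟙_ V ⟶ (k ⟶[V] F.obj p))
    (d : 𝟙_ V ⟶ (m ⟶[V] G'.obj k))
    (h : ucomp b (a ≫ F'.map _ _) = ucomp d (ucomp (c ≫ G'.map _ _) (n p))) :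
    (G.map p y ▷ (G.obj y ⟶[V] z) ≫ eComp V (G.obj p) (G.obj y) z ≫ pre a z) ≫
      F'.map q z ≫ pre b (F'.obj z) =
    ((F.map p y ≫ pre c (F.obj y)) ⊗ₘ (F'.map (G.obj y) z ≫ pre (n y) (F'.obj z))) ≫
      G'.map k (F.obj y) ▷ _ ≫ eComp V (G'.obj k) (G'.obj (F.obj y)) (F'.obj z) ≫
        pre d (F'.obj z) := by
  have e : (G.map p y ▷ (G.obj y ⟶[V] z) ≫ eComp V (G.obj p) (G.obj y) z ≫ pre a z) ≫
      F'.map q z = ((G.map p y ≫ F'.map _ _) ⊗ₘ F'.map (G.obj y) z) ≫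
        eComp V _ _ _ ≫ pre (a ≫ F'.map _ _) (F'.obj z) := by
    rw [Category.assoc, Category.assoc, map_pre, ← Category.assoc (eComp V _ _ _), F'.map_comp]
    simp [MonoidalCategory.tensorHom_def]
  have e' : ((F.map p y ≫ pre c (F.obj y)) ≫ G'.map k (F.obj y)) ≫ post _ (n y) =
      (G.map p y ≫ F'.map _ _) ≫ pre (ucomp (c ≫ G'.map _ _) (n p)) _ := by
    rw [Category.assoc (F.map p y), map_pre, Category.assoc, Category.assoc, pre_post,
      pre_ucomp, ← Category.assoc, ← Category.assoc, hn]
    simp only [Category.assoc]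
  calc
    _ = ((G.map p y ≫ F'.map _ _) ⊗ₘ F'.map (G.obj y) z) ≫ eComp V _ _ _ ≫
        pre (ucomp b (a ≫ F'.map _ _)) (F'.obj z) := by
      rw [← Category.assoc _ (F'.map q z), e, pre_ucomp]
      simp only [Category.assoc]
    _ = (((G.map p y ≫ F'.map _ _) ≫ pre (ucomp (c ≫ G'.map _ _) (n p)) _) ⊗ₘ
        F'.map (G.obj y) z) ≫ eComp V _ _ _ ≫ pre d (F'.obj z) := by
      rw [h, pre_ucomp _ d, ← Category.assoc (eComp V _ _ _), comp_pre, Category.assoc,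
        tensorHom_comp_whiskerRight_assoc]
    _ = (((F.map p y ≫ pre c (F.obj y)) ≫ G'.map k (F.obj y)) ⊗ₘ F'.map (G.obj y) z) ≫
        (post _ (n y) ▷ _ ≫ eComp V _ _ _) ≫ pre d (F'.obj z) := by
      rw [← e', Category.assoc (_ ▷ _), tensorHom_comp_whiskerRight_assoc]
    _ = _ := by
      rw [post_comp, Category.assoc (_ ◁ _), tensorHom_comp_whiskerLeft_assoc,
        tensorHom_comp_whiskerRight_assoc]

end GrMapAux


noncomputable section GrMap

variable {V : Type u} [Category.{v} V] [MonoidalCategory V] [SymmetricCategory V]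
  [HasCoproducts.{w} V]
  [∀ (A : V) (J : Type w), PreservesColimitsOfShape (Discrete J) (tensorLeft A)]
  {I : Type w} [SmallCategory I] {X Y : OplaxFunctor (LocallyDiscrete I) (VCat.{w} V)}

/-- The effect of a left transformation on components of the Grothendieck constructions. -/
def grMapComp (F : X ⟶ Y) {a b : LocallyDiscrete I} (f : a ⟶ b) (x : X.obj a) (y : X.obj b) :
    ((X.map f).obj x ⟶[V] y) ⟶
      ((Y.map f).obj ((Oplax.LaxTrans.app F a).obj x) ⟶[V] (Oplax.LaxTrans.app F b).obj y) :=
  (Oplax.LaxTrans.app F b).map ((X.map f).obj x) y ≫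
    pre ((Oplax.LaxTrans.naturality F f).app x) ((Oplax.LaxTrans.app F b).obj y)

lemma grMapComp_id (F : X ⟶ Y) (a : LocallyDiscrete I) (x : X.obj a) :
    (X.mapId a).app x ≫ grMapComp F (𝟙 a) x x =
      (Y.mapId a).app ((Oplax.LaxTrans.app F a).obj x) := by
  have h : ucomp _ (VCat.el (Oplax.LaxTrans.app F a) _) = ucomp _ (ucomp (eId V _) (eId V _)) :=
    congrArg (fun α => VNat.app α x) (Oplax.LaxTrans.naturality_id F a)
  rw [ucomp_eId, ucomp_eId] at h
  refine Eq.trans ?_ h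
  rw [ucomp_eq_pre]
  exact (Category.assoc _ _ _).symm

lemma grMapComp_comp (F : X ⟶ Y) {a b c : LocallyDiscrete I} (f : a ⟶ b) (g : b ⟶ c)
    (x : X.obj a) (y : X.obj b) (z : X.obj c) :
    grComp X f g x y z ≫ grMapComp F (f ≫ g) x z =
      (grMapComp F f x y ⊗ₘ grMapComp F g y z) ≫ grComp Y f g _ _ _ := by
  have h : ucomp _ (VCat.el (Oplax.LaxTrans.app F c) _) = ucomp _ (ucomp (eId V _) (ucomp
      (VCat.el (Y.map g) _) (ucomp (eId V _) (ucomp _ (eId V _))))) :=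
    congrArg (fun α => VNat.app α x) (Oplax.LaxTrans.naturality_comp F f g)
  rw [eId_ucomp, eId_ucomp, ucomp_eId] at h
  exact grMap_comp_aux (F := Oplax.LaxTrans.app F b) (G := X.map g) (G' := Y.map g)
    (F' := Oplax.LaxTrans.app F c) (Oplax.LaxTrans.naturality F g).app
    ((Oplax.LaxTrans.naturality F g).naturality _ _) _ _ _ _ h

/-- The effect of a left transformation on objects of the Grothendieck constructions. -/
abbrev grMapOb (F : X ⟶ Y) (x : GrOb X) : GrOb Y := ⟨x.deg, (Oplax.LaxTrans.app F ⟨x.deg⟩).obj x.ob⟩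

/-- The effect of a left transformation on morphism objects of the Grothendieck constructions. -/
abbrev grMapHom (F : X ⟶ Y) (x y : GrOb X) :
    (∐ grComponent x y) ⟶ ∐ grComponent (grMapOb F x) (grMapOb F y) :=
  Sigma.desc fun u => grMapComp F u.toLoc x.ob y.ob ≫ grι (grMapOb F x) (grMapOb F y) u

lemma ι_grMapHom (F : X ⟶ Y) (x y : GrOb X) (u : x.deg ⟶ y.deg) :
    grι x y u ≫ grMapHom F x y = grMapComp F u.toLoc x.ob y.ob ≫
      grι (grMapOb F x) (grMapOb F y) u := Sigma.ι_desc _ _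

lemma grMapHom_id (F : X ⟶ Y) (x : GrOb X) : grId x ≫ grMapHom F x x = grId (grMapOb F x) := by
  refine (Category.assoc _ _ _).trans ((congrArg (_ ≫ ·) (ι_grMapHom F x x (𝟙 _))).trans ?_)
  exact comp₂_eq (grMapComp_id F ⟨x.deg⟩ x.ob) _

lemma grMapHom_comp (F : X ⟶ Y) (x y z : GrOb X) :
    grMul x y z ≫ grMapHom F x z = (grMapHom F x y ⊗ₘ grMapHom F y z) ≫ grMul _ _ _ := by
  refine tensor_sigma_ext fun u v => ?_
  have h := grMapComp_comp F u.toLoc v.toLoc x.ob y.ob z.ob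
  refine (comp₂_eq (tensorHom_grMul u v) _).trans ?_
  refine (Category.assoc _ _ _).trans ((congrArg (_ ≫ ·) (ι_grMapHom F x z (u ≫ v))).trans ?_)
  refine (comp₂_eq h _).trans ?_
  refine Eq.trans ?_ (comp₂_eq (tensorHom_comp_tensorHom _ _ _ _) _).symm
  refine Eq.trans ?_ (congrArg (· ≫ _)
    (congrArg₂ (· ⊗ₘ ·) (ι_grMapHom F x y u) (ι_grMapHom F y z v))).symm
  refine Eq.trans ?_ (pair_grMul (x := grMapOb F x) (y := grMapOb F y) (z := grMapOb F z)
    (u := u) (v := v) _ _).symm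
  exact Category.assoc _ _ _

lemma grMapHom_coact (F : X ⟶ Y) (x y : GrOb X) :
    grMapHom F x y ≫ grCoact (grMapOb F x) (grMapOb F y) =
      grCoact x y ≫ grMapHom F x y ▷ _ := by
  refine Sigma.hom_ext _ _ fun u => ?_
  refine (comp₂_eq (ι_grMapHom F x y u) _).trans ?_
  refine Eq.trans ?_ (comp₂_eq (ι_grCoact x y u) _).symm
  refine (Category.assoc _ _ _).trans ((congrArg (_ ≫ ·) (ι_grCoact (grMapOb F x) (grMapOb F y) u)).trans ?_)
  refine Eq.trans ?_ ((Category.assoc _ _ _).trans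
    (congrArg (_ ≫ ·) (tensorHom_comp_whiskerRight _ _ _))).symm
  refine Eq.trans ?_ (congrArg (fun f => _ ≫ (f ⊗ₘ _)) (ι_grMapHom F x y u)).symm
  rw [rightUnitor_inv_naturality_assoc]
  exact congrArg (_ ≫ ·) (whiskerRight_comp_tensorHom _ _ _)

/-- The left morphism of Grothendieck constructions induced by a left transformation. -/
abbrev grMap (F : X ⟶ Y) : Gr X ⟶ Gr Y where
  fn :=
    { obj x := grMapOb F x
      map x y := grMapHom F x y
      map_id x := grMapHom_id F x
      map_comp x y z := grMapHom_comp F x y z }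
  twist :=
    { app x := eId V ((Gr Y).coaction.obj (grMapOb F x))
      naturality x y := by
        refine (congrArg (_ ≫ ·) (post_eId _ _)).trans (Eq.trans ?_
          (congrArg (_ ≫ ·) (pre_eId _ _)).symm)
        exact congrArg (· ≫ 𝟙 _) (grMapHom_coact F x y) }
  exists_deg := ⟨fun x => 𝟙 _, fun x => rfl⟩

end GrMap

noncomputable section GrFunctor


variable {V : Type u} [Category.{v} V] [MonoidalCategory V] [SymmetricCategory V]
  [HasCoproducts.{w} V]
  [∀ (A : V) (J : Type w), PreservesColimitsOfShape (Discrete J) (tensorLeft A)]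
  {I : Type w} [SmallCategory I] {X Y : OplaxFunctor (LocallyDiscrete I) (VCat.{w} V)}

/-- A morphism of `X(i)` as a morphism of degree `1_i` of the Grothendieck construction. -/
def grEl {i : I} {x y : X.obj ⟨i⟩} (f : 𝟙_ V ⟶ (x ⟶[V] y)) :
    𝟙_ V ⟶ ((GrOb.mk i x : GrOb X) ⟶[V] (GrOb.mk i y : GrOb X)) :=
  (f ≫ pre ((X.mapId ⟨i⟩).app x) y) ≫ grι (GrOb.mk i x : GrOb X) (GrOb.mk i y : GrOb X) (𝟙 i)

lemma ι_post_grEl (z : GrOb X) {i : I} {x y : X.obj ⟨i⟩} (f : 𝟙_ V ⟶ (x ⟶[V] y))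
    (u : z.deg ⟶ i) :
    grι z ⟨i, x⟩ u ≫ post z (grEl f) = post ((X.map u.toLoc).obj z.ob) f ≫ grι z ⟨i, y⟩ u := by
  refine (grMul_right (y := ⟨i, x⟩) (y' := ⟨i, y⟩) (u := u) (v := 𝟙 i) _).trans ?_
  refine (comp₃_eq (grComp_id_right X u.toLoc z.ob x y f) _).trans ?_
  refine (Category.assoc _ _ _).trans (congrArg (_ ≫ ·) ?_)
  exact pre_grι (y := ⟨i, y⟩) (Bicategory.rightUnitor u.toLoc).hom

lemma ι_pre_grEl (z : GrOb X) {i : I} {x y : X.obj ⟨i⟩} (f : 𝟙_ V ⟶ (x ⟶[V] y))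
    (u : i ⟶ z.deg) :
    grι ⟨i, y⟩ z u ≫ pre (grEl f) z = pre (VCat.el (X.map u.toLoc) f) z.ob ≫ grι ⟨i, x⟩ z u := by
  refine (grMul_left (x := ⟨i, x⟩) (x' := ⟨i, y⟩) (u := 𝟙 i) (v := u) _).trans ?_
  refine (comp₃_eq (grComp_el_left X u.toLoc x y z.ob f) _).trans ?_
  refine (Category.assoc _ _ _).trans (congrArg (_ ≫ ·) ?_)
  exact pre_grι (x := ⟨i, x⟩) (Bicategory.leftUnitor u.toLoc).hom

lemma grEl_eId {i : I} (x : X.obj ⟨i⟩) : grEl (X := X) (eId V x) = eId V (GrOb.mk i x : GrOb X) := by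
  refine congrArg (· ≫ _) ?_
  exact (ucomp_eq_pre _ _).symm.trans (ucomp_eId _)

lemma grEl_ucomp {i : I} {x y z : X.obj ⟨i⟩} (f : 𝟙_ V ⟶ (x ⟶[V] y)) (g : 𝟙_ V ⟶ (y ⟶[V] z)) :
    grEl (X := X) (ucomp f g) = ucomp (grEl f) (grEl g) := by
  refine Eq.trans ?_ (ucomp_eq_post _ _).symm
  refine Eq.trans ?_ ((Category.assoc _ _ _).trans
    (congrArg (_ ≫ ·) (ι_post_grEl ⟨i, x⟩ g (𝟙 i)))).symm
  have h : (f ≫ post x g) ≫ pre ((X.mapId ⟨i⟩).app x) z =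
      (f ≫ pre ((X.mapId ⟨i⟩).app x) y) ≫ post ((X.map (𝟙 i).toLoc).obj x) g := by
    refine (Category.assoc _ _ _).trans (Eq.trans (congrArg (f ≫ ·) ?_) (Category.assoc _ _ _).symm)
    exact (pre_post _ _).symm
  rw [grEl, ucomp_eq_post]
  exact (congrArg (· ≫ _) h).trans (Category.assoc _ _ _)

lemma grMapComp_mod {F G : X ⟶ Y} (m : F ⟶ G) {a b : LocallyDiscrete I} (f : a ⟶ b)
    (x : X.obj a) (y : X.obj b) :
    grMapComp F f x y ≫ post _ ((Oplax.LaxTrans.Modification.app m.as b).app y) =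
      grMapComp G f x y ≫
        pre (VCat.el (Y.map f) ((Oplax.LaxTrans.Modification.app m.as a).app x)) _ := by
  have h : ucomp (VCat.el (Y.map f) _) _ = ucomp _ _ :=
    congrArg (fun α => VNat.app α x) (Oplax.LaxTrans.Modification.naturality m.as f)
  have h' := (Oplax.LaxTrans.Modification.app m.as b).naturality ((X.map f).obj x) y
  rw [grMapComp, grMapComp, Category.assoc, Category.assoc, ← pre_ucomp, h]
  refine (congrArg (_ ≫ ·) (pre_post _ _)).trans (Eq.trans ?_
    (congrArg (_ ≫ ·) (pre_ucomp _ _ _)).symm)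
  exact (comp₂_eq h' _).trans (Category.assoc _ _ _)

lemma eId_square' {C : VCat.{w} V} {a b : C} {i : I} {f : 𝟙_ V ⟶ (a ⟶[V] b)}
    {c : 𝟙_ V ⟶ (a ⟶[V] b) ⊗ freeObj V (i ⟶ i)} (hc : c = tpair f (single (𝟙 i))) :
    ucomp (C := tensorCat C (freeCat V I)) (a := (a, ⟨i⟩)) (b := (b, ⟨i⟩)) (c := (b, ⟨i⟩)) c
        (eId V ((b, ⟨i⟩) : tensorCat C (freeCat V I))) =
      ucomp (C := tensorCat C (freeCat V I)) (a := (a, ⟨i⟩)) (b := (a, ⟨i⟩)) (c := (b, ⟨i⟩))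
        (eId V ((a, ⟨i⟩) : tensorCat C (freeCat V I))) (tpair f (single (𝟙 i))) := by
  subst hc
  exact (ucomp_eId (C := tensorCat C (freeCat V I)) _).trans
    (eId_ucomp (V := V) (C := tensorCat C (freeCat V I)) (a := (a, ⟨i⟩)) (b := (b, ⟨i⟩)) _).symm

/-- The 2-morphism induced by a modification. -/
abbrev grMap₂ {F G : X ⟶ Y} (m : F ⟶ G) : grMap F ⟶ grMap G :=
  LeftMor₂.mk'
    { app x := grEl ((Oplax.LaxTrans.Modification.app m.as ⟨x.deg⟩).app x.ob)
      naturality x y := by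
        refine Sigma.hom_ext _ _ fun u => ?_
        refine (comp₂_eq (ι_grMapHom F x y u) _).trans (Eq.trans ?_
          (comp₂_eq (ι_grMapHom G x y u) _).symm)
        refine (Category.assoc _ _ _).trans (Eq.trans ?_ (Category.assoc _ _ _).symm)
        refine (congrArg (_ ≫ ·) (ι_post_grEl (grMapOb F x) _ u)).trans (Eq.trans ?_
          (congrArg (_ ≫ ·) (ι_pre_grEl (grMapOb G y) _ u)).symm)
        refine (Category.assoc _ _ _).symm.trans (Eq.trans ?_ (Category.assoc _ _ _))
        exact congrArg (· ≫ _) (grMapComp_mod m u.toLoc x.ob y.ob) } fun x =>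
    eId_square' (el_grCoact (x := grMapOb F x) (y := grMapOb G x) (𝟙 x.deg) _)

variable (X Y) in
/-- The functor sending a left transformation to the induced morphism of Grothendieck
constructions. -/
def Gr.homFunctor : (X ⟶ Y) ⥤ (Gr X ⟶ Gr Y) where
  obj F := grMap F
  map m := grMap₂ m
  map_id _ := GradedCat.hom_ext₂ (VCat.hom_ext fun _ => grEl_eId _)
  map_comp _ _ := GradedCat.hom_ext₂ (VCat.hom_ext fun _ => grEl_ucomp _ _)

end GrFunctor

end GradedV

/-!
The functor `F ↦ ε ∘ Gr(F)` from left transformations `X ⟶ Γ_cof(μ)` to left morphisms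
`Gr(X) ⟶ μ` is fully faithful and essentially surjective; its inverse is the required equivalence.

*The Grothendieck construction as a lax colimit.* `Gr(X)` is generated by the images of the
inclusions `grIncl i : X(i) ⟶ Gr(X)` and by morphisms `grGen u x : (x, i) ⟶ (X(u)(x), j)` of degree
`u : i ⟶ j`: the component of degree `u` of a morphism object consists of the composites of
`grGen u` with morphisms of `X(j)` (`grIncl_pre_grGen`). The relations between the generators
(`grGenNat`, `grGen_id`, `grGen_comp`) are those of a lax cocone. Hence a lax cocone under `X` with
vertex `C` gives a `V`-functor `Gr(X) ⟶ C` (`GrCocone.desc`), and a family of morphisms between the values of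
two `V`-functors out of `Gr(X)` is `V`-natural as soon as it is so on every `X(i)` and commutes with
the generators (`grNatMk`).

*Degrees.* Both the naturality of the twist `1 ⊗ d` of a left morphism out of `Gr(X)` and the
condition on a 2-morphism say that certain morphisms of `E` satisfy the equation that defines the
morphism objects of `E ↓ i` (`isHomog_of_twist`, `comm_iff_isHomog`), so that they lift, uniquely,
to `E ↓ i`.

*The morphism `ε`.* The inclusions of the fibres into `E`, compared by the units of the adjunctions
`s_i ⊣ i_i`, form a lax cocone under `Γ_cof(μ)` with vertex `E`; `ε` is the induced `V`-functor
(`cofCounit`). A modification is sent to the family of its components, considered in `E`. This gives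
faithfulness; fullness holds because the components of a 2-morphism are homogeneous, hence lie in
the fibres, and because a morphism out of `s_j a` is determined by its transpose
(`cofModApp_naturality`).

*Essential surjectivity.* A left morphism `H : Gr(X) ⟶ μ`, with a choice of the morphisms `d` of
its twist `1 ⊗ d`, gives a left transformation `X ⟶ Γ(μ)` (`restrict`). If the units are
invertible, the functors `s_i` form a left transformation `Γ(μ) ⟶ Γ_cof(μ)` (`VCat.toTransport`).
The composite is a preimage of `H`, up to the isomorphism given by the inverses of the units
(`cofRestrictIso`).
-/

namespace GradedV

/-! ### The generators of the Grothendieck construction -/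

section GrCompUnits

variable {V : Type u} [Category.{v} V] [MonoidalCategory V]
  {B : Type w₁} [Bicategory.{w₂, w₃} B] (X : OplaxFunctor B (VCat.{w} V))

lemma whiskerLeft_pre_mapId_grComp {a b : B} (f : a ⟶ b) (x : X.obj a) (y z : X.obj b) :
    _ ◁ pre ((X.mapId b).app y) z ≫ grComp X f (𝟙 b) x y z =
      eComp V ((X.map f).obj x) y z ≫ pre ((X.map₂ (Bicategory.rightUnitor f).hom).app x) z := by
  have h1 : _ = ucomp _ (ucomp _ (eId V _)) :=
    congrArg (fun α => VNat.app α x) (X.map₂_rightUnitor f)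
  rw [ucomp_eId] at h1
  have hn : (X.map (𝟙 b)).map ((X.map f).obj x) y ≫ post _ ((X.mapId b).app y) =
      pre ((X.mapId b).app ((X.map f).obj x)) y :=
    ((X.mapId b).naturality _ _).trans (Category.id_comp _)
  rw [h1, pre_ucomp, grComp, whisker_exchange_assoc]
  have e : (X.map (𝟙 b)).map ((X.map f).obj x) y ▷ _ ≫ _ ◁ pre ((X.mapId b).app y) z ≫
      eComp V _ _ z = eComp V ((X.map f).obj x) y z ≫ pre ((X.mapId b).app ((X.map f).obj x)) z := by
    have hp := post_comp (d := z) (a := (X.map (𝟙 b)).obj ((X.map f).obj x)) ((X.mapId b).app y)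
    refine (congrArg (_ ≫ ·) hp.symm).trans ?_
    refine (comp_whiskerRight_assoc _ _ _ _).symm.trans ?_
    refine (congrArg (fun m => m ▷ _ ≫ _) hn).trans ?_
    exact (comp_pre _).symm
  exact comp₃_eq e _ |>.trans (Category.assoc _ _ _)

lemma eId_whiskerRight_grComp {a b c : B} (f : a ⟶ b) (g : b ⟶ c) (x : X.obj a) (z : X.obj c) :
    (λ_ _).inv ≫ eId V ((X.map f).obj x) ▷ _ ≫ grComp X f g x ((X.map f).obj x) z =
      pre ((X.mapComp f g).app x) z := by
  rw [grComp, ← comp_whiskerRight_assoc, EnrichedFunctor.map_id]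
  exact (comp₃_eq (e_id_comp V _ _) _).trans (Category.id_comp _)

lemma whiskerLeft_eId_grComp {a b c : B} (f : a ⟶ b) (g : b ⟶ c) (x : X.obj a) (y : X.obj b) :
    (ρ_ _).inv ≫ _ ◁ eId V ((X.map g).obj y) ≫ grComp X f g x y ((X.map g).obj y) =
      (X.map g).map ((X.map f).obj x) y ≫ pre ((X.mapComp f g).app x) ((X.map g).obj y) := by
  rw [grComp, whisker_exchange_assoc, ← rightUnitor_inv_naturality_assoc]
  refine congrArg (_ ≫ ·) ?_
  exact (comp₃_eq (e_comp_id V _ _) _).trans (Category.id_comp _)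

end GrCompUnits

noncomputable section GrGenerators

variable {V : Type u} [Category.{v} V] [MonoidalCategory V] [SymmetricCategory V]
  [HasCoproducts.{w} V]
  [∀ (A : V) (J : Type w), PreservesColimitsOfShape (Discrete J) (tensorLeft A)]
  {I : Type w} [SmallCategory I] {X Y : OplaxFunctor (LocallyDiscrete I) (VCat.{w} V)}

/-- The effect on morphism objects of the inclusion of `X(i)` into the Grothendieck construction. -/
abbrev grInclMap {i : I} (x y : X.obj ⟨i⟩) :
    (x ⟶[V] y) ⟶ ∐ grComponent (GrOb.mk i x : GrOb X) (GrOb.mk i y) :=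
  pre ((X.mapId ⟨i⟩).app x) y ≫ grι (GrOb.mk i x : GrOb X) (GrOb.mk i y) (𝟙 i)

lemma ι_grInclMap_mul (z : GrOb X) {i : I} (x y : X.obj ⟨i⟩) (u : z.deg ⟶ i) :
    (grι z ⟨i, x⟩ u ⊗ₘ grInclMap x y) ≫ grMul z ⟨i, x⟩ ⟨i, y⟩ =
      eComp V ((X.map u.toLoc).obj z.ob) x y ≫ grι z ⟨i, y⟩ u := by
  refine (pair_grMul_right (x := z) (y := ⟨i, x⟩) (z := ⟨i, y⟩) (u := u) (v := 𝟙 i) _).trans ?_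
  refine (comp₂_eq (whiskerLeft_pre_mapId_grComp X u.toLoc z.ob x y) _).trans ?_
  refine (Category.assoc _ _ _).trans (congrArg (_ ≫ ·) ?_)
  exact pre_grι (y := ⟨i, y⟩) (Bicategory.rightUnitor u.toLoc).hom

variable (X) in
/-- The inclusion of `X(i)` into the Grothendieck construction. -/
def grIncl (i : I) : X.obj ⟨i⟩ ⟶ (Gr X).cat where
  obj x := GrOb.mk i x
  map x y := grInclMap x y
  map_id x := by
    refine (Category.assoc _ _ _).symm.trans (congrArg (· ≫ _) ?_)
    exact (ucomp_eq_pre _ _).symm.trans (ucomp_eId _)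
  map_comp x y z := by
    have h := ι_grInclMap_mul (GrOb.mk i x : GrOb X) y z (𝟙 i)
    have e : (grInclMap (X := X) x y ⊗ₘ grInclMap y z) =
        pre ((X.mapId ⟨i⟩).app x) y ▷ _ ≫ (grι (GrOb.mk i x : GrOb X) ⟨i, y⟩ (𝟙 i) ⊗ₘ
          grInclMap y z) := (whiskerRight_comp_tensorHom _ _ _).symm
    refine Eq.trans ?_ (comp₂_eq e.symm _)
    refine Eq.trans ?_ (congrArg (_ ≫ ·) h.symm)
    refine (Category.assoc _ _ _).symm.trans ((congrArg (· ≫ _) ?_).trans (Category.assoc _ _ _))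
    exact comp_pre _

/-- The morphism `(x, i) ⟶ (X(u)(x), j)` of degree `u : i ⟶ j` given by the identity of
`X(u)(x)`. -/
def grGen {i j : I} (u : i ⟶ j) (x : X.obj ⟨i⟩) :
    𝟙_ V ⟶ ((grIncl X i).obj x ⟶[V] (grIncl X j).obj ((X.map u.toLoc).obj x)) :=
  eId V ((X.map u.toLoc).obj x) ≫ grι (GrOb.mk i x : GrOb X) ⟨j, (X.map u.toLoc).obj x⟩ u

/-- Every morphism of degree `u` is the composite of `grGen u` and a morphism of degree one. -/
lemma grIncl_pre_grGen {i j : I} (u : i ⟶ j) (x : X.obj ⟨i⟩) (y : X.obj ⟨j⟩) :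
    (grIncl X j).map ((X.map u.toLoc).obj x) y ≫ pre (grGen u x) ((grIncl X j).obj y) =
      grι (GrOb.mk i x : GrOb X) ⟨j, y⟩ u := by
  refine (Category.assoc _ _ _).trans ((congrArg (_ ≫ ·) (grMul_left (x := ⟨i, x⟩)
    (x' := ⟨j, (X.map u.toLoc).obj x⟩) (y := ⟨j, y⟩) (u := u) (v := 𝟙 j) _)).trans ?_)
  refine (congrArg (_ ≫ ·)
    (comp₃_eq (eId_whiskerRight_grComp X u.toLoc (𝟙 _) x y) _)).trans ?_
  have h1 : _ = ucomp _ (ucomp _ (eId V _)) :=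
    congrArg (fun α => VNat.app α x) (X.map₂_rightUnitor u.toLoc)
  rw [ucomp_eId] at h1
  refine (Category.assoc _ _ _).symm.trans (Eq.trans (congrArg (· ≫ _) ?_)
    (pre_grι (x := ⟨i, x⟩) (y := ⟨j, y⟩) (Bicategory.rightUnitor u.toLoc).hom))
  exact (pre_ucomp _ _ _).symm.trans (congrArg (fun m => pre m y) h1.symm)

lemma grIncl_post_grGen {i j : I} (u : i ⟶ j) (x y : X.obj ⟨i⟩) :
    (grIncl X i).map x y ≫ post ((grIncl X i).obj x) (grGen u y) =
      (X.map u.toLoc).map x y ≫ grι (GrOb.mk i x : GrOb X) ⟨j, (X.map u.toLoc).obj y⟩ u := by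
  refine (Category.assoc _ _ _).trans ((congrArg (_ ≫ ·) (grMul_right (x := ⟨i, x⟩)
    (y := ⟨i, y⟩) (y' := ⟨j, (X.map u.toLoc).obj y⟩) (u := 𝟙 i) (v := u) _)).trans ?_)
  refine (congrArg (_ ≫ ·)
    (comp₃_eq (whiskerLeft_eId_grComp X (𝟙 _) u.toLoc x y) _)).trans ?_
  have h1 : _ = ucomp _ (ucomp (VCat.el (X.map u.toLoc) _) (eId V _)) :=
    congrArg (fun α => VNat.app α x) (X.map₂_leftUnitor u.toLoc)
  rw [ucomp_eId] at h1
  have h2 : pre ((X.mapId ⟨i⟩).app x) y ≫ (X.map u.toLoc).map _ _ = _ :=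
    map_pre (X.map u.toLoc) y ((X.mapId ⟨i⟩).app x)
  have h3 := pre_grι (x := ⟨i, x⟩) (y := ⟨j, (X.map u.toLoc).obj y⟩)
    (Bicategory.leftUnitor u.toLoc).hom
  refine Eq.trans ?_ (congrArg (_ ≫ ·) h3)
  rw [h1, pre_ucomp]
  refine (Category.assoc _ _ _).symm.trans (Eq.trans ?_ (Category.assoc _ _ _))
  refine congrArg (· ≫ _) ?_
  refine (Category.assoc _ _ _).symm.trans (Eq.trans ?_ (Category.assoc _ _ _))
  exact congrArg (· ≫ _) h2

variable (X) in
/-- The morphisms `grGen u` as a `V`-natural transformation. -/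
def grGenNat {i j : I} (u : i ⟶ j) : grIncl X i ⟶ X.map u.toLoc ≫ grIncl X j where
  app x := grGen u x
  naturality x y := (grIncl_post_grGen u x y).trans
    ((congrArg (_ ≫ ·) (grIncl_pre_grGen u x _).symm).trans (Category.assoc _ _ _).symm)

lemma grGen_ucomp_incl {i j : I} (u : i ⟶ j) (x : X.obj ⟨i⟩) {y : X.obj ⟨j⟩}
    (g : 𝟙_ V ⟶ ((X.map u.toLoc).obj x ⟶[V] y)) :
    ucomp (grGen u x) (VCat.el (grIncl X j) g) = g ≫ grι (GrOb.mk i x : GrOb X) ⟨j, y⟩ u :=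
  (ucomp_eq_pre _ _).trans ((Category.assoc _ _ _).trans
    (congrArg (g ≫ ·) (grIncl_pre_grGen u x y)))

lemma grGen_id (i : I) (x : X.obj ⟨i⟩) :
    ucomp (grGen (𝟙 i) x) (VCat.el (grIncl X i) ((X.mapId ⟨i⟩).app x)) =
      eId V ((grIncl X i).obj x) :=
  grGen_ucomp_incl (𝟙 i) x _

lemma grGen_comp {i j k : I} (u : i ⟶ j) (v : j ⟶ k) (x : X.obj ⟨i⟩) :
    ucomp (grGen (u ≫ v) x) (VCat.el (grIncl X k) ((X.mapComp u.toLoc v.toLoc).app x)) =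
      ucomp (grGen u x) (grGen v ((X.map u.toLoc).obj x)) := by
  refine (grGen_ucomp_incl (u ≫ v) x _).trans ?_
  refine Eq.trans ?_ (ucomp_eq_post _ _).symm
  refine Eq.trans ?_ (Category.assoc _ _ _).symm
  refine Eq.trans ?_ (congrArg (_ ≫ ·) (grMul_right (x := ⟨i, x⟩)
    (y := ⟨j, (X.map u.toLoc).obj x⟩) (y' := ⟨k, _⟩) (u := u) (v := v) _)).symm
  refine Eq.trans ?_ (congrArg (_ ≫ ·)
    (comp₃_eq (whiskerLeft_eId_grComp X u.toLoc v.toLoc x _) _)).symm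
  refine Eq.trans (congrArg (· ≫ _) ?_) ((Category.assoc _ _ _))
  refine Eq.trans ?_ (Category.assoc _ _ _)
  refine Eq.trans ?_ (congrArg (· ≫ _) (EnrichedFunctor.map_id _ _).symm)
  exact (ucomp_eId _).symm.trans (ucomp_eq_pre _ _)

/-- A family of morphisms is `V`-natural between `V`-functors out of the Grothendieck construction
if it is so on the `X(i)` and on the generators `grGen u`. -/
def grNatMk {C : VCat.{w} V} {H K : (Gr X).cat ⟶ C}
    (app : ∀ i, grIncl X i ≫ H ⟶ grIncl X i ≫ K)
    (gen : ∀ {i j : I} (u : i ⟶ j) (x : X.obj ⟨i⟩),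
      ucomp (VCat.el H (grGen u x)) ((app j).app ((X.map u.toLoc).obj x)) =
        ucomp ((app i).app x) (VCat.el K (grGen u x))) : H ⟶ K where
  app x := (app x.deg).app x.ob
  naturality x y := by
    obtain ⟨i, x⟩ := x
    obtain ⟨j, y⟩ := y
    refine Sigma.hom_ext _ _ fun u => ?_
    have h := (app j).naturality ((X.map u.toLoc).obj x) y
    have e (M : (Gr X).cat ⟶ C) : grι (GrOb.mk i x : GrOb X) ⟨j, y⟩ u ≫ M.map _ _ =
        (grIncl X j ≫ M).map ((X.map u.toLoc).obj x) y ≫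
          pre (VCat.el M (grGen u x)) (M.obj ⟨j, y⟩) := by
      refine (congrArg (· ≫ _) (grIncl_pre_grGen u x y).symm).trans ?_
      refine (Category.assoc _ _ _).trans (Eq.trans ?_ (Category.assoc _ _ _).symm)
      exact congrArg (_ ≫ ·) (map_pre M _ _)
    refine (comp₂_eq (e H) _).trans (Eq.trans ?_ (comp₂_eq (e K) _).symm)
    refine (Category.assoc _ _ _).trans (Eq.trans ?_ (Category.assoc _ _ _).symm)
    refine (congrArg (_ ≫ ·) (pre_post _ _)).trans ?_
    refine (Category.assoc _ _ _).symm.trans ((congrArg (· ≫ _) h).trans ?_)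
    refine (Category.assoc _ _ _).trans (congrArg (_ ≫ ·) ?_)
    exact (pre_ucomp _ _ _).symm.trans ((congrArg (fun m => pre m _) (gen u x)).trans
      (pre_ucomp _ _ _))

end GrGenerators

/-! ### `V`-functors out of the Grothendieck construction -/

noncomputable section GrDesc

variable {V : Type u} [Category.{v} V] [MonoidalCategory V] [SymmetricCategory V]
  [HasCoproducts.{w} V]
  [∀ (A : V) (J : Type w), PreservesColimitsOfShape (Discrete J) (tensorLeft A)]
  {I : Type w} [SmallCategory I] {X Y : OplaxFunctor (LocallyDiscrete I) (VCat.{w} V)}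

variable (X) in
/-- A lax cocone under an oplax functor `X`, with vertex a `V`-category `C`. -/
structure GrCocone (C : VCat.{w} V) where
  /-- the legs of the cocone -/
  leg (i : I) : X.obj ⟨i⟩ ⟶ C
  /-- the comparison of the legs -/
  cell {i j : I} (u : i ⟶ j) : leg i ⟶ X.map u.toLoc ≫ leg j
  cell_id (i : I) (x : X.obj ⟨i⟩) :
    ucomp ((cell (𝟙 i)).app x) (VCat.el (leg i) ((X.mapId ⟨i⟩).app x)) = eId V ((leg i).obj x)
  cell_comp {i j k : I} (u : i ⟶ j) (v : j ⟶ k) (x : X.obj ⟨i⟩) :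
    ucomp ((cell (u ≫ v)).app x) (VCat.el (leg k) ((X.mapComp u.toLoc v.toLoc).app x)) =
      ucomp ((cell u).app x) ((cell v).app ((X.map u.toLoc).obj x))

namespace GrCocone

variable {C : VCat.{w} V} (T : GrCocone X C)

/-- The effect of `desc` on the component of degree `u` of a morphism object. -/
abbrev descComp {x y : GrOb X} (u : x.deg ⟶ y.deg) :
    grComponent x y u ⟶ ((T.leg x.deg).obj x.ob ⟶[V] (T.leg y.deg).obj y.ob) :=
  (T.leg y.deg).map ((X.map u.toLoc).obj x.ob) y.ob ≫
    pre ((T.cell u).app x.ob) ((T.leg y.deg).obj y.ob)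

/-- The effect of `desc` on morphism objects. -/
abbrev descMap (x y : GrOb X) :
    (∐ grComponent x y) ⟶ ((T.leg x.deg).obj x.ob ⟶[V] (T.leg y.deg).obj y.ob) :=
  Sigma.desc fun u => T.descComp u

lemma ι_descMap {x y : GrOb X} (u : x.deg ⟶ y.deg) :
    grι x y u ≫ T.descMap x y = T.descComp u := Sigma.ι_desc _ _

/-- Compatibility of `desc` with composition. This is the computation for the map of Grothendieck
constructions induced by a left transformation, with the identity of `C` in place of the second
oplax functor. -/
lemma grComp_descComp {x y z : GrOb X} (u : x.deg ⟶ y.deg) (v : y.deg ⟶ z.deg) :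
    grComp X u.toLoc v.toLoc x.ob y.ob z.ob ≫ T.descComp (x := x) (y := z) (u ≫ v) =
      (T.descComp u ⊗ₘ T.descComp v) ≫ eComp V ((T.leg x.deg).obj x.ob)
        ((T.leg y.deg).obj y.ob) ((T.leg z.deg).obj z.ob) := by
  have h := grMap_comp_aux (F := T.leg y.deg) (G := X.map v.toLoc) (G' := fid C)
    (F' := T.leg z.deg) (p := (X.map u.toLoc).obj x.ob) (y := y.ob)
    (k := (T.leg x.deg).obj x.ob) (z := z.ob) (T.cell v).app
    ((congrArg (· ≫ _) (Category.comp_id _)).trans ((T.cell v).naturality _ _))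
    ((X.mapComp u.toLoc v.toLoc).app x.ob) ((T.cell (u ≫ v)).app x.ob)
    ((T.cell u).app x.ob) (eId V _) (by
      refine (T.cell_comp u v x.ob).trans ?_
      exact (congrArg (ucomp · _) (Category.comp_id _).symm).trans (eId_ucomp _).symm)
  refine Eq.trans h ?_
  refine congrArg (_ ≫ ·) ?_
  refine (congrArg (_ ≫ ·) (congrArg (_ ≫ ·) (pre_eId _ _))).trans ?_
  simp

/-- The `V`-functor out of the Grothendieck construction given by a lax cocone. -/
def desc : (Gr X).cat ⟶ C where
  obj x := (T.leg x.deg).obj x.ob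
  map x y := T.descMap x y
  map_id x := by
    refine (Category.assoc _ _ _).trans ((congrArg (_ ≫ ·) (T.ι_descMap (x := x) (y := x)
      (𝟙 _))).trans ?_)
    refine (Category.assoc _ _ _).symm.trans ?_
    exact (ucomp_eq_pre _ _).symm.trans (T.cell_id x.deg x.ob)
  map_comp x y z := by
    refine tensor_sigma_ext fun u v => ?_
    refine (comp₂_eq (tensorHom_grMul u v) _).trans ?_
    refine (Category.assoc _ _ _).trans ((congrArg (_ ≫ ·) (T.ι_descMap (u ≫ v))).trans ?_)
    refine (T.grComp_descComp u v).trans ?_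
    refine Eq.trans ?_ (comp₂_eq (tensorHom_comp_tensorHom _ _ _ _) _).symm
    exact (congrArg (· ≫ _) (congrArg₂ (· ⊗ₘ ·) (T.ι_descMap u) (T.ι_descMap v))).symm

lemma grIncl_desc {i : I} (x y : X.obj ⟨i⟩) :
    (grIncl X i).map x y ≫ T.desc.map _ _ = (T.leg i).map x y := by
  refine (Category.assoc _ _ _).trans ((congrArg (_ ≫ ·) (T.ι_descMap (x := ⟨i, x⟩)
    (y := ⟨i, y⟩) (𝟙 _))).trans ?_)
  refine (Category.assoc _ _ _).symm.trans ((congrArg (· ≫ _) (map_pre (T.leg i) _ _)).trans ?_)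
  refine (Category.assoc _ _ _).trans (Eq.trans (congrArg (_ ≫ ·) ?_) (Category.comp_id _))
  exact (pre_ucomp _ _ _).symm.trans ((congrArg (fun m => pre m _) (T.cell_id i x)).trans
    (pre_eId _ _))

lemma el_desc_grGen {i j : I} (u : i ⟶ j) (x : X.obj ⟨i⟩) :
    VCat.el T.desc (grGen u x) = (T.cell u).app x := by
  refine (Category.assoc _ _ _).trans ((congrArg (_ ≫ ·) (T.ι_descMap (x := ⟨i, x⟩)
    (y := ⟨j, _⟩) u)).trans ?_)
  refine (Category.assoc _ _ _).symm.trans ((congrArg (· ≫ _)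
    (EnrichedFunctor.map_id _ _)).trans ?_)
  exact (ucomp_eq_pre _ _).symm.trans (ucomp_eId _)

end GrCocone

lemma grIncl_grMap (F : X ⟶ Y) {i : I} (x y : X.obj ⟨i⟩) :
    (grIncl X i).map x y ≫ (grMap F).fn.map _ _ =
      (Oplax.LaxTrans.app F ⟨i⟩).map x y ≫ (grIncl Y i).map _ _ := by
  have h : ucomp _ (VCat.el (Oplax.LaxTrans.app F ⟨i⟩) _) = ucomp _ (ucomp (eId V _) (eId V _)) :=
    congrArg (fun α => VNat.app α x) (Oplax.LaxTrans.naturality_id F ⟨i⟩)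
  rw [ucomp_eId, ucomp_eId] at h
  refine (Category.assoc _ _ _).trans ((congrArg (_ ≫ ·) (ι_grMapHom F ⟨i, x⟩
    ⟨i, y⟩ (𝟙 _))).trans ?_)
  refine (Category.assoc _ _ _).symm.trans (Eq.trans (congrArg (· ≫ _) ?_) (Category.assoc _ _ _))
  refine (Category.assoc _ _ _).symm.trans
    ((congrArg (· ≫ _) (map_pre (Oplax.LaxTrans.app F ⟨i⟩) _ _)).trans ?_)
  refine (Category.assoc _ _ _).trans (congrArg (_ ≫ ·) ?_)
  exact (pre_ucomp _ _ _).symm.trans (congrArg (fun m => pre m _) h)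

lemma el_grMap_grGen (F : X ⟶ Y) {i j : I} (u : i ⟶ j) (x : X.obj ⟨i⟩) :
    VCat.el (grMap F).fn (grGen u x) = ucomp (grGen u ((Oplax.LaxTrans.app F ⟨i⟩).obj x))
      (VCat.el (grIncl Y j) ((Oplax.LaxTrans.naturality F u.toLoc).app x)) := by
  refine (Category.assoc _ _ _).trans ((congrArg (_ ≫ ·) (ι_grMapHom F ⟨i, x⟩
    ⟨j, _⟩ u)).trans ?_)
  refine Eq.trans ?_ (grGen_ucomp_incl u _ _).symm
  refine (Category.assoc _ _ _).symm.trans (congrArg (· ≫ _) ?_)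
  refine (Category.assoc _ _ _).symm.trans ((congrArg (· ≫ _)
    (EnrichedFunctor.map_id _ _)).trans ?_)
  exact (ucomp_eq_pre _ _).symm.trans (ucomp_eId _)

end GrDesc

/-! ### Homogeneous morphisms -/

noncomputable section Homogeneous

variable {V : Type u} [Category.{v} V] [MonoidalCategory V] [SymmetricCategory V]
  [HasCoproducts.{w} V]
  [∀ (A : V) (J : Type w), PreservesColimitsOfShape (Discrete J) (tensorLeft A)]
  [HasFiniteLimits V] {I : Type w} [SmallCategory I]

namespace GradedCat

variable {E E' : GradedCat V I}

/-- A family `f` of morphisms from `a` to `b`, indexed by an object `A` of `V`, is homogeneous with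
respect to `u` and `v` if it satisfies the equation that defines the morphism object of `E ↓ i` from
`(a, u)` to `(b, v)`. Informally, the degree of `f`, followed by `v`, is `u`. -/
def IsHomog {a b : E.cat} {i : I} {A : V} (f : A ⟶ (a ⟶[V] b)) (u : E.deg a ⟶ i)
    (v : E.deg b ⟶ i) : Prop :=
  f ≫ E.coact a b ≫ _ ◁ push _ v = f ≫ (ρ_ _).inv ≫ _ ◁ single u

lemma IsHomog.precomp {a b : E.cat} {i : I} {A B : V} {f : A ⟶ (a ⟶[V] b)} {u : E.deg a ⟶ i}
    {v : E.deg b ⟶ i} (h : IsHomog f u v) (g : B ⟶ A) : IsHomog (g ≫ f) u v := by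
  rw [IsHomog, Category.assoc, Category.assoc]
  exact congrArg (g ≫ ·) h

lemma IsHomog.congr_left {a b : E.cat} {i : I} {A : V} {f : A ⟶ (a ⟶[V] b)} {u u' : E.deg a ⟶ i}
    {v : E.deg b ⟶ i} (h : IsHomog f u v) (hu : u = u') : IsHomog f u' v := hu ▸ h

lemma IsHomog.pre {a b c : E.cat} {i : I} {A : V} {g : A ⟶ (b ⟶[V] c)}
    {f : 𝟙_ V ⟶ (a ⟶[V] b)} {u : E.deg a ⟶ i} {v : E.deg b ⟶ i} {w : E.deg c ⟶ i}
    (hf : IsHomog f u v) (hg : IsHomog g v w) : IsHomog (g ≫ pre f c) u w := by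
  have h : IsHomog _ u w := comp_condition_aux u v w hf hg
  have e : g ≫ GradedV.pre f c = (λ_ _).inv ≫ (f ⊗ₘ g) ≫ eComp V a b c := by
    rw [GradedV.pre, leftUnitor_inv_naturality_assoc, MonoidalCategory.tensorHom_def',
      Category.assoc]
  rw [e]
  exact h.precomp _

lemma post_tpair_free {C : VCat.{w} V} {a b : C} {i j k : I} (p : i ⟶ j) :
    post (C := tensorCat C (freeCat V I)) (a := (b, ⟨i⟩)) (b := (b, ⟨j⟩)) (a, ⟨k⟩)
      (tpair (eId V b) (single p)) = (a ⟶[V] b) ◁ push (V := V) k p := by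
  refine (post_tensor (C := C) (D := freeCat V I) _ _ _ _).trans ?_
  rw [post_eId]
  exact id_tensorHom _ _

/-- The `V`-naturality of the comparison `1 ⊗ d` of coactions, spelled out. -/
lemma twist_natural_iff (T : E.cat ⟶ E'.cat) {x y : E.cat} {i j : I} (p : i ⟶ E.deg x)
    (q : j ⟶ E.deg y) {m : (T.obj x ⟶[V] T.obj y) ⟶ (T.obj x ⟶[V] T.obj y) ⊗ freeObj V (i ⟶ j)} :
    ((T.map x y ≫ m) ≫ post (C := tensorCat E'.cat (freeCat V I)) (a := (T.obj y, ⟨j⟩))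
        (b := (T.obj y, ⟨E.deg y⟩)) (T.obj x, ⟨i⟩) (tpair (eId V (T.obj y)) (single q)) =
      (E.coact x y ≫ T.map x y ▷ _) ≫ pre (C := tensorCat E'.cat (freeCat V I))
        (a := (T.obj x, ⟨i⟩)) (b := (T.obj x, ⟨E.deg x⟩)) (tpair (eId V (T.obj x)) (single p))
        (T.obj y, ⟨E.deg y⟩)) ↔
    T.map x y ≫ m ≫ _ ◁ push i q = E.coact x y ≫ (T.map x y ⊗ₘ pre (V := V) (C := FreeOb I)
      (a := ⟨i⟩) (b := ⟨E.deg x⟩) (single p) ⟨E.deg y⟩) := by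
  have h1 := post_tpair_free (a := T.obj x) (b := T.obj y) (k := i) q
  have h2 := pre_tensor (C := E'.cat) (D := freeCat V I) (T.obj y) ⟨E.deg y⟩ (eId V (T.obj x))
    (a' := ⟨i⟩) (b' := ⟨E.deg x⟩) (single p)
  rw [pre_eId, id_tensorHom] at h2
  have h2' := (congrArg ((E.coact x y ≫ T.map x y ▷ _) ≫ ·) h2)
  have h1' := (congrArg ((T.map x y ≫ m) ≫ ·) h1)
  rw [MonoidalCategory.tensorHom_def]
  constructor
  · intro h
    refine (Category.assoc _ _ _).symm.trans ((h1'.symm.trans (h.trans h2')).trans ?_)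
    exact Category.assoc _ _ _
  · intro h
    refine h1'.trans (((Category.assoc _ _ _).trans (h.trans ?_)).trans h2'.symm)
    exact (Category.assoc _ _ _).symm

/-- The condition on a 2-morphism says that its components are homogeneous. -/
lemma comm_iff_isHomog {F G : E ⟶ E'} {x : E.cat} {p : E'.deg (F.fn.obj x) ⟶ E.deg x}
    {q : E'.deg (G.fn.obj x) ⟶ E.deg x}
    (hp : F.twist.app x = tpair (eId V (F.fn.obj x)) (single p))
    (hq : G.twist.app x = tpair (eId V (G.fn.obj x)) (single q))
    (f : 𝟙_ V ⟶ (F.fn.obj x ⟶[V] G.fn.obj x)) :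
    (ucomp (C := tensorCat E'.cat (freeCat V I)) (a := (F.fn.obj x, ⟨E'.deg (F.fn.obj x)⟩))
        (b := (G.fn.obj x, ⟨E'.deg (G.fn.obj x)⟩)) (c := (G.fn.obj x, ⟨E.deg x⟩))
        (f ≫ E'.coact _ _) (G.twist.app x) =
      ucomp (C := tensorCat E'.cat (freeCat V I)) (a := (F.fn.obj x, ⟨E'.deg (F.fn.obj x)⟩))
        (b := (F.fn.obj x, ⟨E.deg x⟩)) (c := (G.fn.obj x, ⟨E.deg x⟩))
        (F.twist.app x) (tpair f (single (𝟙 (E.deg x))))) ↔ IsHomog f p q := by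
  rw [hp, hq]
  have h1 : ucomp (C := tensorCat E'.cat (freeCat V I))
      (a := (F.fn.obj x, ⟨E'.deg (F.fn.obj x)⟩))
      (b := (G.fn.obj x, ⟨E'.deg (G.fn.obj x)⟩)) (c := (G.fn.obj x, ⟨E.deg x⟩))
      (f ≫ E'.coact _ _) (tpair (eId V (G.fn.obj x)) (single q)) =
      f ≫ E'.coact _ _ ≫ _ ◁ push _ q :=
    (ucomp_eq_post _ _).trans ((congrArg (_ ≫ ·) (post_tpair_free q)).trans
      (Category.assoc _ _ _))
  have h2 := ucomp_tensor_free (C := E'.cat) (eId V (F.fn.obj x)) p f (𝟙 (E.deg x))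
  rw [eId_ucomp, Category.comp_id] at h2
  have h3 : tpair f (single p) = f ≫ (ρ_ _).inv ≫ _ ◁ single p := by
    rw [rightUnitor_inv_naturality_assoc, tpair, MonoidalCategory.tensorHom_def, unitors_inv_equal]
  exact ⟨fun h => h1.symm.trans (h.trans (h2.trans h3)),
    fun h => h1.trans (Eq.trans h (h2.trans h3).symm)⟩

end GradedCat

variable {X : OplaxFunctor (LocallyDiscrete I) (VCat.{w} V)} {E : GradedCat V I}

/-- On the component of degree `u` of a morphism object of the Grothendieck construction, the
coaction is `1 ⊗ u`, so that the naturality of a twist is a homogeneity condition. -/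
lemma grCoact_tensorHom_iff (T : (Gr X).cat ⟶ E.cat) (x y : GrOb X)
    (p : E.deg (T.obj x) ⟶ x.deg) (q : E.deg (T.obj y) ⟶ y.deg) :
    (T.map x y ≫ E.coact _ _ ≫ _ ◁ GradedCat.push _ q =
      (Gr X).coact x y ≫ (T.map x y ⊗ₘ pre (V := V) (C := FreeOb I)
      (a := ⟨E.deg (T.obj x)⟩) (b := ⟨x.deg⟩) (single p) ⟨y.deg⟩)) ↔
    ∀ u : x.deg ⟶ y.deg, GradedCat.IsHomog (grι x y u ≫ T.map x y) (p ≫ u) q := by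
  have e (u : x.deg ⟶ y.deg) : grι x y u ≫ (Gr X).coact x y ≫ (T.map x y ⊗ₘ
      pre (V := V) (C := FreeOb I) (a := ⟨E.deg (T.obj x)⟩) (b := ⟨x.deg⟩) (single p) ⟨y.deg⟩) =
      (grι x y u ≫ T.map x y) ≫ (ρ_ _).inv ≫ _ ◁ single (p ≫ u) := by
    refine (comp₂_eq (ι_grCoact x y u) _).trans ((Category.assoc _ _ _).trans ?_)
    refine (congrArg (_ ≫ ·) (tensorHom_comp_tensorHom _ _ _ _)).trans ?_
    have h : single (V := V) u ≫ pre (V := V) (C := FreeOb I) (a := ⟨E.deg (T.obj x)⟩)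
        (b := ⟨x.deg⟩) (single p) ⟨y.deg⟩ = single (p ≫ u) :=
      (ucomp_eq_pre (V := V) (C := FreeOb I) (a := ⟨E.deg (T.obj x)⟩) (b := ⟨x.deg⟩)
        (c := ⟨y.deg⟩) (single p) (single u)).symm.trans (GradedCat.single_comp_eComp p u)
    refine (congrArg (fun m => _ ≫ (_ ⊗ₘ m)) h).trans ?_
    rw [rightUnitor_inv_naturality_assoc, MonoidalCategory.tensorHom_def]
  constructor
  · intro h u
    refine (Category.assoc _ _ _).trans ((congrArg (grι x y u ≫ ·) h).trans (e u))
  · intro h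
    refine Sigma.hom_ext _ _ fun u => ?_
    exact (Category.assoc _ _ _).symm.trans (Eq.trans (h u) (e u).symm)

lemma isHomog_of_twist (H : Gr X ⟶ E) {x y : GrOb X} {p : E.deg (H.fn.obj x) ⟶ x.deg}
    {q : E.deg (H.fn.obj y) ⟶ y.deg}
    (hp : H.twist.app x = tpair (eId V (H.fn.obj x)) (single p))
    (hq : H.twist.app y = tpair (eId V (H.fn.obj y)) (single q)) (u : x.deg ⟶ y.deg) :
    GradedCat.IsHomog (grι x y u ≫ H.fn.map x y) (p ≫ u) q := by
  have h := H.twist.naturality x y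
  rw [hp, hq] at h
  exact (grCoact_tensorHom_iff H.fn x y p q).1
    ((GradedCat.twist_natural_iff (E := Gr X) H.fn p q).1 h) u

/-- A left morphism out of the Grothendieck construction, given by a `V`-functor that is compatible
with the degrees on every component. -/
abbrev leftMorMk (T : (Gr X).cat ⟶ E.cat) (d : ∀ x, E.deg (T.obj x) ⟶ (Gr X).deg x)
    (h : ∀ (x y : GrOb X) (u : x.deg ⟶ y.deg),
      GradedCat.IsHomog (grι x y u ≫ T.map x y) (d x ≫ u) (d y)) : Gr X ⟶ E where
  fn := T
  twist :=
    { app x := tpair (eId V (T.obj x)) (single (d x))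
      naturality x y := (GradedCat.twist_natural_iff (E := Gr X) T (d x) (d y)).2
        ((grCoact_tensorHom_iff T x y (d x) (d y)).2 (h x y)) }
  exists_deg := ⟨d, fun _ => rfl⟩

end Homogeneous

/-! ### Lifting to the categories `E ↓ i` -/

noncomputable section Lifting

variable {V : Type u} [Category.{v} V] [MonoidalCategory V] [SymmetricCategory V]
  [HasCoproducts.{w} V]
  [∀ (A : V) (J : Type w), PreservesColimitsOfShape (Discrete J) (tensorLeft A)]
  [HasFiniteLimits V] {I : Type w} [SmallCategory I]

namespace GradedCat

variable {E : GradedCat V I}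

lemma IsHomog.of_eq {a b : E.cat} {i : I} {A : V} {f g : A ⟶ (a ⟶[V] b)} {u : E.deg a ⟶ i}
    {v : E.deg b ⟶ i} (h : IsHomog f u v) (e : f = g) : IsHomog g u v := e ▸ h

/-- A homogeneous family of morphisms of `E` as a family of morphisms of `E ↓ i`. -/
def commaLift {i : I} {x y : CommaOb E i} {A : V} (f : A ⟶ (x.ob ⟶[V] y.ob))
    (h : IsHomog f x.hom y.hom) : A ⟶ (x ⟶[V] y) :=
  equalizer.lift f h

lemma commaLift_forget {i : I} {x y : CommaOb E i} {A : V} (f : A ⟶ (x.ob ⟶[V] y.ob))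
    (h : IsHomog f x.hom y.hom) : commaLift f h ≫ (forget E i).map x y = f :=
  equalizer.lift_ι _ _

lemma isHomog_forget {i : I} {x y : CommaOb E i} {A : V} (f : A ⟶ (x ⟶[V] y)) :
    IsHomog (f ≫ (forget E i).map x y) x.hom y.hom :=
  IsHomog.precomp (commaι_condition x y) f

/-- A `V`-functor to `E` whose values on morphisms are homogeneous as a `V`-functor to `E ↓ i`. -/
def commaLiftFunctor {C : VCat.{w} V} {i : I} (T : C ⟶ E.cat) (d : ∀ x, E.deg (T.obj x) ⟶ i)
    (h : ∀ x y, IsHomog (T.map x y) (d x) (d y)) : C ⟶ comma E i where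
  obj x := ⟨T.obj x, d x⟩
  map x y := commaLift (x := ⟨T.obj x, d x⟩) (y := ⟨T.obj y, d y⟩) (T.map x y) (h x y)
  map_id x := by
    refine comma_ext ?_
    rw [Category.assoc, commaLift_forget, T.map_id]
    exact ((forget E i).map_id ⟨T.obj x, d x⟩).symm
  map_comp x y z := by
    refine comma_ext ?_
    rw [Category.assoc, Category.assoc, commaLift_forget, (forget E i).map_comp,
      tensorHom_comp_tensorHom_assoc, commaLift_forget, commaLift_forget, T.map_comp]

/-- A `V`-natural transformation between `V`-functors to `E ↓ i` given by homogeneous morphisms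
of `E`. -/
def commaLiftNat {C : VCat.{w} V} {i : I} {F G : C ⟶ comma E i}
    (α : F ≫ forget E i ⟶ G ≫ forget E i)
    (h : ∀ x, IsHomog (α.app x) (F.obj x).hom (G.obj x).hom) : F ⟶ G where
  app x := commaLift (x := F.obj x) (y := G.obj x) (α.app x) (h x)
  naturality x y := by
    refine comma_ext ?_
    rw [Category.assoc, Category.assoc, map_post, map_pre, commaLift_forget, commaLift_forget,
      ← Category.assoc, ← Category.assoc]
    exact α.naturality x y

lemma el_forget_injective {i : I} {x y : CommaOb E i} {f g : 𝟙_ V ⟶ (x ⟶[V] y)}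
    (h : VCat.el (forget E i) f = VCat.el (forget E i) g) : f = g := comma_ext h

lemma el_forget_commaMap {i j : I} (u : i ⟶ j) {x y : CommaOb E i} (f : 𝟙_ V ⟶ (x ⟶[V] y)) :
    VCat.el (forget E j) (VCat.el (commaMap E u) f) = VCat.el (forget E i) f :=
  (Category.assoc _ _ _).trans (congrArg (f ≫ ·) (commaMap_forget u x y))

end GradedCat

open GradedCat

variable {X : OplaxFunctor (LocallyDiscrete I) (VCat.{w} V)} {E : GradedCat V I}

section

variable (H : Gr X ⟶ E) (d : ∀ x : GrOb X, E.deg (H.fn.obj x) ⟶ x.deg)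
  (hd : ∀ x, H.twist.app x = tpair (eId V (H.fn.obj x)) (single (d x)))

/-- The `V`-functor `X(i) ⟶ E ↓ i` given by a left morphism out of the Grothendieck construction. -/
def restrictApp (i : I) : X.obj ⟨i⟩ ⟶ comma E i :=
  commaLiftFunctor (grIncl X i ≫ H.fn) (fun x => d ⟨i, x⟩) fun x y => by
    have h := isHomog_of_twist H (hd ⟨i, x⟩) (hd ⟨i, y⟩) (𝟙 i)
    exact ((h.congr_left (Category.comp_id _)).precomp (pre ((X.mapId ⟨i⟩).app x) y)).of_eq
      (Category.assoc _ _ _).symm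

lemma restrictApp_forget (i : I) (x y : X.obj ⟨i⟩) :
    (restrictApp H d hd i).map x y ≫ (forget E i).map _ _ = (grIncl X i ≫ H.fn).map x y :=
  commaLift_forget _ _

lemma el_forget_restrictApp {i : I} {x y : X.obj ⟨i⟩} (f : 𝟙_ V ⟶ (x ⟶[V] y)) :
    VCat.el (forget E i) (VCat.el (restrictApp H d hd i) f) =
      VCat.el H.fn (VCat.el (grIncl X i) f) :=
  (Category.assoc _ _ _).trans ((congrArg (f ≫ ·) (restrictApp_forget H d hd i x y)).trans
    (Category.assoc _ _ _).symm)

/-- The `V`-natural transformation of `V`-functors `X(i) ⟶ E ↓ j` given by the images of the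
generators `grGen u`. -/
def restrictCell {i j : I} (u : i ⟶ j) :
    restrictApp H d hd i ≫ commaMap E u ⟶ X.map u.toLoc ≫ restrictApp H d hd j :=
  commaLiftNat
    { app x := VCat.el H.fn (grGen u x)
      naturality x y := by
        have h := (Bicategory.whiskerRight (grGenNat X u) H.fn).naturality x y
        refine (congrArg (· ≫ _) ?_).trans (Eq.trans h (congrArg (· ≫ _) ?_))
        · refine (Category.assoc _ _ _).trans ?_
          refine (congrArg (_ ≫ ·) (commaMap_forget _ _ _)).trans ?_
          exact restrictApp_forget H d hd i x y
        · refine (Category.assoc _ _ _).trans (Eq.trans ?_ (Category.assoc _ _ _).symm)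
          exact congrArg ((X.map u.toLoc).map x y ≫ ·)
            (restrictApp_forget H d hd j _ _).symm } fun x => by
    have h := (isHomog_of_twist H (hd ⟨i, x⟩) (hd ⟨j, (X.map u.toLoc).obj x⟩) u).precomp
      (eId V ((X.map u.toLoc).obj x))
    exact h.of_eq (Category.assoc _ _ _).symm

lemma el_forget_restrictCell {i j : I} (u : i ⟶ j) (x : X.obj ⟨i⟩) :
    VCat.el (forget E j) ((restrictCell H d hd u).app x) = VCat.el H.fn (grGen u x) :=
  commaLift_forget _ _

/-- The left transformation `X ⟶ Γ(μ)` given by a left morphism `Gr(X) ⟶ μ`. Its axioms are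
checked after inclusion into `E`, where they are the images of the relations between the generators
of `Gr(X)` and the structure 2-cells of `Γ(μ)` become identities. -/
def restrict : X ⟶ Gamma E where
  app a := restrictApp H d hd a.as
  naturality f := restrictCell H d hd f.as
  naturality_naturality {a b f g} η := by
    obtain rfl := LocallyDiscrete.eq_of_hom η
    obtain rfl : η = 𝟙 f := Subsingleton.elim _ _
    rw [X.map₂_id, (Gamma E).map₂_id]
    refine (congrArg (_ ≫ ·) (Bicategory.id_whiskerRight _ _)).trans ((Category.comp_id _).trans ?_)
    exact ((congrArg (· ≫ _) (Bicategory.whiskerLeft_id _ _)).trans (Category.id_comp _)).symm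
  naturality_id a := by
    refine VCat.hom_ext fun x => el_forget_injective ?_
    refine (VCat.el_ucomp (forget E a.as) _ _).trans ?_
    refine (congrArg₂ ucomp (el_forget_restrictCell H d hd (𝟙 a.as) x)
      (el_forget_restrictApp H d hd _)).trans ?_
    refine (VCat.el_ucomp _ _ _).symm.trans ?_
    refine (congrArg (VCat.el H.fn) (grGen_id a.as x)).trans ?_
    refine (VCat.el_eId _ _).trans ?_
    refine (commaId_forget (H.fn.obj ⟨a.as, x⟩) (Category.comp_id (d ⟨a.as, x⟩))).symm.trans ?_
    have e : ((Gamma E).mapId a).app ((restrictApp H d hd a.as).obj x) =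
        (Bicategory.whiskerLeft (restrictApp H d hd a.as) ((Gamma E).mapId a) ≫
          (Bicategory.rightUnitor _).hom ≫ (Bicategory.leftUnitor _).inv).app x :=
      (ucomp_eId _).symm.trans (congrArg (ucomp _ ·) (ucomp_eId _).symm)
    exact congrArg (VCat.el (forget E a.as)) e
  naturality_comp {a b c} f g := by
    refine VCat.hom_ext fun x => el_forget_injective ?_
    refine (VCat.el_ucomp (forget E c.as) _ _).trans ?_
    refine (congrArg₂ ucomp (el_forget_restrictCell H d hd (f.as ≫ g.as) x)
      (el_forget_restrictApp H d hd _)).trans ?_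
    refine (VCat.el_ucomp _ _ _).symm.trans ?_
    refine (congrArg (VCat.el H.fn) (grGen_comp f.as g.as x)).trans ?_
    refine (VCat.el_ucomp _ _ _).trans ?_
    have e : ucomp (C := comma E c.as) (((Gamma E).mapComp f g).app
        ((restrictApp H d hd a.as).obj x)) (ucomp (C := comma E c.as)
          (VCat.el (commaMap E g.as) ((restrictCell H d hd f.as).app x))
          ((restrictCell H d hd g.as).app ((X.map f).obj x))) =
        (Bicategory.whiskerLeft (restrictApp H d hd a.as) ((Gamma E).mapComp f g) ≫
          (Bicategory.associator _ _ _).inv ≫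
          Bicategory.whiskerRight (restrictCell H d hd f.as) ((Gamma E).map g) ≫
          (Bicategory.associator _ _ _).hom ≫
          Bicategory.whiskerLeft (X.map f) (restrictCell H d hd g.as) ≫
          (Bicategory.associator _ _ _).inv).app x := by
      refine congrArg (ucomp _ ·) ?_
      refine Eq.trans ?_ (eId_ucomp _).symm
      refine congrArg (ucomp _ ·) ?_
      refine Eq.trans ?_ (eId_ucomp _).symm
      exact (ucomp_eId _).symm
    refine Eq.trans ?_ (congrArg (VCat.el (forget E c.as)) e)
    refine Eq.trans ?_ (VCat.el_ucomp (forget E c.as)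
      (((Gamma E).mapComp f g).app ((restrictApp H d hd a.as).obj x))
      (ucomp (C := comma E c.as) (VCat.el (commaMap E g.as) ((restrictCell H d hd f.as).app x))
        ((restrictCell H d hd g.as).app ((X.map f).obj x)))).symm
    have e1 : VCat.el (forget E c.as)
        (((Gamma E).mapComp f g).app ((restrictApp H d hd a.as).obj x)) =
          eId V (H.fn.obj ⟨a.as, x⟩) := commaId_forget _ (Category.assoc _ _ _).symm
    refine Eq.trans ?_ (congrArg (ucomp · _) e1).symm
    refine Eq.trans ?_ (eId_ucomp _).symm
    refine Eq.trans ?_ (VCat.el_ucomp (forget E c.as)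
      (VCat.el (commaMap E g.as) ((restrictCell H d hd f.as).app x))
      ((restrictCell H d hd g.as).app ((X.map f).obj x))).symm
    refine congrArg₂ ucomp ?_ (el_forget_restrictCell H d hd g.as _).symm
    refine Eq.trans ?_ (el_forget_commaMap g.as ((restrictCell H d hd f.as).app x)).symm
    exact (el_forget_restrictCell H d hd f.as x).symm

end

end Lifting

/-! ### Comparison with the transported oplax functor -/

section TransportMap

variable {V : Type u} [Category.{v} V] [MonoidalCategory V]
  {B : Type w₁} [Bicategory.{w₂, w₃} B]

namespace VCat

lemma iso_hom_inv_app {C D : VCat.{w} V} {F G : C ⟶ D} (α : F ⟶ G) [IsIso α] (x : C) :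
    ucomp (α.app x) ((inv α).app x) = eId V (F.obj x) :=
  congrArg (fun α => VNat.app α x) (IsIso.hom_inv_id α)

lemma iso_inv_hom_app {C D : VCat.{w} V} {F G : C ⟶ D} (α : F ⟶ G) [IsIso α] (x : C) :
    ucomp ((inv α).app x) (α.app x) = eId V (G.obj x) :=
  congrArg (fun α => VNat.app α x) (IsIso.inv_hom_id α)

/-- Naturality of the inverse of the unit of an adjunction. -/
lemma inv_unit_nat {C D : VCat.{w} V} {l : C ⟶ D} {r : D ⟶ C} (adj : Bicategory.Adjunction l r)
    [IsIso adj.unit] {x y : C} (f : 𝟙_ V ⟶ (x ⟶[V] y)) :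
    ucomp (el r (el l f)) ((inv adj.unit).app y) = ucomp ((inv adj.unit).app x) f :=
  (congrArg (ucomp · _) (comp_el₂ _ _ _).symm).trans ((nat_el (inv adj.unit) f).trans
    (congrArg (ucomp _ ·) (Category.comp_id f)))

/-- The left adjoint sends the inverse of the unit to the counit. -/
lemma el_inv_unit {C D : VCat.{w} V} {l : C ⟶ D} {r : D ⟶ C} (adj : Bicategory.Adjunction l r)
    [IsIso adj.unit] (x : C) :
    el l ((inv adj.unit).app x) = adj.counit.app (l.obj x) := by
  have h := (el_ucomp l (adj.unit.app x) ((inv adj.unit).app x)).symm.trans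
    ((congrArg (el l) (iso_hom_inv_app adj.unit x)).trans (el_eId l x))
  have h' := (el_ucomp l ((inv adj.unit).app x) (adj.unit.app x)).symm.trans
    ((congrArg (el l) (iso_inv_hom_app adj.unit x)).trans (el_eId l _))
  calc el l ((inv adj.unit).app x) = ucomp (el l ((inv adj.unit).app x)) (eId V _) :=
        (ucomp_eId _).symm
    _ = ucomp (el l ((inv adj.unit).app x)) (ucomp (el l (adj.unit.app x))
        (adj.counit.app (l.obj x))) := congrArg (ucomp _ ·) (adj_left adj x).symm
    _ = ucomp (ucomp (el l ((inv adj.unit).app x)) (el l (adj.unit.app x)))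
        (adj.counit.app (l.obj x)) := (ucomp_assoc _ _ _).symm
    _ = ucomp (eId V _) (adj.counit.app (l.obj x)) := congrArg (ucomp · _) h'
    _ = _ := eId_ucomp _

variable (G : OplaxFunctor B (VCat.{w} V)) (C : B → VCat.{w} V) (r : ∀ a, C a ⟶ G.obj a)
  (l : ∀ a, G.obj a ⟶ C a) (adj : ∀ a, Bicategory.Adjunction (l a) (r a))
  [hu : ∀ a, IsIso (adj a).unit]

/-- The component at `f` of the left transformation from an oplax functor to a transported one:
the inverse of the unit, inserted in the middle. -/
noncomputable def toTransportCell {a b : B} (f : a ⟶ b) :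
    l a ≫ r a ≫ G.map f ≫ l b ⟶ G.map f ≫ l b :=
  (Bicategory.associator _ _ _).inv ≫ Bicategory.whiskerRight (inv (adj a).unit) (G.map f ≫ l b) ≫
    (Bicategory.leftUnitor _).hom

lemma toTransportCell_app {a b : B} (f : a ⟶ b) (x : G.obj a) :
    (toTransportCell G C r l adj f).app x =
      el (l b) (el (G.map f) ((inv (adj a).unit).app x)) := by
  refine (eId_ucomp _).trans ((ucomp_eId _).trans ?_)
  exact comp_el₂ _ _ _

/-- If the units of the adjunctions are invertible, the left adjoints form a left transformation
to the transported oplax functor. -/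
noncomputable def toTransport : G ⟶ transport G C r l adj where
  app a := l a
  naturality f := toTransportCell G C r l adj f
  naturality_naturality {a b f g} η := by
    refine hom_ext fun x => ?_
    have h := nat_el (G.map₂ η) ((inv (adj a).unit).app x)
    refine (congrArg (ucomp · _) (toTransportCell_app G C r l adj f x)).trans ?_
    refine Eq.trans ?_ (congrArg (ucomp _ ·) (toTransportCell_app G C r l adj g x)).symm
    exact el_sq (l b) h
  naturality_id a := by
    refine hom_ext fun x => ?_
    have h := nat_el (G.mapId a) ((inv (adj a).unit).app x)
    refine (congrArg (ucomp · _) (toTransportCell_app G C r l adj (𝟙 a) x)).trans ?_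
    refine (el_sq (l a) (h.trans (congrArg (ucomp _ ·) (Category.comp_id _)))).trans ?_
    refine (congrArg (ucomp _ ·) (el_inv_unit (adj a) x)).trans ?_
    refine (transportId_app G C r l adj a _).symm.trans ?_
    exact (ucomp_eId _).symm.trans (congrArg (ucomp _ ·) (ucomp_eId _).symm)
  naturality_comp {a b c} f g := by
    refine hom_ext fun x => ?_
    have h := nat_el (G.mapComp f g) ((inv (adj a).unit).app x)
    have h2 := unit_nat (adj b) (el (G.map f) ((inv (adj a).unit).app x))
    have h3 := iso_hom_inv_app (adj b).unit ((G.map f).obj x)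
    have e : ucomp ((transportComp G C r l adj f g).app ((l a).obj x))
        (ucomp (el (r b ≫ G.map g ≫ l c) ((toTransportCell G C r l adj f).app x))
          ((toTransportCell G C r l adj g).app ((G.map f).obj x))) =
        (Bicategory.whiskerLeft (l a) (transportComp G C r l adj f g) ≫
          (Bicategory.associator _ _ _).inv ≫
          Bicategory.whiskerRight (toTransportCell G C r l adj f) (r b ≫ G.map g ≫ l c) ≫
          (Bicategory.associator _ _ _).hom ≫
          Bicategory.whiskerLeft (G.map f) (toTransportCell G C r l adj g) ≫
          (Bicategory.associator _ _ _).inv).app x := by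
      refine congrArg (ucomp _ ·) ?_
      refine Eq.trans ?_ (eId_ucomp _).symm
      refine congrArg (ucomp _ ·) ?_
      refine Eq.trans ?_ (eId_ucomp _).symm
      exact (ucomp_eId _).symm
    refine Eq.trans ?_ e
    refine (congrArg (ucomp · _) (toTransportCell_app G C r l adj (f ≫ g) x)).trans ?_
    refine Eq.trans ?_ (congrArg₂ ucomp (transportComp_app G C r l adj f g _).symm
      (congrArg₂ ucomp ((congrArg (el (r b ≫ G.map g ≫ l c))
        (toTransportCell_app G C r l adj f x)).trans (comp_el (r b) (G.map g) (l c) _)).symm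
        (toTransportCell_app G C r l adj g _).symm))
    refine Eq.trans ?_ (congrArg (ucomp _ ·) (el_ucomp (l c) _ _))
    refine Eq.trans ?_ (el_ucomp (l c) _ _)
    refine (el_ucomp (l c) _ _).symm.trans (congrArg (el (l c)) ?_)
    refine h.trans ?_
    refine Eq.trans ?_ (ucomp_assoc _ _ _).symm
    refine congrArg (ucomp _ ·) ?_
    refine (comp_el₂ _ _ _).trans ?_
    refine Eq.trans ?_ (congrArg (ucomp _ ·) (el_ucomp (G.map g) _ _))
    refine Eq.trans (congrArg (el (G.map g)) ?_) (el_ucomp (G.map g) _ _)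
    refine Eq.trans ?_ (ucomp_assoc _ _ _)
    refine Eq.trans ?_ (congrArg (ucomp · _) h2)
    refine Eq.trans ?_ (ucomp_assoc _ _ _).symm
    exact (ucomp_eId _).symm.trans (congrArg (ucomp _ ·) h3.symm)

end VCat

end TransportMap

/-! ### The morphism `Gr(Γ_cof(μ)) ⟶ μ` and the functor it induces -/

section AdjunctionElements

variable {V : Type u} [Category.{v} V] [MonoidalCategory V]

namespace VCat

variable {C D : VCat.{w} V} {l : C ⟶ D} {r : D ⟶ C} (adj : Bicategory.Adjunction l r)

lemma unit_transpose {x : C} {y : D} (f : 𝟙_ V ⟶ (x ⟶[V] r.obj y)) :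
    ucomp (adj.unit.app x) (el r (ucomp (el l f) (adj.counit.app y))) = f := by
  refine (congrArg (ucomp _ ·) (el_ucomp r _ _)).trans ?_
  refine (ucomp_assoc _ _ _).symm.trans ?_
  refine (congrArg (ucomp · _) (unit_nat adj f).symm).trans ?_
  refine (ucomp_assoc _ _ _).trans ?_
  exact (congrArg (ucomp f ·) (adj_right adj y)).trans (ucomp_eId f)

lemma counit_transpose {x : C} {y : D} (g : 𝟙_ V ⟶ (l.obj x ⟶[V] y)) :
    ucomp (el l (ucomp (adj.unit.app x) (el r g))) (adj.counit.app y) = g := by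
  refine (congrArg (ucomp · _) (el_ucomp l _ _)).trans ?_
  refine (ucomp_assoc _ _ _).trans ?_
  refine (congrArg (ucomp _ ·) (counit_nat adj g)).trans ?_
  refine (ucomp_assoc _ _ _).symm.trans ?_
  exact (congrArg (ucomp · g) (adj_left adj x)).trans (eId_ucomp g)

lemma transpose_injective {x : C} {y : D} {g g' : 𝟙_ V ⟶ (l.obj x ⟶[V] y)}
    (h : ucomp (adj.unit.app x) (el r g) = ucomp (adj.unit.app x) (el r g')) : g = g' :=
  (counit_transpose adj g).symm.trans ((congrArg (fun f => ucomp (el l f) _) h).trans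
    (counit_transpose adj g'))

lemma ucomp_el_ucomp (F : C ⟶ D) {a : D} {x y z : C} (f : 𝟙_ V ⟶ (a ⟶[V] F.obj x))
    (g : 𝟙_ V ⟶ (x ⟶[V] y)) (k : 𝟙_ V ⟶ (y ⟶[V] z)) :
    ucomp f (el F (ucomp g k)) = ucomp (ucomp f (el F g)) (el F k) :=
  (congrArg (ucomp f ·) (el_ucomp F g k)).trans (ucomp_assoc _ _ _).symm

/-- The `V`-natural transformation given by inverses of the components of a `V`-natural
transformation. -/
def natInv {F G : C ⟶ D} (α : F ⟶ G) (b : ∀ x, 𝟙_ V ⟶ (G.obj x ⟶[V] F.obj x))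
    (h : ∀ x, ucomp (α.app x) (b x) = eId V (F.obj x))
    (h' : ∀ x, ucomp (b x) (α.app x) = eId V (G.obj x)) : G ⟶ F where
  app := b
  naturality x y := by
    have e (c : D) : pre (α.app x) c ≫ pre (b x) c = 𝟙 _ := by rw [← pre_ucomp, h', pre_eId]
    have e' (c : D) : post c (α.app y) ≫ post c (b y) = 𝟙 _ := by rw [← post_ucomp, h, post_eId]
    calc G.map x y ≫ post (G.obj x) (b y)
        = (G.map x y ≫ pre (α.app x) (G.obj y)) ≫ pre (b x) _ ≫ post _ (b y) := by
          rw [Category.assoc, reassoc_of% (e (G.obj y))]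
      _ = (F.map x y ≫ post _ (α.app y)) ≫ post _ (b y) ≫ pre (b x) _ := by
          rw [α.naturality, pre_post]
      _ = _ := by rw [Category.assoc, reassoc_of% (e' (F.obj x))]

end VCat

end AdjunctionElements

noncomputable section Counit

variable {V : Type u} [Category.{v} V] [MonoidalCategory V] [SymmetricCategory V]
  [HasCoproducts.{w} V]
  [∀ (A : V) (J : Type w), PreservesColimitsOfShape (Discrete J) (tensorLeft A)]
  [HasFiniteLimits V] {I : Type w} [SmallCategory I] {E : GradedCat V I}

open GradedCat

variable (E) in
/-- The inclusion of the fibre over `i` into `E`. -/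
abbrev fibreForget (i : I) : E.fibre i ⟶ E.cat := E.incl i ≫ forget E i

lemma el_fibreForget {i : I} {x y : E.fibre i} (f : 𝟙_ V ⟶ (x ⟶[V] y)) :
    VCat.el (fibreForget E i) f = VCat.el (forget E i) (VCat.el (E.incl i) f) :=
  VCat.comp_el₂ _ _ _

lemma el_fibreForget_injective {i : I} {x y : E.fibre i} {f g : 𝟙_ V ⟶ (x ⟶[V] y)}
    (h : VCat.el (fibreForget E i) f = VCat.el (fibreForget E i) g) : f = g := by
  rw [el_fibreForget, el_fibreForget] at h
  exact (Category.comp_id f).symm.trans ((el_forget_injective h).trans (Category.comp_id g))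

variable (P : Precofibered E)

/-- The `V`-natural transformation of `V`-functors `E|_i ⟶ E` given by the unit at the objects
`(e, u)`. -/
def cofCell {i j : I} (u : i ⟶ j) :
    fibreForget E i ⟶ P.GammaCof.map u.toLoc ≫ fibreForget E j where
  app x := VCat.el (forget E j) ((P.adj j).unit.app ((commaMap E u).obj ((E.incl i).obj x)))
  naturality x y := by
    have h := (Bicategory.whiskerLeft (E.incl i ≫ commaMap E u)
      (Bicategory.whiskerRight (P.adj j).unit (forget E j))).naturality x y
    refine (congrArg (· ≫ _) ?_).trans (Eq.trans h (congrArg (· ≫ _) ?_))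
    · refine Eq.trans ?_ (Category.assoc _ _ _).symm
      refine congrArg (_ ≫ ·) ?_
      refine Eq.trans ?_ (congrArg (_ ≫ ·) (Category.id_comp _).symm)
      exact (commaMap_forget u _ _).symm
    · have e {a b c d e f : V} (k : a ⟶ b) (l : b ⟶ c) (m : c ⟶ d) (n : d ⟶ e) (p : e ⟶ f) :
          (k ≫ l) ≫ (m ≫ n) ≫ p = (k ≫ l ≫ m) ≫ n ≫ p := by simp only [Category.assoc]
      exact e _ _ _ _ _

/-- The fibres of `E` form a lax cocone under `Γ_cof(μ)` with vertex `E`. -/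
def cofCocone : GrCocone P.GammaCof E.cat where
  leg i := fibreForget E i
  cell u := cofCell P u
  cell_id i x := by
    have h1 := VCat.transportId_app (Gamma E) (fun i => E.fibre i.as) (fun i => E.incl i.as)
      (fun i => P.s i.as) (fun i => P.adj i.as) ⟨i⟩ x
    have h2 := VCat.unit_transpose (P.adj i) (((Gamma E).mapId ⟨i⟩).app ((E.incl i).obj x))
    refine (congrArg (ucomp _ ·) ((congrArg (VCat.el (fibreForget E i)) h1).trans
      (el_fibreForget _))).trans ?_
    refine (VCat.el_ucomp (forget E i) _ _).symm.trans ?_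
    refine (congrArg (VCat.el (forget E i)) h2).trans ?_
    exact commaId_forget x.ob (Category.comp_id _)
  cell_comp {i j k} u v x := by
    have h1 := VCat.transportComp_app (Gamma E) (fun i => E.fibre i.as) (fun i => E.incl i.as)
      (fun i => P.s i.as) (fun i => P.adj i.as) u.toLoc v.toLoc x
    have h2 := VCat.unit_nat (P.adj k) (ucomp
      (((Gamma E).mapComp u.toLoc v.toLoc).app ((E.incl i).obj x)) (VCat.el (commaMap E v)
        ((P.adj j).unit.app ((commaMap E u).obj ((E.incl i).obj x)))))
    refine (congrArg (ucomp _ ·) ((congrArg (VCat.el (fibreForget E k)) h1).trans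
      (el_fibreForget _))).trans ?_
    refine (VCat.el_ucomp (forget E k) _ _).symm.trans ?_
    refine (congrArg (VCat.el (forget E k)) h2.symm).trans ?_
    refine (VCat.el_ucomp (forget E k) _ _).trans ?_
    refine congrArg (ucomp · _) ?_
    refine (VCat.el_ucomp (forget E k) _ _).trans ?_
    refine (congrArg (ucomp · _) (commaId_forget x.ob (Category.assoc _ _ _).symm)).trans ?_
    refine (eId_ucomp _).trans ?_
    exact el_forget_commaMap v ((P.adj j).unit.app ((commaMap E u).obj ((E.incl i).obj x)))

/-- The universal left morphism `Gr(Γ_cof(μ)) ⟶ μ`. -/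
def cofCounit : Gr P.GammaCof ⟶ E :=
  leftMorMk (cofCocone P).desc (fun x => eqToHom (FibreOb.deg_eq x.ob)) fun x y u => by
    have h : IsHomog (E := E) ((cofCocone P).descComp u)
        (eqToHom (FibreOb.deg_eq (E := E) x.ob) ≫ u) (eqToHom (FibreOb.deg_eq (E := E) y.ob)) :=
      IsHomog.pre (isHomog_forget _) (isHomog_forget _)
    exact h.of_eq ((cofCocone P).ι_descMap u).symm

variable {X : OplaxFunctor (LocallyDiscrete I) (VCat.{w} V)}

section

variable {P} (F : X ⟶ P.GammaCof)

/-- The component at `i` of a left transformation to `Γ_cof(μ)`. -/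
abbrev cofApp (i : I) : X.obj ⟨i⟩ ⟶ E.fibre i := Oplax.LaxTrans.app F ⟨i⟩

/-- The value at `F` of the functor `F ↦ ε ∘ Gr(F)`. -/
abbrev cofMor : Gr X ⟶ E := grMap F ≫ cofCounit P

/-- The twist of `ε ∘ Gr(F)` is the identification of the degree of an object of a fibre. -/
lemma cofMor_twist (x : GrOb X) : (cofMor F).twist.app x =
    tpair (eId V ((cofMor F).fn.obj x))
      (single (eqToHom (FibreOb.deg_eq ((cofApp F x.deg).obj x.ob)))) := by
  refine (congrArg (ucomp (C := tensorCat E.cat (freeCat V I)) _ ·)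
    ((tensorMap (cofCounit P).fn (freeCat V I)).map_id _)).trans ?_
  exact ucomp_eId (C := tensorCat E.cat (freeCat V I)) _

/-- On `X(i)`, the `V`-functor underlying `ε ∘ Gr(F)` is the component of `F`, followed by the
inclusion of the fibre. -/
lemma grIncl_cofMor (i : I) (x y : X.obj ⟨i⟩) :
    (grIncl X i ≫ (cofMor F).fn).map x y = (cofApp F i ≫ fibreForget E i).map x y := by
  refine (Category.assoc _ _ _).symm.trans ((congrArg (· ≫ _) (grIncl_grMap F x y)).trans ?_)
  refine (Category.assoc _ _ _).trans (congrArg (_ ≫ ·) ?_)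
  exact (cofCocone P).grIncl_desc _ _

/-- On the generators, `ε ∘ Gr(F)` is the transpose of the structure 2-cell of `F`. -/
lemma el_cofMor_grGen {i j : I} (u : i ⟶ j) (x : X.obj ⟨i⟩) :
    VCat.el (cofMor F).fn (grGen u x) = VCat.el (forget E j)
      (ucomp ((P.adj j).unit.app ((commaMap E u).obj ((E.incl i).obj ((cofApp F i).obj x))))
        (VCat.el (E.incl j) ((Oplax.LaxTrans.naturality F u.toLoc).app x))) := by
  refine (Category.assoc _ _ _).symm.trans ?_
  refine (congrArg (VCat.el (cofCocone P).desc) (el_grMap_grGen F u x)).trans ?_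
  refine (VCat.el_ucomp (cofCocone P).desc _ _).trans ?_
  refine Eq.trans ?_ (VCat.el_ucomp (forget E j)
    ((P.adj j).unit.app ((commaMap E u).obj ((E.incl i).obj ((cofApp F i).obj x))))
    (VCat.el (E.incl j) ((Oplax.LaxTrans.naturality F u.toLoc).app x))).symm
  refine congrArg₂ ucomp ((cofCocone P).el_desc_grGen u _) ?_
  refine (Category.assoc _ _ _).trans ?_
  refine (congrArg (_ ≫ ·) ((cofCocone P).grIncl_desc _ _)).trans ?_
  exact el_fibreForget _

end

variable (X) in
/-- The functor `F ↦ ε ∘ Gr(F)`. -/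
abbrev cofFunctor : (X ⟶ P.GammaCof) ⥤ (Gr X ⟶ E) :=
  Gr.homFunctor X P.GammaCof ⋙ Bicategory.postcomp (Gr X) (cofCounit P)

lemma cofFunctor_map_app {F G : X ⟶ P.GammaCof} (m : F ⟶ G) (i : I) (x : X.obj ⟨i⟩) :
    (LeftMor₂.nat ((cofFunctor P X).map m)).app ⟨i, x⟩ =
      VCat.el (fibreForget E i) ((Oplax.LaxTrans.Modification.app m.as ⟨i⟩).app x) := by
  have e : grEl (X := P.GammaCof) ((Oplax.LaxTrans.Modification.app m.as ⟨i⟩).app x) =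
    VCat.el (grIncl P.GammaCof i) ((Oplax.LaxTrans.Modification.app m.as ⟨i⟩).app x) :=
    Category.assoc _ _ _
  refine (congrArg (VCat.el (cofCocone P).desc) e).trans ?_
  refine (Category.assoc _ _ _).trans ?_
  exact congrArg (_ ≫ ·) ((cofCocone P).grIncl_desc _ _)

instance cofFunctor_faithful : (cofFunctor P X).Faithful where
  map_injective {F G m n} h := by
    refine Oplax.LaxTrans.homCategory.ext fun a => VCat.hom_ext fun x => ?_
    refine el_fibreForget_injective (E := E) (i := a.as) ?_
    refine (cofFunctor_map_app P m a.as x).symm.trans (Eq.trans ?_ (cofFunctor_map_app P n a.as x))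
    exact congrArg (fun ξ : LeftMor₂ (cofMor F) (cofMor G) => ξ.nat.app ⟨a.as, x⟩) h

/-- The inclusion of the fibre is fully faithful, so it reflects `V`-natural transformations. -/
def inclReflect {C : VCat.{w} V} {i : I} {F G : C ⟶ E.fibre i}
    (α : F ≫ E.incl i ⟶ G ≫ E.incl i) : F ⟶ G where
  app x := α.app x
  naturality x y := by
    refine (congrArg (· ≫ _) (Category.comp_id _).symm).trans (Eq.trans (α.naturality x y) ?_)
    exact congrArg (· ≫ _) (Category.comp_id _)

section

variable {P} {F G : X ⟶ P.GammaCof} (ξ : LeftMor₂ (cofMor F) (cofMor G))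

/-- The component at `i` of the modification given by a 2-morphism `ε ∘ Gr(F) ⟶ ε ∘ Gr(G)`. -/
def cofModApp (i : I) : cofApp F i ⟶ cofApp G i :=
  inclReflect (commaLiftNat
    { app x := ξ.nat.app ⟨i, x⟩
      naturality x y := by
        have h := (Bicategory.whiskerLeft (grIncl X i) ξ.nat).naturality x y
        have eF := (grIncl_cofMor F i x y).trans (Category.assoc _ _ _).symm
        have eG := (grIncl_cofMor G i x y).trans (Category.assoc _ _ _).symm
        exact (congrArg (· ≫ _) eF.symm).trans (Eq.trans h (congrArg (· ≫ _) eG)) } fun x =>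
      (comm_iff_isHomog (cofMor_twist F ⟨i, x⟩) (cofMor_twist G ⟨i, x⟩) _).1
        (ξ.comm_app ⟨i, x⟩))

lemma el_cofModApp (i : I) (x : X.obj ⟨i⟩) :
    VCat.el (forget E i) (VCat.el (E.incl i) ((cofModApp ξ i).app x)) = ξ.nat.app ⟨i, x⟩ :=
  (congrArg (· ≫ _) (Category.comp_id _)).trans (commaLift_forget _ _)

/-- The components form a modification: after transposition along `s_j ⊣ i_j` and inclusion into
`E`, this is the naturality of the 2-morphism on the generator `grGen u x`. -/
lemma cofModApp_naturality {i j : I} (u : i ⟶ j) (x : X.obj ⟨i⟩) :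
    ucomp (VCat.el (P.GammaCof.map u.toLoc) ((cofModApp ξ i).app x))
        ((Oplax.LaxTrans.naturality G u.toLoc).app x) =
      ucomp ((Oplax.LaxTrans.naturality F u.toLoc).app x)
        ((cofModApp ξ j).app ((X.map u.toLoc).obj x)) := by
  refine VCat.transpose_injective (P.adj j) (el_forget_injective ?_)
  have h := VCat.nat_el ξ.nat (grGen u x)
  rw [el_cofMor_grGen, el_cofMor_grGen] at h
  have hn := VCat.unit_nat (P.adj j) (VCat.el (commaMap E u)
    (VCat.el (E.incl i) ((cofModApp ξ i).app x)))
  have e1 : VCat.el (P.GammaCof.map u.toLoc) ((cofModApp ξ i).app x) = VCat.el (P.s j)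
      (VCat.el (commaMap E u) (VCat.el (E.incl i) ((cofModApp ξ i).app x))) :=
    VCat.comp_el (E.incl i) (commaMap E u) (P.s j) ((cofModApp ξ i).app x)
  rw [e1]
  refine (congrArg (fun m => VCat.el (forget E j) (ucomp _ m))
    (VCat.el_ucomp (E.incl j) _ _)).trans ?_
  refine (congrArg (VCat.el (forget E j)) ((ucomp_assoc _ _ _).symm.trans
    ((congrArg (ucomp · _) hn.symm).trans (ucomp_assoc _ _ _)))).trans ?_
  refine (VCat.el_ucomp (forget E j) _ _).trans ?_
  refine (congrArg (ucomp · _) ((el_forget_commaMap u _).trans (el_cofModApp ξ i x))).trans ?_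
  refine h.symm.trans ?_
  refine Eq.trans ?_ (congrArg (VCat.el (forget E j)) (VCat.ucomp_el_ucomp (E.incl j)
    ((P.adj j).unit.app ((commaMap E u).obj ((E.incl i).obj ((cofApp F i).obj x))))
    ((Oplax.LaxTrans.naturality F u.toLoc).app x)
    ((cofModApp ξ j).app ((X.map u.toLoc).obj x)))).symm
  refine Eq.trans ?_ (VCat.el_ucomp (forget E j)
    (ucomp (C := E.comma j)
      ((P.adj j).unit.app ((commaMap E u).obj ((E.incl i).obj ((cofApp F i).obj x))))
      (VCat.el (E.incl j) ((Oplax.LaxTrans.naturality F u.toLoc).app x)))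
    (VCat.el (E.incl j) ((cofModApp ξ j).app ((X.map u.toLoc).obj x)))).symm
  exact congrArg (ucomp _ ·) (el_cofModApp ξ j _).symm

end

instance cofFunctor_full : (cofFunctor P X).Full where
  map_surjective {F G} ξ := by
    refine ⟨⟨⟨fun a => cofModApp (P := P) ξ a.as, fun f => VCat.hom_ext fun x =>
      cofModApp_naturality (P := P) ξ f.as x⟩⟩, ?_⟩
    refine hom_ext₂ (VCat.hom_ext fun x => ?_)
    refine (cofFunctor_map_app P _ x.deg x.ob).trans ?_
    exact (el_fibreForget _).trans (el_cofModApp (P := P) ξ x.deg x.ob)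

section

variable [∀ i, IsIso (P.adj i).unit] (H : Gr X ⟶ E)
  (d : ∀ x : GrOb X, E.deg (H.fn.obj x) ⟶ x.deg)
  (hd : ∀ x, H.twist.app x = tpair (eId V (H.fn.obj x)) (single (d x)))

/-- The left transformation `X ⟶ Γ_cof(μ)` given by a left morphism `Gr(X) ⟶ μ`. -/
def cofRestrict : X ⟶ P.GammaCof :=
  restrict H d hd ≫ VCat.toTransport (Gamma E) (fun i => E.fibre i.as) (fun i => E.incl i.as)
    (fun i => P.s i.as) (fun i => P.adj i.as)
    (hu := fun i => inferInstanceAs (IsIso (P.adj i.as).unit))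

lemma cofRestrict_naturality {i j : I} (u : i ⟶ j) (x : X.obj ⟨i⟩) :
    (Oplax.LaxTrans.naturality (cofRestrict P H d hd) u.toLoc).app x =
      VCat.el (P.s j) (ucomp (VCat.el (commaMap E u)
        ((inv (P.adj i).unit).app ((restrictApp H d hd i).obj x)))
        ((restrictCell H d hd u).app x)) := by
  have h := VCat.toTransportCell_app (Gamma E) (fun i => E.fibre i.as) (fun i => E.incl i.as)
    (fun i => P.s i.as) (fun i => P.adj i.as)
    (hu := fun i => inferInstanceAs (IsIso (P.adj i.as).unit)) u.toLoc
    ((restrictApp H d hd i).obj x)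
  refine Eq.trans ?_ (VCat.el_ucomp (P.s j) _ _).symm
  refine Eq.trans ?_ (congrArg (ucomp · _) h)
  refine (eId_ucomp _).trans ?_
  refine congrArg (ucomp _ ·) ?_
  exact (eId_ucomp _).trans (ucomp_eId _)

/-- The inverses of the units, as a `V`-natural transformation between `V`-functors out of the
Grothendieck construction. -/
def cofRestrictNat : (cofMor (cofRestrict P H d hd)).fn ⟶ H.fn :=
  grNatMk (fun i =>
    { app x := VCat.el (forget E i) ((inv (P.adj i).unit).app ((restrictApp H d hd i).obj x))
      naturality x y := by
        have h := (Bicategory.whiskerLeft (restrictApp H d hd i)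
          (Bicategory.whiskerRight (inv (P.adj i).unit) (forget E i))).naturality x y
        refine (congrArg (· ≫ _) ?_).trans (Eq.trans h (congrArg (· ≫ _) ?_))
        · refine (grIncl_cofMor _ i x y).trans ?_
          refine (Category.assoc _ _ _).trans (congrArg (_ ≫ ·) ?_)
          exact (Category.assoc _ _ _).symm
        · refine (congrArg (_ ≫ ·) (Category.id_comp _)).trans ?_
          exact restrictApp_forget H d hd i x y }) fun {i j} u x => by
    have h := VCat.inv_unit_nat (P.adj j) (ucomp (VCat.el (commaMap E u)
        ((inv (P.adj i).unit).app ((restrictApp H d hd i).obj x)))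
        ((restrictCell H d hd u).app x))
    have h' := VCat.iso_hom_inv_app (P.adj j).unit ((commaMap E u).obj ((E.incl i).obj
      ((P.s i).obj ((restrictApp H d hd i).obj x))))
    -- By naturality the inverse of the unit moves past `s_j`, where it cancels the unit.
    refine (congrArg (ucomp · _) (el_cofMor_grGen _ u x)).trans ?_
    refine (congrArg (fun m => ucomp (VCat.el (forget E j) (ucomp _ (VCat.el (E.incl j) m))) _)
      (cofRestrict_naturality P H d hd u x)).trans ?_
    refine (VCat.el_ucomp (forget E j) _ _).symm.trans ?_
    refine (congrArg (VCat.el (forget E j)) ((ucomp_assoc _ _ _).trans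
      ((congrArg (ucomp _ ·) h).trans ((ucomp_assoc _ _ _).symm.trans
        ((congrArg (ucomp · _) h').trans (eId_ucomp _)))))).trans ?_
    refine (VCat.el_ucomp (forget E j) _ _).trans ?_
    exact congrArg₂ ucomp (el_forget_commaMap u _) (el_forget_restrictCell H d hd u x)

/-- Every left morphism `Gr(X) ⟶ μ` factors through `ε` up to isomorphism. -/
def cofRestrictIso : cofMor (cofRestrict P H d hd) ≅ H where
  hom := LeftMor₂.mk' (F := cofMor (cofRestrict P H d hd)) (G := H)
    (cofRestrictNat P H d hd) fun x =>
      (comm_iff_isHomog (cofMor_twist _ x) (hd x) _).2 (isHomog_forget _)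
  inv := LeftMor₂.mk' (F := H) (G := cofMor (cofRestrict P H d hd))
    (VCat.natInv (cofRestrictNat P H d hd) (fun x => VCat.el (forget E x.deg)
        ((P.adj x.deg).unit.app ((restrictApp H d hd x.deg).obj x.ob)))
      (fun x => (VCat.el_ucomp (forget E x.deg) _ _).symm.trans
        ((congrArg (VCat.el (forget E x.deg)) (VCat.iso_inv_hom_app _ _)).trans
          (VCat.el_eId _ _)))
      fun x => (VCat.el_ucomp (forget E x.deg) _ _).symm.trans
        ((congrArg (VCat.el (forget E x.deg)) (VCat.iso_hom_inv_app _ _)).trans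
          (VCat.el_eId _ _))) fun x =>
      (comm_iff_isHomog (hd x) (cofMor_twist _ x) _).2 (isHomog_forget _)
  hom_inv_id := hom_ext₂ (VCat.hom_ext fun x => (VCat.el_ucomp (forget E x.deg) _ _).symm.trans
    ((congrArg (VCat.el (forget E x.deg)) (VCat.iso_inv_hom_app _ _)).trans (VCat.el_eId _ _)))
  inv_hom_id := hom_ext₂ (VCat.hom_ext fun x => (VCat.el_ucomp (forget E x.deg) _ _).symm.trans
    ((congrArg (VCat.el (forget E x.deg)) (VCat.iso_hom_inv_app _ _)).trans (VCat.el_eId _ _)))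

end

lemma cofFunctor_essSurj (hunit : ∀ i, IsIso (P.adj i).unit) : (cofFunctor P X).EssSurj where
  mem_essImage H := by
    -- The morphisms `d` need not be determined by the twist; any choice will do.
    obtain ⟨d, hd⟩ := LeftMor.exists_deg H
    exact ⟨cofRestrict P H d hd, ⟨cofRestrictIso P H d hd⟩⟩

end Counit

end GradedV

theorem mainTheorem6 {V : Type u} [Category.{v} V] [MonoidalCategory V] [SymmetricCategory V]
    [HasCoproducts.{w} V]
    [∀ (A : V) (J : Type w), PreservesColimitsOfShape (Discrete J) (tensorLeft A)]
    [HasFiniteLimits V] {I : Type w} [SmallCategory I]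
    (E : GradedV.GradedCat V I) (P : E.Precofibered)
    (hcounit : ∀ i, IsIso (P.adj i).counit) (hunit : ∀ i, IsIso (P.adj i).unit) :
    ∃ ε : GradedV.Gr P.GammaCof ⟶ E,
      ∀ X : OplaxFunctor (LocallyDiscrete I) (GradedV.VCat.{w} V),
        ∃ Φ : (GradedV.Gr X ⟶ E) ≌ (X ⟶ P.GammaCof),
          Nonempty (Φ.inverse ≅
            GradedV.Gr.homFunctor X P.GammaCof ⋙ Bicategory.postcomp (GradedV.Gr X) ε) := by
  refine ⟨GradedV.cofCounit P, fun X => ?_⟩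
  have := GradedV.cofFunctor_essSurj (X := X) P hunit
  have : (GradedV.cofFunctor P X).IsEquivalence := {}
  exact ⟨(GradedV.cofFunctor P X).asEquivalence.symm, ⟨Iso.refl _⟩⟩
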